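/- Let $N,k\ge 0$ be integers and let $|\psi_N\rangle$ be any unit vector of $\bigotimes_{j=1}^N(\mathbb C^2)^{\otimes k}$: an $N$-party pure state in which party $j$ holds $k$ qubits ($k=1$: any $N$-qubit pure state; local dimension $d\le 2^k$: regard each $\mathbb C^d$ as a subspace of $(\mathbb C^2)^{\otimes k}$). Let $|\psi_N^*\rangle$ be its entrywise complex conjugate in the computational basis. A *site* is a pair $s=(j,i)$ with $1\le j\le N$, $1\le i\le k$; there are $n=Nk$ sites, listed party by party as $s_1,\dots,s_n$, with indices read modulo $n$. **Network experiments.** There are $N$ main parties $A_1,\dots,A_N$ and one auxiliary party $B$. All Hilbert spaces are finite-dimensional, of arbitrary dimension. The sources are independent: the state is $$|\Psi\rangle=\Big(\bigotimes_{j=1}^N|\Psi_j\rangle_{A_jB_j}\Big)\otimes|\tilde\Psi\rangle_{\tilde A_1\cdots\tilde A_N}$$ with unit vectors $|\Psi_j\rangle$, $|\tilde\Psi\rangle$. Main party $j$ holds $A_j\tilde A_j$ and party $B$ holds $B_1\cdots B_N$. All measurements are projective and otherwise arbitrary. - Main party $j$ has inputs $x\in\{0,\dots,5\}^k$ with output $a\in\{0,1\}^k$,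 and an input $\diamond$ with output $a_j=(a_{(j,i)})_i\in(\{0,1\}^2)^k$ and projectors $\mathsf M_{a_j|\diamond}$. - Party $B$ has inputs $y\in\{0,1,2\}^{n}$ with output $b\in\{0,1\}^{n}$ and projectors $\mathsf N_{b|y}$, and two inputs $\lozenge,\blacklozenge$ with one pair of bits as output for each $m\in\{1,\dots,\lfloor n/2\rfloor\}$. Let $A^{s}_{x}$ be the $\pm1$ observable of the output bit for site $s=(j,i)$ when $A_j$ receives $x$, and let $B^{s}_{y}=\sum_b(-1)^{b_s}\mathsf N_{b|y}$. Let $\mathsf N^{m}_{c|\lozenge}$, $\mathsf N^{m}_{c|\blacklozenge}$ be the projectors onto the result $c\in\{0,1\}^2$ for pair $m$. Write $\sigma_0=\sigma_z$, $\sigma_1=\sigma_x$, $\sigma_2=\sigma_y$, $\mathsf N'_{b|y}=\frac12(1+(-1)^b\sigma_y)$ (with $y\in\{0,1,2\}$ the index), $U_{00}=1$, $U_{01}=\sigma_z$, $U_{10}=\sigma_x$, $U_{11}=\sigma_z\sigma_x$, and $|\phi^+\rangle=\frac1{\sqrt2}(|00\rangle+|11\rangle)$. **Reference correlations for $|\psi_N\rangle$.**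 1. *3-CHSH violations.* For every site $s=(j,i)$, all inputs $x^0,\dots,x^5$ of $A_j$ with $x^m_i=m$, and all inputs $y^0,y^1,y^2$ of $B$ with $y^m_s=m$, $$\mathrm{CHSH}_s(x^0,x^1;y^0,y^1)+\mathrm{CHSH}_s(x^2,x^3;y^0,y^2)+\mathrm{CHSH}_s(x^4,x^5;y^1,y^2)=6\sqrt2,$$ where $\mathrm{CHSH}_s(x,x';y,y')=\langle A^s_xB^s_y\rangle+\langle A^s_xB^s_{y'}\rangle+\langle A^s_{x'}B^s_y\rangle-\langle A^s_{x'}B^s_{y'}\rangle$. 2. *Alignment.* Let $m\in\{1,\dots,\lfloor n/2\rfloor\}$ and $c=(c_1,c_2)\in\{0,1\}^2$. Let either $(s,t)=(s_{2m-1},s_{2m})$ and $P=\mathsf N^m_{c|\lozenge}$, or $(s,t)=(s_{2m},s_{2m+1})$ and $P=\mathsf N^m_{c|\blacklozenge}$. Then, whatever the inputs at the other sites, $$\Big\langle \tfrac{A^s_0+A^s_1}{\sqrt2}\,\tfrac{A^t_0+A^t_1}{\sqrt2}\otimes P\Big\rangle=\tfrac14(-1)^{c_2},\quad \Big\langle \tfrac{A^s_0-A^s_1}{\sqrt2}\,\tfrac{A^t_0-A^t_1}{\sqrt2}\otimes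 P\Big\rangle=\tfrac14(-1)^{c_1},$$ $$\Big\langle \tfrac{A^s_2-A^s_3}{\sqrt2}\,\tfrac{A^t_2-A^t_3}{\sqrt2}\otimes P\Big\rangle=\tfrac14(-1)^{c_1\oplus c_2\oplus 1}.$$ Here the products are expanded, and in each term $A^s_pA^t_q$ is measured with inputs whose entries at $s$ and $t$ are $p$ and $q$ and whose other entries are the same in all four terms. 3. *Teleportation tomography.* For all $a=(a_1,\dots,a_N)$, $y$, $b$, $$\langle\Psi|\bigotimes_{j}\mathsf M_{a_j|\diamond}\otimes\mathsf N_{b|y}|\Psi\rangle=\frac1{4^{n}}\langle\psi_N|\bigotimes_{s}U_{a_s}^\dagger\,\mathsf N'_{b_s|y_s}U_{a_s}|\psi_N\rangle .$$ **Theorem.** (i) The reference correlations are realised by an experiment in this network in which $|\tilde\Psi\rangle=|\psi_N\rangle$ and every $|\Psi_j\rangle$ is the maximally entangled state $|\phi^+\rangle^{\otimes k}$ of dimension $2^k$. (ii) For every experiment in this network that reproduces the reference correlations, one of the following two cases holds: $|\varphi\rangle=|\psi_N\rangle$, or $|\varphi\rangle=|\psi_N^*\rangle$. In that case there are a local isometry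 $V=\bigotimes_jV_A^{(j)}\otimes V_B$, which adds ancillas initialised to $|0\cdots0\rangle$ (two registers $A_j',A_j''$ of $k$ qubits at each main party and two registers $B',B''$ of $n$ qubits at $B$), and channels (CPTP maps) $\Phi_1,\dots,\Phi_N$, where $\Phi_j$ acts on $A_j\tilde A_jA_j'A_j''$ and adds a register $\bar A_j$ of $k$ qubits, such that $$V|\Psi\rangle=|\mathrm{aux}\rangle\otimes|\phi^+\rangle^{\otimes n}_{A'_1\cdots A'_N,\,B'}$$ for some vector $|\mathrm{aux}\rangle$ of the remaining systems, and, with $\mathrm{Tr}_{\mathbb B}$ the partial trace over all systems of $B$ and $[v]=|v\rangle\langle v|$, $$\Big(\bigotimes_j\Phi_j\Big)\big(\mathrm{Tr}_{\mathbb B}[V\Psi]\big)=\xi\otimes|\varphi\rangle\langle\varphi|_{\bar A_1\cdots\bar A_N},$$ $$\Big(\bigotimes_j\Phi_j\Big)\Big(\tfrac1{p(b|y)}\mathrm{Tr}_{\mathbb B}\big[V\,\mathsf N_{b|y}\Psi\big]\Big)=\xi_{b,y}\otimes|\varphi\rangle\langle\varphi|_{\bar A_1\cdots\bar A_N}\quad\text{for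 all }y,b,$$ where $p(b|y)=\langle\Psi|\mathsf N_{b|y}|\Psi\rangle$, and $\xi$, $\xi_{b,y}$ are density operators on the systems of the main parties other than $\bar A_1\cdots\bar A_N$. So exactly $|\psi_N\rangle$ or exactly $|\psi_N^*\rangle$ is extracted, never a mixture or superposition of the two. -/

import Mathlib

open scoped Kronecker Matrix ComplexOrder

noncomputable section

namespace NetworkSelfTest

/-! ### Vectors, operators, measurements, channels

All Hilbert spaces are finite-dimensional with a fixed orthonormal basis: a vector is a function on
the index type of the basis, an operator is a complex matrix. The basis of a tensor product is the
product (or the dependent product) of the index types. -/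

/-- A pure state: a unit vector. -/
def IsState {ι : Type*} [Fintype ι] (v : ι → ℂ) : Prop := star v ⬝ᵥ v = 1

/-- The expectation value `⟨v| O |v⟩`. -/
def expect {ι : Type*} [Fintype ι] (v : ι → ℂ) (O : Matrix ι ι ℂ) : ℂ := star v ⬝ᵥ (O *ᵥ v)

/-- The operator `|v⟩⟨v|`. -/
def proj {ι : Type*} (v : ι → ℂ) : Matrix ι ι ℂ := Matrix.vecMulVec v (star v)

/-- A density operator. -/
def IsDensity {ι : Type*} [Fintype ι] (ρ : Matrix ι ι ℂ) : Prop := ρ.PosSemidef ∧ ρ.trace = 1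

/-- A projective measurement with outcomes in `o`. -/
structure IsPVM {o ι : Type*} [Fintype o] [Fintype ι] [DecidableEq ι]
    (M : o → Matrix ι ι ℂ) : Prop where
  hermitian : ∀ a, (M a).IsHermitian
  idem : ∀ a, M a * M a = M a
  orthogonal : ∀ a a', a ≠ a' → M a * M a' = 0
  sum_eq_one : ∑ a, M a = 1

/-- The tensor product `⨂ j, T j` of a finite family of operators. -/
def tensor {J : Type*} [Fintype J] {p q : J → Type*} (T : ∀ j, Matrix (p j) (q j) ℂ) :
    Matrix (∀ j, p j) (∀ j, q j) ℂ :=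
  fun u v => ∏ j, T j (u j) (v j)

/-- The operator `T` on tensor factor `j`, and the identity on all other factors. -/
def onFactor {J : Type*} [Fintype J] [DecidableEq J] {p : J → Type*} [∀ j, DecidableEq (p j)]
    (j : J) (T : Matrix (p j) (p j) ℂ) : Matrix (∀ j, p j) (∀ j, p j) ℂ :=
  tensor (Function.update (fun i => (1 : Matrix (p i) (p i) ℂ)) j T)

/-- The partial trace over the second factor. -/
def traceSnd {ι κ : Type*} [Fintype κ] (ρ : Matrix (ι × κ) (ι × κ) ℂ) : Matrix ι ι ℂ :=
  fun u v => ∑ c, ρ (u, c) (v, c)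

/-- A quantum channel (completely positive trace-preserving map) from operators on `ℂ^m` to
operators on `ℂ^n`, given by Kraus operators: `ρ ↦ ∑ r, K r * ρ * (K r)ᴴ` with
`∑ r, (K r)ᴴ * K r = 1`. -/
structure Channel (m n : Type*) [Fintype m] [DecidableEq m] [Fintype n] where
  rank : ℕ
  kraus : Fin rank → Matrix n m ℂ
  trace_preserving : ∑ r, (kraus r)ᴴ * kraus r = 1

/-- The action on `ρ` of the tensor product `⨂ j, Φ j` of local channels; its Kraus operators are
the tensor products of the local ones. -/
def Channel.tensorApply {J : Type*} [Fintype J] [DecidableEq J] {m n : J → Type*}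
    [∀ j, Fintype (m j)] [∀ j, DecidableEq (m j)] [∀ j, Fintype (n j)]
    (Φ : ∀ j, Channel (m j) (n j)) (ρ : Matrix (∀ j, m j) (∀ j, m j) ℂ) :
    Matrix (∀ j, n j) (∀ j, n j) ℂ :=
  ∑ r : (∀ j, Fin (Φ j).rank),
    tensor (fun j => (Φ j).kraus (r j)) * ρ * (tensor (fun j => (Φ j).kraus (r j)))ᴴ

/-! ### Qubits -/

/-- Basis labels of a register of `k` qubits. -/
abbrev Reg (k : ℕ) : Type := Fin k → Fin 2

/-- The qubit number `i` of the main party `j`, for `N` main parties with `k` qubits each. -/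
abbrev Site (N k : ℕ) : Type := Fin N × Fin k

/-- `(-1)^b`. -/
def sgn (b : Fin 2) : ℂ := (-1) ^ (b : ℕ)

/-- `σ_0 = σ_z`, `σ_1 = σ_x`, `σ_2 = σ_y`. -/
def pauli : Fin 3 → Matrix (Fin 2) (Fin 2) ℂ :=
  ![!![1, 0; 0, -1], !![0, 1; 1, 0], !![0, -Complex.I; Complex.I, 0]]

/-- The projector onto the eigenspace with eigenvalue `(-1)^b` of the Pauli matrix number `y`. -/
def pauliProj (y : Fin 3) (b : Fin 2) : Matrix (Fin 2) (Fin 2) ℂ :=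
  (1 / 2 : ℂ) • (1 + sgn b • pauli y)

/-- The unitaries of the teleportation: `U_00 = 1`, `U_01 = σ_z`, `U_10 = σ_x`,
`U_11 = σ_z σ_x`. -/
def teleU (a : Fin 2 × Fin 2) : Matrix (Fin 2) (Fin 2) ℂ :=
  pauli 0 ^ (a.2 : ℕ) * pauli 1 ^ (a.1 : ℕ)

/-- The coefficients of `|φ⁺⟩ = (|00⟩ + |11⟩) / √2`. -/
def phiPlus (u v : Fin 2) : ℂ := if u = v then ((1 / Real.sqrt 2 : ℝ) : ℂ) else 0

/-- The maximally entangled state of two registers of `k` qubits, `|φ⁺⟩^{⊗ k}`. -/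
def maxEntangled (k : ℕ) : Reg k × Reg k → ℂ := fun p => ∏ i, phiPlus (p.1 i) (p.2 i)

/-- The site in position `t` when the sites are listed party by party. -/
def siteAt {N k : ℕ} (t : ℕ) (ht : t < N * k) : Site N k := finProdFinEquiv.symm ⟨t, ht⟩

/-- The pairs of neighbouring sites (counted from 0) `(0, 1), (2, 3), …`, on which the reference
measurement `◇` consists of Bell state measurements. -/
def pairWhite {N k : ℕ} (m : Fin (N * k / 2)) : Site N k × Site N k :=
  (siteAt (2 * m) (by omega), siteAt (2 * m + 1) (by omega))

/-- The pairs of neighbouring sites (counted from 0) `(1, 2), (3, 4), …`, on which the reference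
measurement `◆` consists of Bell state measurements; if the number of sites is even, the last pair
consists of the last and the first site. -/
def pairBlack {N k : ℕ} (m : Fin (N * k / 2)) : Site N k × Site N k :=
  (siteAt (2 * m + 1) (by omega), siteAt ((2 * m + 2) % (N * k)) (Nat.mod_lt _ (by have := m.isLt; omega)))

/-! ### Experiments in the network -/

section Experiment

variable {N k : ℕ}

/-- A quantum experiment in the network of `N` main parties and one auxiliary party with
independent sources. The system of the main party `j` is `α j × τ j` and that of the auxiliary
party is `∀ j, β j`. The source `j` prepares a pure state of `α j × β j`, and a further source
prepares a pure state of `∀ j, τ j`. The measurements are arbitrary projective measurements of the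
parties: the main party `j` has the inputs `x : Fin k → Fin 6` with outputs in `{0,1}^k` (`main`)
and one further input with `k` pairs of bits as output (`tele`); the auxiliary party has the inputs
`y : Site N k → Fin 3` with one output bit for each site (`aux`), and two further inputs, `◇` and
`◆`, whose output is one pair of bits for each pair of neighbouring sites (`white`, `black`). -/
structure Experiment (N k : ℕ) (α τ β : Fin N → Type*)
    [∀ j, Fintype (α j)] [∀ j, DecidableEq (α j)]
    [∀ j, Fintype (τ j)] [∀ j, DecidableEq (τ j)]
    [∀ j, Fintype (β j)] [∀ j, DecidableEq (β j)] where
  source : ∀ j, α j × β j → ℂ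
  source_isState : ∀ j, IsState (source j)
  shared : (∀ j, τ j) → ℂ
  shared_isState : IsState shared
  main : ∀ j, (Fin k → Fin 6) → (Fin k → Fin 2) → Matrix (α j × τ j) (α j × τ j) ℂ
  main_isPVM : ∀ j x, IsPVM (main j x)
  tele : ∀ j, (Fin k → Fin 2 × Fin 2) → Matrix (α j × τ j) (α j × τ j) ℂ
  tele_isPVM : ∀ j, IsPVM (tele j)
  aux : (Site N k → Fin 3) → (Site N k → Fin 2) → Matrix (∀ j, β j) (∀ j, β j) ℂ
  aux_isPVM : ∀ y, IsPVM (aux y)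
  white : (Fin (N * k / 2) → Fin 2 × Fin 2) → Matrix (∀ j, β j) (∀ j, β j) ℂ
  white_isPVM : IsPVM white
  black : (Fin (N * k / 2) → Fin 2 × Fin 2) → Matrix (∀ j, β j) (∀ j, β j) ℂ
  black_isPVM : IsPVM black

namespace Experiment

variable {α τ β : Fin N → Type*}
  [∀ j, Fintype (α j)] [∀ j, DecidableEq (α j)]
  [∀ j, Fintype (τ j)] [∀ j, DecidableEq (τ j)]
  [∀ j, Fintype (β j)] [∀ j, DecidableEq (β j)]

/-- The state `|Ψ⟩ = (⨂ j, |Ψ_j⟩) ⊗ |Ψ̃⟩` of all parties. -/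
def state (R : Experiment N k α τ β) : (∀ j, α j × τ j) × (∀ j, β j) → ℂ :=
  fun p => (∏ j, R.source j ((p.1 j).1, p.2 j)) * R.shared (fun j => (p.1 j).2)

/-- The observable of the bit that the main party `s.1` outputs for its qubit `s.2` when the main
parties receive the inputs `x`, as an operator on the systems of all main parties. -/
def obsA (R : Experiment N k α τ β) (s : Site N k) (x : Site N k → Fin 6) :
    Matrix (∀ j, α j × τ j) (∀ j, α j × τ j) ℂ :=
  onFactor (p := fun j => α j × τ j) s.1
    (∑ a, sgn (a s.2) • R.main s.1 (fun i => x (s.1, i)) a)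

/-- The observable of the bit that the auxiliary party outputs for the site `s` on input `y`. -/
def obsB (R : Experiment N k α τ β) (s : Site N k) (y : Site N k → Fin 3) :
    Matrix (∀ j, β j) (∀ j, β j) ℂ :=
  ∑ b, sgn (b s) • R.aux y b

/-- The correlator of the output bits of a main party and of the auxiliary party for the site
`s`. -/
def corr (R : Experiment N k α τ β) (s : Site N k) (x : Site N k → Fin 6)
    (y : Site N k → Fin 3) : ℂ :=
  expect R.state (R.obsA s x ⊗ₖ R.obsB s y)

/-- The CHSH expression of the site `s`. -/
def CHSH (R : Experiment N k α τ β) (s : Site N k) (x x' : Site N k → Fin 6)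
    (y y' : Site N k → Fin 3) : ℂ :=
  R.corr s x y + R.corr s x y' + R.corr s x' y - R.corr s x' y'

/-- Maximal violation of the 3-CHSH inequality at every site, for all inputs that have the
prescribed entry at that site. -/
def MaximalCHSH (R : Experiment N k α τ β) : Prop :=
  ∀ (s : Site N k) (x : Fin 6 → Site N k → Fin 6) (y : Fin 3 → Site N k → Fin 3),
    (∀ m, x m s = m) → (∀ m, y m s = m) →
      R.CHSH s (x 0) (x 1) (y 0) (y 1) + R.CHSH s (x 2) (x 3) (y 0) (y 2) +
        R.CHSH s (x 4) (x 5) (y 1) (y 2) = ((6 * Real.sqrt 2 : ℝ) : ℂ)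

/-- `⟨Ψ| A^s_p A^t_q ⊗ P |Ψ⟩`: the main parties receive the inputs `x`, changed to `p` at the site
`s` and to `q` at the site `t`. -/
def pairCorr (R : Experiment N k α τ β) (s t : Site N k) (x : Site N k → Fin 6) (p q : Fin 6)
    (P : Matrix (∀ j, β j) (∀ j, β j) ℂ) : ℂ :=
  expect R.state
    ((R.obsA s (Function.update (Function.update x s p) t q) *
      R.obsA t (Function.update (Function.update x s p) t q)) ⊗ₖ P)

/-- `⟨Ψ| (A^s_p + c A^s_q)/√2 · (A^t_p + c A^t_q)/√2 ⊗ P |Ψ⟩`. -/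
def alignCorr (R : Experiment N k α τ β) (s t : Site N k) (x : Site N k → Fin 6) (p q : Fin 6)
    (c : ℂ) (P : Matrix (∀ j, β j) (∀ j, β j) ℂ) : ℂ :=
  (1 / 2) * (R.pairCorr s t x p p P + c * R.pairCorr s t x p q P +
    c * R.pairCorr s t x q p P + c * c * R.pairCorr s t x q q P)

/-- The projector onto the result `c` for the pair number `m` in a measurement that outputs one
pair of bits for each pair of neighbouring sites. -/
def marginal (Q : (Fin (N * k / 2) → Fin 2 × Fin 2) → Matrix (∀ j, β j) (∀ j, β j) ℂ)
    (m : Fin (N * k / 2)) (c : Fin 2 × Fin 2) : Matrix (∀ j, β j) (∀ j, β j) ℂ :=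
  ∑ b with b m = c, Q b

/-- The correlations of a Bell state measurement with outcome `c`, which is described by the
projector `P`, on the qubits of the auxiliary party at the sites `s` and `t`. -/
def Aligned (R : Experiment N k α τ β) (s t : Site N k) (c : Fin 2 × Fin 2)
    (P : Matrix (∀ j, β j) (∀ j, β j) ℂ) : Prop :=
  ∀ x : Site N k → Fin 6,
    R.alignCorr s t x 0 1 1 P = 1 / 4 * sgn c.2 ∧
    R.alignCorr s t x 0 1 (-1) P = 1 / 4 * sgn c.1 ∧
    R.alignCorr s t x 2 3 (-1) P = 1 / 4 * -(sgn c.1 * sgn c.2)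

/-- The alignment correlations of the measurements `◇` and `◆`. -/
def BellAlignment (R : Experiment N k α τ β) : Prop :=
  ∀ (m : Fin (N * k / 2)) (c : Fin 2 × Fin 2),
    R.Aligned (pairWhite m).1 (pairWhite m).2 c (marginal R.white m c) ∧
    R.Aligned (pairBlack m).1 (pairBlack m).2 c (marginal R.black m c)

/-- The statistics of the tomography of the teleported state `ψ`. -/
def TeleportationTomography (R : Experiment N k α τ β) (ψ : (Fin N → Reg k) → ℂ) : Prop :=
  ∀ (a : ∀ _ : Fin N, Fin k → Fin 2 × Fin 2) (y : Site N k → Fin 3) (b : Site N k → Fin 2),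
    expect R.state (tensor (fun j => R.tele j (a j)) ⊗ₖ R.aux y b) =
      1 / 4 ^ (N * k) * expect ψ (tensor fun j => tensor fun i =>
        (teleU (a j i))ᴴ * pauliProj (y (j, i)) (b (j, i)) * teleU (a j i))

/-- The experiment reproduces the reference correlations for `ψ`. -/
def Reproduces (R : Experiment N k α τ β) (ψ : (Fin N → Reg k) → ℂ) : Prop :=
  R.MaximalCHSH ∧ R.BellAlignment ∧ R.TeleportationTomography ψ

/-- The probability `p(b | y)` of the auxiliary party's output `b` on input `y`. -/
def prob (R : Experiment N k α τ β) (y : Site N k → Fin 3) (b : Site N k → Fin 2) : ℂ :=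
  expect R.state ((1 : Matrix (∀ j, α j × τ j) (∀ j, α j × τ j) ℂ) ⊗ₖ R.aux y b)

/-- The unnormalized state `N_{b|y} |Ψ⟩` after the auxiliary party has obtained `b` on input
`y`. -/
def postState (R : Experiment N k α τ β) (y : Site N k → Fin 3) (b : Site N k → Fin 2) :
    (∀ j, α j × τ j) × (∀ j, β j) → ℂ :=
  ((1 : Matrix (∀ j, α j × τ j) (∀ j, α j × τ j) ℂ) ⊗ₖ R.aux y b) *ᵥ R.state

/-- The state `φ` can be extracted. There are isometries `VA j`, of the main parties, and `VB`, of
the auxiliary party, that add two registers of `k` qubits at each main party (`A'_j`, `A''_j`) and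
two registers of `N * k` qubits at the auxiliary party (`B'`, `B''`), all initialized to
`|0…0⟩`, and that bring the state to the form `|aux⟩_{A A'' B B''} ⊗ |φ⁺⟩^{⊗ N k}_{A' B'}`; and
there are local channels `Φ j` of the main parties that map the state of the main parties, after
these isometries, to the product of `|φ⟩⟨φ|` on new registers and a density operator on the systems
that the main parties had before. The same holds with the same maps for the state conditioned on
any input and output of the auxiliary party. -/
def Extracts (R : Experiment N k α τ β) (φ : (Fin N → Reg k) → ℂ) : Prop :=
  ∃ (VA : ∀ j, Matrix ((α j × τ j) × Reg k × Reg k) (α j × τ j) ℂ)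
    (VB : Matrix ((∀ j, β j) × (Fin N → Reg k) × (Fin N → Reg k)) (∀ j, β j) ℂ)
    (Φ : ∀ j, Channel ((α j × τ j) × Reg k × Reg k) (((α j × τ j) × Reg k × Reg k) × Reg k)),
    (∀ j, (VA j)ᴴ * VA j = 1) ∧ VBᴴ * VB = 1 ∧
    (∃ junk : (∀ j, (α j × τ j) × Reg k) × ((∀ j, β j) × (Fin N → Reg k)) → ℂ,
      (tensor VA ⊗ₖ VB) *ᵥ R.state = fun p =>
        junk (fun j => ((p.1 j).1, (p.1 j).2.2), (p.2.1, p.2.2.2)) *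
          ∏ j, maxEntangled k ((p.1 j).2.1, p.2.2.1 j)) ∧
    (∃ ξ : Matrix (∀ j, (α j × τ j) × Reg k × Reg k) (∀ j, (α j × τ j) × Reg k × Reg k) ℂ,
      IsDensity ξ ∧
      Channel.tensorApply Φ (traceSnd (proj ((tensor VA ⊗ₖ VB) *ᵥ R.state))) = fun u v =>
        ξ (fun j => (u j).1) (fun j => (v j).1) *
          proj φ (fun j => (u j).2) (fun j => (v j).2)) ∧
    ∀ (y : Site N k → Fin 3) (b : Site N k → Fin 2),
      ∃ ξ : Matrix (∀ j, (α j × τ j) × Reg k × Reg k) (∀ j, (α j × τ j) × Reg k × Reg k) ℂ,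
        IsDensity ξ ∧
        Channel.tensorApply Φ ((R.prob y b)⁻¹ •
          traceSnd (proj ((tensor VA ⊗ₖ VB) *ᵥ R.postState y b))) = fun u v =>
            ξ (fun j => (u j).1) (fun j => (v j).1) *
              proj φ (fun j => (u j).2) (fun j => (v j).2)

end Experiment

end Experiment

end NetworkSelfTest

end

open NetworkSelfTest

/-! Write the joint state as a matrix `M` whose rows belong to the main parties and whose columns
belong to the auxiliary party. Then `T ⊗ S` acts as `T * M * Sᵀ`, and relations between operators
need to hold only after multiplication with `M`, that is, on the support of the state.

Rigidity of the observables. The sum-of-squares form of each CHSH expression (`chsh_sum_of_squares`)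
vanishes at the maximal value. So every observable of the auxiliary party acts on `M` from the right
as a local operator of one main party acts from the left; it is "mirrored". Mirrored operators,
identified when they agree on `M`, form an algebra `MirrorQuot M`. There the three observables of a
site square to one and anticommute, those of different sites commute, and each depends only on the
input entry of its own site.

Handedness. These relations determine two observables as `σ_z`, `σ_x`, but the third only up to the
handedness `g_s`, the product of the three, with `g_s² = -1`. The Bell state correlations of
neighbouring sites force `g_s = g_t` (`handedness_eq_of_aligned`), hence one common `g`. If there
are two main parties, `g` is mirrored by both; as the sources are independent, an operation that
either of two parties can carry out acts as a scalar (`mul_eq_smul_of_two_parties`). So `g = ± i`: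
this excludes mixtures and superpositions of the two cases.

Representation. The observables now generate matrix units, and every measurement of the auxiliary
party is a product Pauli measurement or its transpose (`calc_eq_unitRep`). The swap-type isometries
built from local mirrors extract the maximally entangled state. By completeness of Pauli tomography,
the teleportation statistics fix the overlap of every teleportation outcome with every matrix unit
(`trace_tele`); they are those of `ψ` if `g = -i` and those of `star ψ` if `g = i`, the signs being
exchanged by the transpose on the right of `M`.

Extraction. Each main party discards its source qubits, prepares a fresh maximally entangled pair of
its own, teleports its share of the state into half of that pair, and corrects. Since the old qubits
are discarded, a previous measurement of the auxiliary party is harmless (`sum_discard`), which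
gives the conditional statements as well. A single main party is exceptional: no second party fixes
the handedness, but a local channel may simply prepare `ψ`.

For realisability, the correlations of the reference experiment reduce to traces of products of
Pauli matrices, because `φ⁺` turns an operator of the auxiliary party into its transpose at the main
parties. -/

namespace NetworkSelfTest

open Matrix

set_option linter.unusedSectionVars false

/-! ### Tensor products of operators -/

section Tensor

variable {J : Type*} [Fintype J]

theorem tensor_smul {q r : J → Type*} (c : J → ℂ) (T : ∀ j, Matrix (q j) (r j) ℂ) :
    tensor (fun j => c j • T j) = (∏ j, c j) • tensor T := by
  ext u v
  simp [tensor, Finset.prod_mul_distrib]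

theorem tensor_conjTranspose {p q : J → Type*} (T : ∀ j, Matrix (p j) (q j) ℂ) :
    (tensor T)ᴴ = tensor (fun j => (T j)ᴴ) := by
  ext u v
  simp [tensor, conjTranspose_apply]

theorem tensor_transpose {p q : J → Type*} (T : ∀ j, Matrix (p j) (q j) ℂ) :
    (tensor T)ᵀ = tensor (fun j => (T j)ᵀ) := rfl

theorem tensor_one {p : J → Type*} [∀ j, DecidableEq (p j)] [DecidableEq (∀ j, p j)] :
    tensor (fun j => (1 : Matrix (p j) (p j) ℂ)) = 1 := by
  ext u v
  simp [tensor, one_apply, Finset.prod_ite_zero, funext_iff]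

variable [DecidableEq J]

theorem tensor_mul {p q r : J → Type*} [∀ j, Fintype (q j)]
    (S : ∀ j, Matrix (p j) (q j) ℂ) (T : ∀ j, Matrix (q j) (r j) ℂ) :
    tensor S * tensor T = tensor (fun j => S j * T j) := by
  ext u v
  simp only [tensor, mul_apply, Finset.prod_univ_sum, Fintype.piFinset_univ,
    Finset.prod_mul_distrib]

theorem tensor_sum {p q ι : J → Type*} [∀ j, Fintype (ι j)]
    (T : ∀ j, ι j → Matrix (p j) (q j) ℂ) :
    tensor (fun j => ∑ i, T j i) = ∑ f : ∀ j, ι j, tensor (fun j => T j (f j)) := by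
  ext u v
  simp only [tensor, Matrix.sum_apply, Finset.prod_univ_sum, Fintype.piFinset_univ]

theorem trace_tensor {p : J → Type*} [∀ j, Fintype (p j)] (T : ∀ j, Matrix (p j) (p j) ℂ) :
    (tensor T).trace = ∏ j, (T j).trace := by
  simp only [tensor, Matrix.trace, Matrix.diag_apply, Finset.prod_univ_sum,
    Fintype.piFinset_univ]

variable {p : J → Type*} [∀ j, DecidableEq (p j)]

theorem onFactor_apply (j : J) (T : Matrix (p j) (p j) ℂ) (u v : ∀ j, p j) :
    onFactor j T u v = T (u j) (v j) * ∏ i ∈ Finset.univ.erase j, if u i = v i then 1 else 0 := by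
  rw [onFactor, tensor, ← Finset.mul_prod_erase _ _ (Finset.mem_univ j)]
  simp only [Function.update_self]
  congr 1
  refine Finset.prod_congr rfl fun i hi => ?_
  rw [Function.update_of_ne (Finset.ne_of_mem_erase hi), one_apply]

theorem onFactor_apply_ite (j : J) (T : Matrix (p j) (p j) ℂ) (u v : ∀ j, p j) :
    onFactor j T u v = if ∀ i, i ≠ j → u i = v i then T (u j) (v j) else 0 := by
  rw [onFactor_apply, Finset.prod_ite_zero]
  simp

theorem onFactor_one [DecidableEq (∀ j, p j)] (j : J) :
    onFactor j (1 : Matrix (p j) (p j) ℂ) = 1 := by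
  rw [onFactor, Function.update_eq_self_iff.mpr rfl, tensor_one]

theorem onFactor_add (j : J) (S T : Matrix (p j) (p j) ℂ) :
    onFactor j (S + T) = onFactor j S + onFactor j T := by
  ext u v
  simp [onFactor_apply, add_mul]

theorem onFactor_sub (j : J) (S T : Matrix (p j) (p j) ℂ) :
    onFactor j (S - T) = onFactor j S - onFactor j T := by
  ext u v
  simp [onFactor_apply, sub_mul]

theorem onFactor_zero (j : J) : onFactor j (0 : Matrix (p j) (p j) ℂ) = 0 := by
  ext u v
  simp [onFactor_apply]

theorem onFactor_smul (j : J) (c : ℂ) (T : Matrix (p j) (p j) ℂ) :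
    onFactor j (c • T) = c • onFactor j T := by
  ext u v
  simp [onFactor_apply, mul_assoc]

theorem onFactor_sum {ι : Type*} (s : Finset ι) (j : J) (T : ι → Matrix (p j) (p j) ℂ) :
    onFactor j (∑ i ∈ s, T i) = ∑ i ∈ s, onFactor j (T i) := by
  ext u v
  simp [onFactor_apply, Matrix.sum_apply, Finset.sum_mul]

theorem onFactor_conjTranspose (j : J) (T : Matrix (p j) (p j) ℂ) :
    (onFactor j T)ᴴ = onFactor j Tᴴ := by
  rw [onFactor, tensor_conjTranspose, onFactor]
  congr 1
  funext i
  by_cases h : i = j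
  · subst h; simp
  · simp [Function.update_of_ne h]

theorem onFactor_transpose (j : J) (T : Matrix (p j) (p j) ℂ) :
    (onFactor j T)ᵀ = onFactor j Tᵀ := by
  rw [onFactor, tensor_transpose, onFactor]
  congr 1
  funext i
  by_cases h : i = j
  · subst h; simp
  · simp [Function.update_of_ne h]

variable [∀ j, Fintype (p j)]

theorem onFactor_mul (j : J) (S T : Matrix (p j) (p j) ℂ) :
    onFactor j S * onFactor j T = onFactor j (S * T) := by
  rw [onFactor, onFactor, tensor_mul, onFactor]
  congr 1
  funext i
  by_cases h : i = j
  · subst h; simp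
  · simp [h]

theorem onFactor_mul_apply {Y : Type*} (j : J) (T : Matrix (p j) (p j) ℂ)
    (M : Matrix (∀ j, p j) Y ℂ) (u : ∀ j, p j) (q : Y) :
    (onFactor j T * M) u q = ∑ x, T (u j) x * M (Function.update u j x) q := by
  simp only [mul_apply, onFactor_apply_ite, ite_mul, zero_mul]
  rw [← Finset.sum_filter]
  symm
  refine Finset.sum_bij (fun x _ => Function.update u j x) (fun x _ => ?_) (fun x _ x' _ hx => ?_)
    (fun v hv => ?_) fun x _ => ?_
  · simp only [Finset.mem_filter, Finset.mem_univ, true_and]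
    intro i hi
    rw [Function.update_of_ne hi]
  · simpa using congrFun hx j
  · refine ⟨v j, Finset.mem_univ _, funext fun i => ?_⟩
    by_cases hi : i = j
    · subst hi; simp
    · rw [Function.update_of_ne hi]
      exact (Finset.mem_filter.mp hv).2 i hi
  · simp

/-- Local operators that act on `M` from the left as `t j` acts from the right combine to a tensor
product. -/
theorem tensor_mul_eq {Y : Type*} [Fintype Y] [DecidableEq Y] {M : Matrix (∀ j, p j) Y ℂ}
    (T : ∀ j, Matrix (p j) (p j) ℂ) (t : J → Matrix Y Y ℂ)
    (hT : ∀ j, onFactor j (T j) * M = M * t j) (G : Finset J → Matrix Y Y ℂ) (h0 : G ∅ = 1)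
    (hG : ∀ s, ∀ j ∉ s, G (insert j s) = G s * t j) :
    tensor T * M = M * G Finset.univ := by
  have key : ∀ s : Finset J, tensor (fun j => if j ∈ s then T j else 1) * M = M * G s := by
    intro s
    induction s using Finset.induction_on with
    | empty => simp [tensor_one, h0]
    | insert j s hj ih =>
      have : tensor (fun i => if i ∈ insert j s then T i else 1) =
          tensor (fun i => if i ∈ s then T i else 1) * onFactor j (T j) := by
        rw [onFactor, tensor_mul]
        congr 1
        funext i
        by_cases h : i = j
        · subst h; simp [hj]
        · simp [h]
      rw [this, Matrix.mul_assoc, hT, ← Matrix.mul_assoc, ih, Matrix.mul_assoc, hG s j hj]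
  simpa using key Finset.univ

end Tensor

/-! ### Projective measurements -/

section PVM

variable {o ι : Type*} [Fintype o] [Fintype ι] [DecidableEq ι]

theorem IsPVM.mul_eq [DecidableEq o] {P : o → Matrix ι ι ℂ} (hP : IsPVM P) (a b : o) :
    P a * P b = if a = b then P a else 0 := by
  split_ifs with h
  · rw [← h, hP.idem]
  · exact hP.orthogonal a b h

theorem IsPVM.transpose {P : o → Matrix ι ι ℂ} (hP : IsPVM P) : IsPVM fun a => (P a)ᵀ where
  hermitian a := (hP.hermitian a).transpose
  idem a := by rw [← transpose_mul, hP.idem]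
  orthogonal a b h := by rw [← transpose_mul, hP.orthogonal b a h.symm, transpose_zero]
  sum_eq_one := by rw [← transpose_sum, hP.sum_eq_one, transpose_one]

/-- The functional calculus of a projective measurement. -/
noncomputable def IsPVM.calc {P : o → Matrix ι ι ℂ} (hP : IsPVM P) :
    (o → ℂ) →ₐ[ℂ] Matrix ι ι ℂ := by
  classical
  exact AlgHom.ofLinearMap
    { toFun := fun f => ∑ a, f a • P a
      map_add' := fun f g => by simp [add_smul, Finset.sum_add_distrib]
      map_smul' := fun c f => by simp [mul_smul, Finset.smul_sum] }
    (by simp [hP.sum_eq_one])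
    (fun f g => by
      simp [Finset.sum_mul, Finset.mul_sum, hP.mul_eq, smul_smul, mul_comm])

theorem IsPVM.calc_apply {P : o → Matrix ι ι ℂ} (hP : IsPVM P) (f : o → ℂ) :
    hP.calc f = ∑ a, f a • P a := rfl

theorem IsPVM.calc_star {P : o → Matrix ι ι ℂ} (hP : IsPVM P) (f : o → ℂ) :
    (hP.calc f)ᴴ = hP.calc (star f) := by
  simp only [hP.calc_apply, conjTranspose_sum, conjTranspose_smul, (hP.hermitian _).eq,
    Pi.star_apply]

theorem IsPVM.calc_single [DecidableEq o] {P : o → Matrix ι ι ℂ} (hP : IsPVM P) (a : o) :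
    hP.calc (Pi.single a 1) = P a := by
  simp [hP.calc_apply, Pi.single_apply]

end PVM

/-! ### Product measurements. -/

section TensorPVM

variable {J : Type*} [Fintype J] [DecidableEq J] {o p : J → Type*} [∀ j, Fintype (o j)]
  [∀ j, Fintype (p j)] [∀ j, DecidableEq (p j)]

theorem IsPVM.tensor {P : ∀ j, o j → Matrix (p j) (p j) ℂ} (hP : ∀ j, IsPVM (P j)) :
    IsPVM fun a : ∀ j, o j => NetworkSelfTest.tensor fun j => P j (a j) where
  hermitian a := by
    rw [IsHermitian, tensor_conjTranspose]
    simp only [((hP _).hermitian _).eq]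
  idem a := by
    rw [tensor_mul]
    simp only [(hP _).idem]
  orthogonal a b h := by
    obtain ⟨j, hj⟩ := Function.ne_iff.mp h
    rw [tensor_mul]
    ext u v
    refine Finset.prod_eq_zero (Finset.mem_univ j) ?_
    change (P j (a j) * P j (b j)) (u j) (v j) = 0
    rw [(hP j).orthogonal _ _ hj, Matrix.zero_apply]
  sum_eq_one := by
    rw [← tensor_sum]
    simp only [(hP _).sum_eq_one, tensor_one]

/-- In the factors other than `j` the projectors are summed with weight one, and this sum is the
identity. -/
theorem IsPVM.tensor_calc {P : ∀ j, o j → Matrix (p j) (p j) ℂ} (hP : ∀ j, IsPVM (P j)) (j : J)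
    (f : o j → ℂ) : (IsPVM.tensor hP).calc (fun a => f (a j)) = onFactor j ((hP j).calc f) := by
  have h1 : Function.update (fun i => (1 : Matrix (p i) (p i) ℂ)) j ((hP j).calc f) =
      fun i => ∑ a, (Function.update (fun i (_ : o i) => (1 : ℂ)) j f i a) • P i a := by
    funext i
    by_cases h : i = j
    · subst h; simp [IsPVM.calc_apply]
    · simp [h, (hP i).sum_eq_one]
  rw [onFactor, h1, tensor_sum, IsPVM.calc_apply]
  refine Finset.sum_congr rfl fun a _ => ?_
  rw [tensor_smul, Finset.prod_eq_single j (fun i _ h => by simp [h]) (by simp)]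
  simp

end TensorPVM

/-! ### Functions of bits -/

theorem sgn_zero : sgn 0 = 1 := by simp [sgn]
theorem sgn_one : sgn 1 = -1 := by simp [sgn]
theorem sgn_mul_self (b : Fin 2) : sgn b * sgn b = 1 := by
  fin_cases b <;> simp [sgn]
theorem star_sgn (b : Fin 2) : star (sgn b) = sgn b := by
  fin_cases b <;> simp [sgn]
theorem sgn_add (a b : Fin 2) : sgn (a + b) = sgn a * sgn b := by
  fin_cases a <;> fin_cases b <;> simp [sgn]

/-- The algebra of functions of bits is generated by the signs of the bits. -/
theorem signs_induction {σ : Type*} [Fintype σ] [DecidableEq σ] {P : ((σ → Fin 2) → ℂ) → Prop}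
    (hc : ∀ c : ℂ, P (fun _ => c)) (ha : ∀ f g, P f → P g → P (f + g))
    (hm : ∀ f g, P f → P g → P (f * g)) (hs : ∀ s, P (fun b => sgn (b s))) (f) : P f := by
  have h1 : ∀ b0 : σ → Fin 2, P (Pi.single b0 1) := by
    intro b0
    -- The indicator of a bit string is the product over the bits of `(1 + sgn (b0 s) * sgn (b s)) /
    -- 2`; indicators then span all functions.
    have : (Pi.single b0 1 : (σ → Fin 2) → ℂ) =
        ∏ s, ((fun _ => 1 / 2) * ((fun _ => 1) + (fun _ => sgn (b0 s)) * fun b => sgn (b s))) := by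
      funext b
      rw [Finset.prod_apply]
      have h2 : ∀ s, ((fun _ => 1 / 2) * ((fun _ => 1) + (fun _ => sgn (b0 s)) *
          fun b : σ → Fin 2 => sgn (b s)) : (σ → Fin 2) → ℂ) b = if b s = b0 s then 1 else 0 := by
        intro s
        simp only [Pi.mul_apply, Pi.add_apply]
        generalize b s = x
        generalize b0 s = y
        fin_cases x <;> fin_cases y <;> norm_num [sgn]
      simp only [h2, Pi.single_apply, Finset.prod_ite_zero, funext_iff]
      simp
    rw [this]
    exact Finset.prod_induction _ P (fun f g => hm f g) (hc 1)
      fun s _ => hm _ _ (hc _) (ha _ _ (hc _) (hm _ _ (hc _) (hs s)))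
  have : f = ∑ b0, (fun _ => f b0) * Pi.single b0 (1 : ℂ) := by
    funext b
    simp [Finset.sum_apply, Pi.single_apply]
  rw [this]
  exact Finset.sum_induction _ P (fun f g => ha f g) (hc 0) fun b0 _ => hm _ _ (hc _) (h1 b0)

/-! ### Vectors of bipartite systems as matrices -/

section Bipartite

/-- The coefficient matrix of a vector of a bipartite system. -/
def toMat {X Y : Type*} (v : X × Y → ℂ) : Matrix X Y ℂ := fun x y => v (x, y)

variable {X Y X' Y' : Type*} [Fintype Y]

theorem traceSnd_proj (v : X × Y → ℂ) : traceSnd (proj v) = toMat v * (toMat v)ᴴ := by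
  ext x x'
  simp [traceSnd, proj, vecMulVec_apply, mul_apply, toMat]

variable [Fintype X]

/-- Operators of the second party act from the right by their transpose. Every transposed operator
of the auxiliary party below, and with it the exchange of `ψ` and `star ψ`, comes from here. -/
theorem toMat_kronecker_mulVec (T : Matrix X' X ℂ) (S : Matrix Y' Y ℂ) (v : X × Y → ℂ) :
    toMat ((T ⊗ₖ S) *ᵥ v) = T * toMat v * Sᵀ := by
  ext x y
  simp only [toMat, mulVec, dotProduct, kroneckerMap_apply, Fintype.sum_prod_type, mul_apply,
    transpose_apply, Finset.sum_mul]
  rw [Finset.sum_comm]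
  exact Finset.sum_congr rfl fun _ _ => Finset.sum_congr rfl fun _ _ => by ring

theorem star_dotProduct_eq_trace (v w : X × Y → ℂ) :
    star v ⬝ᵥ w = ((toMat v)ᴴ * toMat w).trace := by
  simp only [dotProduct, Matrix.trace, diag_apply, mul_apply, conjTranspose_apply, toMat,
    Fintype.sum_prod_type, Pi.star_apply]
  rw [Finset.sum_comm]

theorem expect_kronecker (v : X × Y → ℂ) (T : Matrix X X ℂ) (S : Matrix Y Y ℂ) :
    expect v (T ⊗ₖ S) = ((toMat v)ᴴ * (T * toMat v * Sᵀ)).trace := by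
  rw [expect, star_dotProduct_eq_trace, toMat_kronecker_mulVec]

end Bipartite

/-- The orthogonal projection onto the column space of a matrix. -/
theorem exists_range_projection {H R : Type*} [Fintype H] [DecidableEq H] [Fintype R]
    (C : Matrix H R ℂ) :
    ∃ Q : Matrix H H ℂ, Qᴴ = Q ∧ Q * Q = Q ∧ Q * C = C ∧ ∃ D : Matrix R H ℂ, Q = C * D := by
  classical
  let K : Submodule ℂ (EuclideanSpace ℂ H) :=
    LinearMap.range ((WithLp.linearEquiv 2 ℂ (H → ℂ)).symm.toLinearMap ∘ₗ C.mulVecLin)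
  let Q : Matrix H H ℂ := (toEuclideanCLM (n := H) (𝕜 := ℂ)).symm K.starProjection
  have hQ : toEuclideanCLM (n := H) (𝕜 := ℂ) Q = K.starProjection :=
    StarAlgEquiv.apply_symm_apply _ _
  have hQv : ∀ v : EuclideanSpace ℂ H, K.starProjection v = WithLp.toLp 2 (Q *ᵥ v.ofLp) := by
    intro v
    rw [← hQ, ← ofLp_toEuclideanCLM]
  refine ⟨Q, ?_, ?_, ?_, ?_⟩
  · apply EquivLike.injective (toEuclideanCLM (n := H) (𝕜 := ℂ))
    rw [← star_eq_conjTranspose, map_star, hQ]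
    exact isSelfAdjoint_starProjection K
  · apply EquivLike.injective (toEuclideanCLM (n := H) (𝕜 := ℂ))
    rw [map_mul, hQ]
    exact K.isIdempotentElem_starProjection
  · ext h r
    have hm : WithLp.toLp 2 (C.col r) ∈ K := ⟨Pi.single r 1, by simp⟩
    have := Submodule.starProjection_eq_self_iff.mpr hm
    rw [hQv] at this
    exact congrFun (congrArg WithLp.ofLp this) h
  -- The columns of `Q` are projections of basis vectors, so they lie in the column space of `C`;
  -- this gives the factorisation `Q = C * D`.
  · have : ∀ h, ∃ d : R → ℂ, C *ᵥ d = Q.col h := by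
      intro h
      obtain ⟨d, hd⟩ := Submodule.starProjection_apply_mem K (WithLp.toLp 2 (Pi.single h 1))
      refine ⟨d, ?_⟩
      rw [hQv] at hd
      simpa using congrArg WithLp.ofLp hd
    choose d hd using this
    refine ⟨Matrix.of fun r h => d h r, ?_⟩
    ext h h'
    exact (congrFun (hd h') h).symm

/-! ### Channels -/

/-- The channel with a given finite family of Kraus operators. -/
noncomputable def Channel.ofFamily {m n ι : Type*} [Fintype m] [DecidableEq m] [Fintype n]
    [Fintype ι] (K : ι → Matrix n m ℂ) (h : ∑ i, (K i)ᴴ * K i = 1) : Channel m n where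
  rank := Fintype.card ι
  kraus r := K ((Fintype.equivFin ι).symm r)
  trace_preserving := by
    rw [← h]
    exact Equiv.sum_comp (Fintype.equivFin ι).symm fun i => (K i)ᴴ * K i

section Channels

variable {J : Type*} [Fintype J] [DecidableEq J] {m n ι : J → Type*}
  [∀ j, Fintype (m j)] [∀ j, DecidableEq (m j)] [∀ j, Fintype (n j)] [∀ j, Fintype (ι j)]

theorem Channel.tensorApply_ofFamily (K : ∀ j, ι j → Matrix (n j) (m j) ℂ)
    (h : ∀ j, ∑ i, (K j i)ᴴ * K j i = 1) (ρ : Matrix (∀ j, m j) (∀ j, m j) ℂ) :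
    Channel.tensorApply (fun j => Channel.ofFamily (K j) (h j)) ρ =
      ∑ i : ∀ j, ι j, tensor (fun j => K j (i j)) * ρ * (tensor fun j => K j (i j))ᴴ :=
  Fintype.sum_equiv (Equiv.piCongrRight fun j => (Fintype.equivFin (ι j)).symm) _ _ fun _ => rfl

/-- Families of Kraus operators that preserve the trace on the range of a projection can be
completed to channels that act in the same way on states supported in this range. -/
theorem exists_channels [∀ j, DecidableEq (n j)] (K : ∀ j, ι j → Matrix (n j) (m j) ℂ)
    (P : ∀ j, Matrix (m j) (m j) ℂ) (hP : ∀ j, (P j)ᴴ = P j) (hPP : ∀ j, P j * P j = P j)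
    (hK : ∀ j, ∑ i, (K j i)ᴴ * K j i = P j) (o : ∀ j, n j) (Y : Type*) [Fintype Y] :
    ∃ Φ : ∀ j, Channel (m j) (n j), ∀ S : Matrix (∀ j, m j) Y ℂ,
      (∀ j, onFactor j (P j) * S = S) →
      Channel.tensorApply Φ (S * Sᴴ) = ∑ i : ∀ j, ι j,
        (tensor (fun j => K j (i j)) * S) * (tensor (fun j => K j (i j)) * S)ᴴ := by
  classical
  -- The added Kraus operators project onto the complement of `P j` and reset the system to the
  -- basis state `o j`.
  let K' : ∀ j, ι j ⊕ m j → Matrix (n j) (m j) ℂ := fun j =>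
    Sum.elim (K j) fun κ => Matrix.single (o j) κ (1 : ℂ) * (1 - P j)
  have hc : ∀ j, (1 - P j) * (1 - P j) = 1 - P j := fun j => by
    rw [Matrix.sub_mul, Matrix.mul_sub, Matrix.mul_sub, hPP]
    simp
  have hK' : ∀ j, ∑ i, (K' j i)ᴴ * K' j i = 1 := by
    intro j
    have h1 : ∀ κ : m j, (Matrix.single (o j) κ (1 : ℂ) * (1 - P j))ᴴ *
        (Matrix.single (o j) κ (1 : ℂ) * (1 - P j)) =
        (1 - P j) * Matrix.single κ κ (1 : ℂ) * (1 - P j) := by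
      intro κ
      rw [conjTranspose_mul, conjTranspose_sub, hP, conjTranspose_one, conjTranspose_single,
        star_one, ← Matrix.mul_assoc, Matrix.mul_assoc (1 - P j), single_mul_single_same, one_mul]
    have h2 : ∑ κ : m j, Matrix.single κ κ (1 : ℂ) = 1 := by
      ext a b
      simp [Matrix.sum_apply, Matrix.single_apply, one_apply, ite_and]
    simp only [K', Fintype.sum_sum_type, Sum.elim_inl, Sum.elim_inr, hK, h1, ← Finset.sum_mul,
      ← Finset.mul_sum, h2]
    rw [Matrix.mul_one, hc]
    simp
  refine ⟨fun j => Channel.ofFamily (K' j) (hK' j), fun S hS => ?_⟩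
  rw [Channel.tensorApply_ofFamily]
  symm
  refine Fintype.sum_of_injective (fun (i : ∀ j, ι j) j => (Sum.inl (i j) : ι j ⊕ m j))
    (fun a b h => funext fun j => Sum.inl_injective (congrFun h j)) _ _ (fun i hi => ?_)
    fun i => ?_
  · have : ∃ j κ, i j = Sum.inr κ := by
      by_contra hcon
      have hl : ∀ j, ∃ l, i j = Sum.inl l := fun j => by
        rcases h : i j with l | κ
        · exact ⟨l, rfl⟩
        · exact (hcon ⟨j, κ, h⟩).elim
      choose l hl using hl
      exact hi ⟨l, funext fun j => (hl j).symm⟩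
    obtain ⟨j, κ, hj⟩ := this
    -- An added Kraus operator at even one party contains the factor `1 - P j`, which annihilates
    -- `S`.
    have h0 : tensor (fun j => K' j (i j)) * S = 0 := by
      have h3 : tensor (fun j => K' j (i j)) =
          tensor (fun j => K' j (i j)) * onFactor j (1 - P j) := by
        rw [onFactor, tensor_mul]
        congr 1
        funext l
        by_cases h : l = j
        · subst h
          simp only [hj, K', Sum.elim_inr, Function.update_self]
          rw [Matrix.mul_assoc, hc]
        · simp [Function.update_of_ne h]
      rw [h3, Matrix.mul_assoc, onFactor_sub, Matrix.sub_mul, hS, onFactor_one, Matrix.one_mul,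
        sub_self, Matrix.mul_zero]
    rw [← Matrix.mul_assoc, h0]
    simp
  · simp only [K', Sum.elim_inl, conjTranspose_mul, Matrix.mul_assoc]

end Channels

/-! ### Pauli observables -/

/-- The two-outcome measurement of an involutive observable. -/
noncomputable def signProj {ι : Type*} [DecidableEq ι] (O : Matrix ι ι ℂ) (b : Fin 2) :
    Matrix ι ι ℂ := (1 / 2 : ℂ) • (1 + sgn b • O)

theorem isPVM_signProj {ι : Type*} [Fintype ι] [DecidableEq ι] {O : Matrix ι ι ℂ}
    (h : O.IsHermitian) (hO : O * O = 1) : IsPVM (signProj O) where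
  hermitian b := by
    simp only [IsHermitian, signProj, conjTranspose_smul, conjTranspose_add, conjTranspose_one,
      star_sgn, h.eq]
    simp
  idem b := by
    simp only [signProj, smul_mul_smul_comm, Matrix.add_mul, Matrix.mul_add, Matrix.one_mul,
      Matrix.mul_one, hO, sgn_mul_self]
    module
  orthogonal b b' hb := by
    have : sgn b' = - sgn b := by
      fin_cases b <;> fin_cases b' <;> simp_all [sgn]
    simp only [signProj, smul_mul_smul_comm, Matrix.add_mul, Matrix.mul_add, Matrix.one_mul,
      Matrix.mul_one, hO, this, mul_neg, sgn_mul_self]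
    module
  sum_eq_one := by
    simp only [signProj, Fin.sum_univ_two, sgn_zero, sgn_one]
    module

theorem signProj_calc_sgn {ι : Type*} [Fintype ι] [DecidableEq ι] {O : Matrix ι ι ℂ}
    (h : O.IsHermitian) (hO : O * O = 1) : (isPVM_signProj h hO).calc sgn = O := by
  simp only [IsPVM.calc_apply, signProj, Fin.sum_univ_two, sgn_zero, sgn_one]
  module

/-- The Pauli matrices, with the sign of `σ_y` determined by `c = ± i`. -/
noncomputable def pauliC (c : ℂ) : Fin 3 → Matrix (Fin 2) (Fin 2) ℂ :=
  ![pauli 0, pauli 1, c • (pauli 1 * pauli 0)]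

theorem pauliC_hermitian {c : ℂ} (hc : c = Complex.I ∨ c = -Complex.I) (y : Fin 3) :
    (pauliC c y).IsHermitian := by
  ext i j
  rcases hc with rfl | rfl <;> fin_cases y <;> fin_cases i <;> fin_cases j <;>
    simp [pauliC, pauli]

theorem pauliC_mul_self {c : ℂ} (hc : c = Complex.I ∨ c = -Complex.I) (y : Fin 3) :
    pauliC c y * pauliC c y = 1 := by
  ext i j
  rcases hc with rfl | rfl <;> fin_cases y <;> fin_cases i <;> fin_cases j <;>
    simp [pauliC, pauli, mul_apply, Fin.sum_univ_two]

theorem isPVM_pauliC {c : ℂ} (hc : c = Complex.I ∨ c = -Complex.I) (y : Fin 3) :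
    IsPVM (signProj (pauliC c y)) :=
  isPVM_signProj (pauliC_hermitian hc y) (pauliC_mul_self hc y)

theorem signProj_pauliC_I (y : Fin 3) (b : Fin 2) :
    signProj (pauliC Complex.I y) b = pauliProj y b := by
  have : pauliC Complex.I y = pauli y := by
    ext i j
    fin_cases y <;> fin_cases i <;> fin_cases j <;> simp [pauliC, pauli]
  rw [signProj, pauliProj, this]

theorem signProj_pauliC_neg_I (y : Fin 3) (b : Fin 2) :
    signProj (pauliC (-Complex.I) y) b = (pauliProj y b)ᵀ := by
  have : pauliC (-Complex.I) y = (pauli y)ᵀ := by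
    ext i j
    fin_cases y <;> fin_cases i <;> fin_cases j <;> simp [pauliC, pauli]
  simp [signProj, pauliProj, this]

/-! ### The matrix units generated by anticommuting observables of independent bits. -/

section Calculus

variable {σ : Type*} [Fintype σ] [DecidableEq σ]

theorem bits_add_self (w : σ → Fin 2) : w + w = 0 := by
  funext s
  have : ∀ x : Fin 2, x + x = 0 := by decide
  exact this _

/-- The character of `(ℤ/2)^σ` with label `w`. -/
noncomputable def chi (w b : σ → Fin 2) : ℂ := ∏ s, sgn (w s * b s)

theorem chi_mul (w w' : σ → Fin 2) : chi w * chi w' = chi (w + w') := by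
  funext b
  simp only [chi, Pi.mul_apply, ← Finset.prod_mul_distrib, Pi.add_apply, add_mul, sgn_add]

theorem chi_zero : chi (0 : σ → Fin 2) = 1 := by
  funext b
  simp [chi, sgn_zero]

theorem chi_add_right (w b b' : σ → Fin 2) : chi w (b + b') = chi w b * chi w b' := by
  simp only [chi, ← Finset.prod_mul_distrib, Pi.add_apply, mul_add, sgn_add]

theorem chi_single (s : σ) (b : σ → Fin 2) : chi (Pi.single s 1) b = sgn (b s) := by
  rw [chi, Finset.prod_eq_single s (fun t _ h => by simp [h, sgn_zero]) (by simp)]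
  simp

theorem chi_single_right (s : σ) (w : σ → Fin 2) : chi w (Pi.single s 1) = sgn (w s) := by
  rw [chi, Finset.prod_eq_single s (fun t _ h => by simp [h, sgn_zero]) (by simp)]
  simp

theorem star_chi (w : σ → Fin 2) : star (chi w) = chi w := by
  funext b
  simp only [chi, Pi.star_apply, star_prod, star_sgn]

/-- A family of functional calculi of measurements such that each output bit depends only on the
input for its site, and two observables of each site anticommute. -/
structure IsAnticommuting {A : Type*} [Ring A] [Algebra ℂ A]
    (h : (σ → Fin 3) → ((σ → Fin 2) → ℂ) →ₐ[ℂ] A) (β : σ → Fin 3 → A) : Prop where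
  sign : ∀ y s, h y (fun b => sgn (b s)) = β s (y s)
  anticomm : ∀ s, β s 1 * β s 0 = -(β s 0 * β s 1)

/-- A family of functional calculi of measurements of Pauli observables: the observables of the
sites satisfy the relations of the Pauli matrices, with `c = ± i`. -/
structure IsPauliCalculus {A : Type*} [Ring A] [Algebra ℂ A]
    (h : (σ → Fin 3) → ((σ → Fin 2) → ℂ) →ₐ[ℂ] A) (β : σ → Fin 3 → A) (c : ℂ) : Prop
    extends IsAnticommuting h β where
  phase : c = Complex.I ∨ c = -Complex.I
  third : ∀ s, β s 2 = c • (β s 1 * β s 0)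

/-- The product measurement of Pauli observables. -/
theorem isPVM_pauliTensor {c : ℂ} (hc : c = Complex.I ∨ c = -Complex.I) (y : σ → Fin 3) :
    IsPVM fun b : σ → Fin 2 => tensor fun s => signProj (pauliC c (y s)) (b s) :=
  IsPVM.tensor fun s => isPVM_pauliC hc (y s)

theorem trace_pauliTensor (c : ℂ) (y : σ → Fin 3) (b : σ → Fin 2) :
    (tensor fun s => signProj (pauliC c (y s)) (b s)).trace = 1 := by
  have : ∀ y b, (signProj (pauliC c y) b).trace = 1 := by
    intro y b
    have : (pauliC c y).trace = 0 := by
      fin_cases y <;> simp [pauliC, pauli, Matrix.trace, Fin.sum_univ_two]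
    simp [signProj, trace_add, this]
  rw [trace_tensor]
  simp [this]

variable {A : Type*} [Ring A] [Algebra ℂ A]

/-- The bit flip with label `w`. -/
noncomputable def flipOp (h : (σ → Fin 3) → ((σ → Fin 2) → ℂ) →ₐ[ℂ] A) (w : σ → Fin 2) : A :=
  h (fun _ => 1) (chi w)

/-- The projector onto the computational basis state `u`. -/
noncomputable def basisProj (h : (σ → Fin 3) → ((σ → Fin 2) → ℂ) →ₐ[ℂ] A) (u : σ → Fin 2) : A :=
  h (fun _ => 0) (Pi.single u 1)

/-- The matrix unit `|w⟩⟨w'|`. -/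
noncomputable def matUnit (h : (σ → Fin 3) → ((σ → Fin 2) → ℂ) →ₐ[ℂ] A) (w w' : σ → Fin 2) : A :=
  flipOp h w * basisProj h 0 * flipOp h w'

/-- The representation of matrices by matrix units. -/
noncomputable def unitRep (h : (σ → Fin 3) → ((σ → Fin 2) → ℂ) →ₐ[ℂ] A)
    (D : Matrix (σ → Fin 2) (σ → Fin 2) ℂ) : A :=
  ∑ w, ∑ w', D w w' • matUnit h w w'

theorem flipOp_mul (h : (σ → Fin 3) → ((σ → Fin 2) → ℂ) →ₐ[ℂ] A) (w w' : σ → Fin 2) :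
    flipOp h w * flipOp h w' = flipOp h (w + w') := by
  rw [flipOp, flipOp, ← map_mul, chi_mul, flipOp]

theorem flipOp_zero (h : (σ → Fin 3) → ((σ → Fin 2) → ℂ) →ₐ[ℂ] A) : flipOp h 0 = 1 := by
  rw [flipOp, chi_zero, map_one]

theorem flipOp_mul_self (h : (σ → Fin 3) → ((σ → Fin 2) → ℂ) →ₐ[ℂ] A) (w : σ → Fin 2) :
    flipOp h w * flipOp h w = 1 := by
  rw [flipOp_mul, bits_add_self, flipOp_zero]

variable {h : (σ → Fin 3) → ((σ → Fin 2) → ℂ) →ₐ[ℂ] A} {β : σ → Fin 3 → A} {c : ℂ}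

theorem basisProj_mul (u v : σ → Fin 2) :
    basisProj h u * basisProj h v = if u = v then basisProj h u else 0 := by
  rw [basisProj, basisProj, ← map_mul]
  split_ifs with huv
  · subst huv
    congr 1
    funext b
    by_cases hb : b = u <;> simp [hb]
  · rw [show (Pi.single u 1 : (σ → Fin 2) → ℂ) * Pi.single v 1 = 0 from ?_, map_zero]
    funext b
    by_cases hb : b = u <;> simp [Pi.single_apply, hb, huv]

theorem sum_basisProj : ∑ u, basisProj h u = 1 := by
  simp only [basisProj, ← map_sum]
  rw [← map_one (h fun _ => 0)]
  congr 1
  funext b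
  simp [Finset.sum_apply, Pi.single_apply]

theorem flipOp_mul_matUnit (w v v' : σ → Fin 2) :
    flipOp h w * matUnit h v v' = matUnit h (w + v) v' := by
  rw [matUnit, ← mul_assoc, ← mul_assoc, flipOp_mul, matUnit]

theorem matUnit_mul_flipOp (w v v' : σ → Fin 2) :
    matUnit h v v' * flipOp h w = matUnit h v (v' + w) := by
  rw [matUnit, mul_assoc, flipOp_mul, matUnit]

theorem unitRep_add (D D' : Matrix (σ → Fin 2) (σ → Fin 2) ℂ) :
    unitRep h (D + D') = unitRep h D + unitRep h D' := by
  simp [unitRep, add_smul, Finset.sum_add_distrib]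

theorem unitRep_smul (a : ℂ) (D : Matrix (σ → Fin 2) (σ → Fin 2) ℂ) :
    unitRep h (a • D) = a • unitRep h D := by
  simp [unitRep, mul_smul, Finset.smul_sum]

namespace IsAnticommuting

/-- One input can ask for `m` at `s` and for `m'` at `t`. Both bits are then outputs of a single
measurement, whose functional calculus is commutative. -/
theorem comm (H : IsAnticommuting h β) {s t : σ} (hst : s ≠ t) (m m' : Fin 3) :
    β s m * β t m' = β t m' * β s m := by
  have h1 := H.sign (Function.update (fun _ => m') s m) s
  have h2 := H.sign (Function.update (fun _ => m') s m) t
  rw [Function.update_self] at h1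
  rw [Function.update_of_ne hst.symm] at h2
  rw [← h1, ← h2, ← map_mul, mul_comm, map_mul]

/-- Conjugation by the `σ_z` of a site flips the sign of the `σ_x` of this site and fixes those of
the others. These signs generate all functions of the outputs, so the conjugation acts on functions
as the shift by `Pi.single s 1`. -/
theorem calc_mul_obs (H : IsAnticommuting h β) (s : σ) (g : (σ → Fin 2) → ℂ) :
    h (fun _ => 1) g * β s 0 = β s 0 * h (fun _ => 1) fun b => g (b + Pi.single s 1) := by
  induction g using signs_induction with
  | hc a =>
    have : h (fun _ => 1) (fun _ => a) = algebraMap ℂ A a := (h (fun _ => 1)).commutes a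
    rw [this, Algebra.commutes]
  | ha f g hf hg =>
    rw [map_add, add_mul, hf, hg, ← mul_add, ← map_add]
    rfl
  | hm f g hf hg =>
    rw [map_mul, mul_assoc, hg, ← mul_assoc, hf, mul_assoc, ← map_mul]
    rfl
  | hs t =>
    rw [H.sign]
    by_cases hst : t = s
    · subst hst
      have : (fun b : σ → Fin 2 => sgn ((b + Pi.single t 1 : σ → Fin 2) t)) =
          -fun b => sgn (b t) := by
        funext b
        simp [sgn_add, sgn_one]
      rw [this, map_neg, H.sign, H.anticomm, mul_neg]
    · have : (fun b : σ → Fin 2 => sgn ((b + Pi.single s 1 : σ → Fin 2) t)) =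
          fun b => sgn (b t) := by
        funext b
        simp [hst]
      rw [this, H.sign, H.comm hst]

/-- The dual of `calc_mul_obs`: a product of `σ_x` observables translates functions of the
computational basis labels. On a generator, moving `σ_z` through the character `chi w` produces the
sign `sgn (w t)`. -/
theorem flipOp_mul_calc (H : IsAnticommuting h β) (w : σ → Fin 2) (f : (σ → Fin 2) → ℂ) :
    flipOp h w * h (fun _ => 0) f = h (fun _ => 0) (fun b => f (b + w)) * flipOp h w := by
  induction f using signs_induction with
  | hc a =>
    have : h (fun _ => 0) (fun _ => a) = algebraMap ℂ A a := (h (fun _ => 0)).commutes a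
    rw [this, Algebra.commutes]
  | ha f g hf hg =>
    rw [map_add, mul_add, hf, hg, ← add_mul, ← map_add]
    rfl
  | hm f g hf hg =>
    rw [map_mul, ← mul_assoc, hf, mul_assoc, hg, ← mul_assoc, ← map_mul]
    rfl
  | hs t =>
    have h1 : (fun b : σ → Fin 2 => sgn ((b + w) t)) = sgn (w t) • fun b => sgn (b t) := by
      funext b
      simp [sgn_add, mul_comm]
    have h2 : (fun b => chi w (b + Pi.single t 1)) = sgn (w t) • chi w := by
      funext b
      simp [chi_add_right, chi_single_right, mul_comm]
    rw [h1, map_smul, H.sign, flipOp, H.calc_mul_obs, h2, map_smul, mul_smul_comm, smul_mul_assoc]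

theorem flipOp_mul_basisProj (H : IsAnticommuting h β) (w u : σ → Fin 2) :
    flipOp h w * basisProj h u = basisProj h (u + w) * flipOp h w := by
  have : (fun b => (Pi.single u 1 : (σ → Fin 2) → ℂ) (b + w)) = Pi.single (u + w) 1 := by
    funext b
    have : b + w = u ↔ b = u + w := by
      constructor
      · rintro rfl; rw [add_assoc, bits_add_self, add_zero]
      · rintro rfl; rw [add_assoc, bits_add_self, add_zero]
    simp only [Pi.single_apply, this]
  rw [basisProj, H.flipOp_mul_calc, this, basisProj]

/-- Between the two projectors onto `0` stands the flip with label `w' + v`. It moves one of them to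
`w' + v`, which is orthogonal to `0` unless `w' = v`. -/
theorem matUnit_mul (H : IsAnticommuting h β) (w w' v v' : σ → Fin 2) :
    matUnit h w w' * matUnit h v v' = if w' = v then matUnit h w v' else 0 := by
  have h1 : matUnit h w w' * matUnit h v v' =
      flipOp h w * (basisProj h 0 * (flipOp h (w' + v) * basisProj h 0)) * flipOp h v' := by
    simp only [matUnit, ← flipOp_mul, mul_assoc]
  rw [h1, H.flipOp_mul_basisProj, ← mul_assoc (basisProj h 0), basisProj_mul, zero_add]
  have h2 : 0 = w' + v ↔ w' = v := by
    constructor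
    · intro h0
      have := congrArg (· + v) h0
      simpa [add_assoc, bits_add_self] using this.symm
    · rintro rfl; rw [bits_add_self]
  simp only [h2]
  split_ifs with hv
  · rw [hv, bits_add_self, flipOp_zero, mul_one, matUnit]
  · simp

theorem matUnit_self (H : IsAnticommuting h β) (w : σ → Fin 2) :
    matUnit h w w = basisProj h w := by
  rw [matUnit, H.flipOp_mul_basisProj, mul_assoc, flipOp_mul_self, mul_one, zero_add]

theorem flipOp_mul_basisProj_self (H : IsAnticommuting h β) (u : σ → Fin 2) :
    flipOp h u * basisProj h u = matUnit h 0 u := by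
  rw [H.flipOp_mul_basisProj, bits_add_self, matUnit, flipOp_zero, one_mul]

theorem basisProj_mul_flipOp_self (H : IsAnticommuting h β) (u : σ → Fin 2) :
    basisProj h u * flipOp h u = matUnit h u 0 := by
  rw [matUnit, flipOp_zero, mul_one, H.flipOp_mul_basisProj, zero_add]

theorem matUnit_mul_unitRep (H : IsAnticommuting h β) (D : Matrix (σ → Fin 2) (σ → Fin 2) ℂ)
    (u v : σ → Fin 2) : matUnit h u v * unitRep h D = ∑ w, D v w • matUnit h u w := by
  simp only [unitRep, Finset.mul_sum, mul_smul_comm, H.matUnit_mul]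
  simp

/-- Together with `unitRep_one` this makes `unitRep` a representation of the full matrix algebra, so
identities between Pauli matrices transfer to `A`. -/
theorem unitRep_mul (H : IsAnticommuting h β) (D D' : Matrix (σ → Fin 2) (σ → Fin 2) ℂ) :
    unitRep h (D * D') = unitRep h D * unitRep h D' := by
  rw [unitRep.eq_1 h D]
  simp only [Finset.sum_mul, smul_mul_assoc, H.matUnit_mul_unitRep]
  simp only [unitRep, mul_apply, Finset.sum_smul, Finset.smul_sum, smul_smul]
  exact Finset.sum_congr rfl fun w _ => Finset.sum_comm

theorem unitRep_one (H : IsAnticommuting h β) : unitRep h 1 = 1 := by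
  simp [unitRep, one_apply, H.matUnit_self, sum_basisProj]

theorem unitRep_onFactor_pauli_zero (H : IsAnticommuting h β) (s : σ) :
    unitRep h (onFactor s (pauli 0)) = β s 0 := by
  have h1 : ∀ w w' : σ → Fin 2, onFactor s (pauli 0) w w' = if w = w' then sgn (w s) else 0 := by
    intro w w'
    have h2 : ∀ a b, pauli 0 a b = if a = b then sgn a else 0 := by
      intro a b
      fin_cases a <;> fin_cases b <;> simp [pauli, sgn]
    rw [onFactor_apply_ite, h2]
    by_cases hw : w = w'
    · simp [hw]
    · by_cases hs : w s = w' s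
      · rw [if_neg, if_neg hw]
        exact fun hi => hw (funext fun i => if his : i = s then his ▸ hs else hi i his)
      · simp [hs, hw]
  -- Spectral decomposition of `σ_z`, to be compared with the diagonal matrix units.
  have h2 : (fun b : σ → Fin 2 => sgn (b s)) = ∑ w, sgn (w s) • Pi.single w 1 := by
    funext b
    simp [Finset.sum_apply, Pi.single_apply]
  rw [← H.sign (fun _ => 0) s, h2]
  simp [unitRep, h1, H.matUnit_self, basisProj]

theorem unitRep_onFactor_pauli_one (H : IsAnticommuting h β) (s : σ) :
    unitRep h (onFactor s (pauli 1)) = β s 1 := by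
  have h1 : ∀ w w' : σ → Fin 2, onFactor s (pauli 1) w w' =
      if w = Pi.single s 1 + w' then 1 else 0 := by
    intro w w'
    have h2 : ∀ a b, pauli 1 a b = if a = 1 + b then 1 else 0 := by
      intro a b
      fin_cases a <;> fin_cases b <;> simp [pauli]
    rw [onFactor_apply_ite, h2, ← ite_and]
    refine if_congr ?_ rfl rfl
    rw [funext_iff]
    constructor
    · rintro ⟨hi, hs⟩ i
      by_cases his : i = s
      · subst his; simpa using hs
      · simpa [his] using hi i his
    · exact fun hi => ⟨fun i his => by simpa [his] using hi i, by simpa using hi s⟩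
  have h2 : (fun b : σ → Fin 2 => sgn (b s)) = chi (Pi.single s 1) := by
    funext b
    rw [chi_single]
  -- `σ_x` is the sum of the matrix units `|w + e_s⟩⟨w|`; the flip at `s` can be pulled out, and the
  -- diagonal units that remain sum to one.
  rw [← H.sign (fun _ => 1) s, h2, unitRep, Finset.sum_comm]
  simp only [h1, ite_smul, one_smul, zero_smul, Finset.sum_ite_eq', Finset.mem_univ, if_true,
    ← flipOp_mul_matUnit, ← Finset.mul_sum, H.matUnit_self, sum_basisProj, mul_one]
  rfl

end IsAnticommuting

namespace IsPauliCalculus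

/-- The relation `third` is the definition of `pauliC c 2` read in the algebra `A`; the other two
observables need no knowledge of `c`. -/
theorem unitRep_onFactor (H : IsPauliCalculus h β c) (s : σ) (m : Fin 3) :
    unitRep h (onFactor s (pauliC c m)) = β s m := by
  fin_cases m
  · exact H.unitRep_onFactor_pauli_zero s
  · exact H.unitRep_onFactor_pauli_one s
  · simp only [pauliC]
    simp only [Fin.reduceFinMk, Matrix.cons_val, onFactor_smul, ← onFactor_mul, unitRep_smul,
      H.unitRep_mul, H.unitRep_onFactor_pauli_zero, H.unitRep_onFactor_pauli_one, H.third]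

/-- Under the Pauli relations, all measurements are represented by the Pauli measurements. -/
theorem calc_eq_unitRep (H : IsPauliCalculus h β c) (y : σ → Fin 3) (f : (σ → Fin 2) → ℂ) :
    h y f = unitRep h ((isPVM_pauliTensor H.phase y).calc f) := by
  induction f using signs_induction with
  | hc a =>
    have h1 : h y (fun _ => a) = algebraMap ℂ A a := (h y).commutes a
    have h2 : (isPVM_pauliTensor H.phase y).calc (fun _ => a) = algebraMap ℂ _ a :=
      AlgHom.commutes _ a
    rw [h1, h2, Algebra.algebraMap_eq_smul_one, Algebra.algebraMap_eq_smul_one, unitRep_smul,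
      H.unitRep_one]
  | ha f g hf hg => rw [map_add, hf, hg, map_add, unitRep_add]
  | hm f g hf hg => rw [map_mul, hf, hg, map_mul, H.unitRep_mul]
  | hs s =>
    have : (isPVM_pauliTensor H.phase y).calc (fun b => sgn (b s)) = onFactor s (pauliC c (y s)) :=
      (IsPVM.tensor_calc (fun s => isPVM_pauliC H.phase (y s)) s sgn).trans
        (congrArg _ (signProj_calc_sgn (pauliC_hermitian H.phase _) (pauliC_mul_self H.phase _)))
    rw [H.sign, this, H.unitRep_onFactor]

/-- Discarding the qubits of a state and preparing a matrix unit instead. -/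
theorem sum_discard (H : IsPauliCalculus h β c) (y : σ → Fin 3) (f : (σ → Fin 2) → ℂ)
    (w w' : σ → Fin 2) :
    ∑ u, flipOp h w * flipOp h u * basisProj h u * h y f *
      (basisProj h u * flipOp h u * flipOp h w') = (∑ b, f b) • matUnit h w w' := by
  have h1 : ∀ u, flipOp h w * flipOp h u * basisProj h u * h y f *
      (basisProj h u * flipOp h u * flipOp h w') =
      (isPVM_pauliTensor H.phase y).calc f u u • matUnit h w w' := by
    intro u
    rw [mul_assoc (flipOp h w), H.flipOp_mul_basisProj_self, H.basisProj_mul_flipOp_self,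
      flipOp_mul_matUnit, matUnit_mul_flipOp, H.calc_eq_unitRep, H.matUnit_mul_unitRep, add_zero,
      zero_add, Finset.sum_mul]
    simp only [smul_mul_assoc, H.matUnit_mul]
    simp
  simp only [h1, ← Finset.sum_smul]
  congr 1
  -- Measuring in the computational basis and resetting leaves only the trace of the old operator.
  -- Each product Pauli projector has trace one, so this trace is `∑ b, f b`.
  have h2 : ∑ u, (isPVM_pauliTensor H.phase y).calc f u u =
      ((isPVM_pauliTensor H.phase y).calc f).trace := rfl
  rw [h2, IsPVM.calc_apply, trace_sum]
  simp only [trace_smul, trace_pauliTensor, smul_eq_mul, mul_one]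

end IsPauliCalculus

end Calculus

/-! ### Operators of one party that are mirrored by operators of the other parties -/

section Mirror

/-- The embedding of the operators of one tensor factor. -/
noncomputable def onFactorHom {J : Type*} [Fintype J] [DecidableEq J] {p : J → Type*}
    [∀ j, Fintype (p j)] [∀ j, DecidableEq (p j)] (j : J) :
    Matrix (p j) (p j) ℂ →⋆ₐ[ℂ] Matrix (∀ j, p j) (∀ j, p j) ℂ where
  toFun := onFactor j
  map_one' := onFactor_one j
  map_mul' S T := (onFactor_mul j S T).symm
  map_zero' := onFactor_zero j
  map_add' := onFactor_add j
  commutes' r := by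
    rw [Algebra.algebraMap_eq_smul_one, Algebra.algebraMap_eq_smul_one, onFactor_smul,
      onFactor_one]
  map_star' T := (onFactor_conjTranspose j T).symm

variable {X Y : Type*} [Fintype X] [DecidableEq X] [Fintype Y] [DecidableEq Y]

/-- The operators that act on `M` from the right, together with their adjoints, in the same way as
operators from a given algebra act from the left. -/
def mirrorAlgebra {B : Type*} [Ring B] [StarRing B] [Algebra ℂ B] [StarModule ℂ B]
    (φ : B →⋆ₐ[ℂ] Matrix X X ℂ) (M : Matrix X Y ℂ) : Subalgebra ℂ (Matrix Y Y ℂ) where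
  carrier := {t | ∃ T, φ T * M = M * t ∧ φ (star T) * M = M * tᴴ}
  mul_mem' := by
    rintro t t' ⟨T, h1, h2⟩ ⟨T', h3, h4⟩
    refine ⟨T * T', ?_, ?_⟩
    · rw [map_mul, Matrix.mul_assoc, h3, ← Matrix.mul_assoc, h1, Matrix.mul_assoc]
    · rw [star_mul, map_mul, Matrix.mul_assoc, h2, ← Matrix.mul_assoc, h4, Matrix.mul_assoc,
        conjTranspose_mul]
  add_mem' := by
    rintro t t' ⟨T, h1, h2⟩ ⟨T', h3, h4⟩
    refine ⟨T + T', ?_, ?_⟩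
    · rw [map_add, Matrix.add_mul, h1, h3, Matrix.mul_add]
    · rw [star_add, map_add, Matrix.add_mul, h2, h4, conjTranspose_add, Matrix.mul_add]
  algebraMap_mem' r := by
    refine ⟨algebraMap ℂ B r, ?_, ?_⟩
    · rw [AlgHomClass.commutes, Algebra.algebraMap_eq_smul_one, Algebra.algebraMap_eq_smul_one]
      simp
    · rw [map_star, AlgHomClass.commutes, Algebra.algebraMap_eq_smul_one,
        Algebra.algebraMap_eq_smul_one, star_eq_conjTranspose]
      simp

/-- The operators on the right that are mirrored by operators on the left. -/
abbrev fullMirror (M : Matrix X Y ℂ) : Subalgebra ℂ (Matrix Y Y ℂ) :=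
  mirrorAlgebra (StarAlgHom.id ℂ (Matrix X X ℂ)) M

theorem mirrorAlgebra_le {B : Type*} [Ring B] [StarRing B] [Algebra ℂ B] [StarModule ℂ B]
    (φ : B →⋆ₐ[ℂ] Matrix X X ℂ) (M : Matrix X Y ℂ) : mirrorAlgebra φ M ≤ fullMirror M := by
  rintro t ⟨T, h1, h2⟩
  exact ⟨φ T, h1, by rw [← map_star]; exact h2⟩

/-- Mirrored operators are identified if they act on `M` in the same way. -/
def mirrorCon (M : Matrix X Y ℂ) : RingCon (fullMirror M) where
  r t t' := M * t.1 = M * t'.1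
  iseqv := ⟨fun _ => rfl, Eq.symm, Eq.trans⟩
  add' := by
    intro a b c d h1 h2
    change M * (a.1 + c.1) = M * (b.1 + d.1)
    rw [Matrix.mul_add, Matrix.mul_add, h1, h2]
  mul' := by
    intro a b c d h1 h2
    -- Only here does the congruence need mirrors: to multiply `c` and `d` from the left by `b`
    -- without losing `M`, the factor `b` is carried to the left of `M`.
    obtain ⟨T, hT, -⟩ := b.2
    change M * (a.1 * c.1) = M * (b.1 * d.1)
    rw [← Matrix.mul_assoc, h1, ← Matrix.mul_assoc, ← hT, Matrix.mul_assoc, h2, ← Matrix.mul_assoc]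

/-- The algebra of mirrored operators in their action on `M`. -/
def MirrorQuot (M : Matrix X Y ℂ) : Type _ := (mirrorCon M).Quotient

instance (M : Matrix X Y ℂ) : Ring (MirrorQuot M) := inferInstanceAs (Ring (mirrorCon M).Quotient)

instance (M : Matrix X Y ℂ) : Algebra ℂ (MirrorQuot M) :=
  inferInstanceAs (Algebra ℂ (mirrorCon M).Quotient)

/-- The class of a mirrored operator. -/
def mirrorMk (M : Matrix X Y ℂ) : fullMirror M →ₐ[ℂ] MirrorQuot M where
  toRingHom := (mirrorCon M).mk'
  commutes' _ := rfl

theorem mirrorMk_eq {M : Matrix X Y ℂ} {t t' : fullMirror M} :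
    mirrorMk M t = mirrorMk M t' ↔ M * t.1 = M * t'.1 :=
  RingCon.eq (mirrorCon M)

theorem mul_coe_algebraMap (M : Matrix X Y ℂ) (a : ℂ) :
    M * (algebraMap ℂ (fullMirror M) a).1 = a • M := by
  change M * algebraMap ℂ (Matrix Y Y ℂ) a = a • M
  rw [Algebra.algebraMap_eq_smul_one, Matrix.mul_smul, Matrix.mul_one]

end Mirror

/-! ### Measurements of many sites that are mirrored party by party -/

section Sites

variable {N k : ℕ} {p : Fin N → Type*} [∀ j, Fintype (p j)] [∀ j, DecidableEq (p j)]
  {Y : Type*} [Fintype Y] [DecidableEq Y]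

/-- The measurements `n y` act on `M` from the right, and the observable of the output bit of each
site is mirrored by the party that holds the site. -/
structure IsMirrored (M : Matrix (∀ j, p j) Y ℂ)
    (n : (Site N k → Fin 3) → (Site N k → Fin 2) → Matrix Y Y ℂ) : Prop where
  pvm : ∀ y, IsPVM (n y)
  sign : ∀ y s, (pvm y).calc (fun b => sgn (b s)) ∈ mirrorAlgebra (onFactorHom s.1) M

namespace IsMirrored

variable {M : Matrix (∀ j, p j) Y ℂ} {n : (Site N k → Fin 3) → (Site N k → Fin 2) → Matrix Y Y ℂ}

/-- The mirrored operators of a party form an algebra and contain the signs of the bits of this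
party, which generate all functions of these bits. -/
theorem party (H : IsMirrored M n) (y : Site N k → Fin 3) (j : Fin N) (g : Reg k → ℂ) :
    (H.pvm y).calc (fun b => g fun i => b (j, i)) ∈ mirrorAlgebra (onFactorHom j) M := by
  induction g using signs_induction with
  | hc a =>
    have : (H.pvm y).calc (fun _ => a) = algebraMap ℂ _ a := (H.pvm y).calc.commutes a
    rw [this]
    exact Subalgebra.algebraMap_mem _ a
  | ha f g hf hg =>
    have := Subalgebra.add_mem _ hf hg
    rwa [← map_add] at this
  | hm f g hf hg =>
    have := Subalgebra.mul_mem _ hf hg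
    rwa [← map_mul] at this
  | hs i => exact H.sign y (j, i)

theorem full (H : IsMirrored M n) (y : Site N k → Fin 3) (f : (Site N k → Fin 2) → ℂ) :
    (H.pvm y).calc f ∈ fullMirror M := by
  induction f using signs_induction with
  | hc a =>
    have : (H.pvm y).calc (fun _ => a) = algebraMap ℂ _ a := (H.pvm y).calc.commutes a
    rw [this]
    exact Subalgebra.algebraMap_mem _ a
  | ha f g hf hg =>
    rw [map_add]
    exact Subalgebra.add_mem _ hf hg
  | hm f g hf hg =>
    rw [map_mul]
    exact Subalgebra.mul_mem _ hf hg
  | hs s => exact mirrorAlgebra_le _ M (H.sign y s)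

/-- The functional calculus of the measurements as mirrored operators. -/
noncomputable def lift (H : IsMirrored M n) (y : Site N k → Fin 3) :
    ((Site N k → Fin 2) → ℂ) →ₐ[ℂ] fullMirror M :=
  (H.pvm y).calc.codRestrict (fullMirror M) (H.full y)

theorem lift_coe (H : IsMirrored M n) (y : Site N k → Fin 3) (f : (Site N k → Fin 2) → ℂ) :
    (H.lift y f : Matrix Y Y ℂ) = (H.pvm y).calc f := rfl

/-- The functional calculus of the measurements in their action on `M`. -/
noncomputable def hom (H : IsMirrored M n) (y : Site N k → Fin 3) :
    ((Site N k → Fin 2) → ℂ) →ₐ[ℂ] MirrorQuot M :=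
  (mirrorMk M).comp (H.lift y)

/-- Local mirror operators of a product of functions of the bits of the parties. -/
theorem tensor_mul_eq (H : IsMirrored M n) (y : Site N k → Fin 3) (g : ∀ _ : Fin N, Reg k → ℂ)
    (T : ∀ j, Matrix (p j) (p j) ℂ)
    (hT : ∀ j, onFactor j (T j) * M = M * (H.pvm y).calc fun b => g j fun i => b (j, i)) :
    tensor T * M = M * (H.pvm y).calc fun b => ∏ j, g j fun i => b (j, i) := by
  have := NetworkSelfTest.tensor_mul_eq (M := M) T _ hT
    (fun s => (H.pvm y).calc (∏ j ∈ s, fun b => g j fun i => b (j, i))) (by simp) ?_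
  · rw [this]
    congr 2
    funext b
    simp
  · intro s j hj
    rw [Finset.prod_insert hj, mul_comm, map_mul]

/-- The bit flips of the sites as mirrored operators. -/
noncomputable def flip (H : IsMirrored M n) (w : Site N k → Fin 2) : fullMirror M :=
  H.lift (fun _ => 1) (chi w)

/-- The projectors onto the computational basis states of the sites as mirrored operators. -/
noncomputable def basis (H : IsMirrored M n) (u : Site N k → Fin 2) : fullMirror M :=
  H.lift (fun _ => 0) (Pi.single u 1)

theorem mk_flip (H : IsMirrored M n) (w : Site N k → Fin 2) :
    mirrorMk M (H.flip w) = flipOp H.hom w := rfl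

theorem mk_basis (H : IsMirrored M n) (u : Site N k → Fin 2) :
    mirrorMk M (H.basis u) = basisProj H.hom u := rfl

theorem mk_lift (H : IsMirrored M n) (y : Site N k → Fin 3) (f : (Site N k → Fin 2) → ℂ) :
    mirrorMk M (H.lift y f) = H.hom y f := rfl

theorem flip_conjTranspose (H : IsMirrored M n) (w : Site N k → Fin 2) :
    (H.flip w).1ᴴ = (H.flip w).1 := by
  change ((H.pvm _).calc (chi w))ᴴ = (H.pvm _).calc (chi w)
  rw [IsPVM.calc_star, star_chi]

theorem flip_mul_self (H : IsMirrored M n) (w : Site N k → Fin 2) :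
    (H.flip w).1 * (H.flip w).1 = 1 := by
  change (H.pvm _).calc (chi w) * (H.pvm _).calc (chi w) = 1
  rw [← map_mul, chi_mul, bits_add_self, chi_zero, map_one]

theorem basis_eq (H : IsMirrored M n) (u : Site N k → Fin 2) :
    (H.basis u).1 = n (fun _ => 0) u :=
  (H.pvm _).calc_single u

end IsMirrored

/-- The labels of the sites as one label. -/
def flat : (Fin N → Reg k) ≃ (Site N k → Fin 2) := (Equiv.curry (Fin N) (Fin k) (Fin 2)).symm

theorem flat_apply (u : Fin N → Reg k) (s : Site N k) : flat u s = u s.1 s.2 := rfl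

theorem chi_flat (w : Fin N → Reg k) (b : Site N k → Fin 2) :
    chi (flat w) b = ∏ j, chi (w j) fun i => b (j, i) := by
  simp only [chi, Fintype.prod_prod_type, flat_apply]

theorem single_flat (u : Fin N → Reg k) (b : Site N k → Fin 2) :
    (Pi.single (flat u) 1 : (Site N k → Fin 2) → ℂ) b =
      ∏ j, (Pi.single (u j) 1 : Reg k → ℂ) fun i => b (j, i) := by
  simp only [Pi.single_apply, Finset.prod_ite_zero, Finset.prod_const_one]
  refine if_congr ?_ rfl rfl
  constructor
  · rintro rfl j -
    rfl
  · intro h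
    funext s
    exact congrFun (h s.1 (Finset.mem_univ _)) s.2

/-- Local operators of the party `j` that act on `M` as the bit flips and as the projectors onto
the computational basis states. -/
structure LocalMirror (M : Matrix (∀ j, p j) Y ℂ)
    {n : (Site N k → Fin 3) → (Site N k → Fin 2) → Matrix Y Y ℂ} (H : IsMirrored M n)
    (j : Fin N) where
  flip : Reg k → Matrix (p j) (p j) ℂ
  basis : Reg k → Matrix (p j) (p j) ℂ
  flip_mul : ∀ u, onFactor j (flip u) * M =
    M * (H.pvm fun _ => 1).calc fun b => chi u fun i => b (j, i)
  flip_star_mul : ∀ u, onFactor j (flip u)ᴴ * M =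
    M * (H.pvm fun _ => 1).calc fun b => chi u fun i => b (j, i)
  basis_mul : ∀ u, onFactor j (basis u) * M =
    M * (H.pvm fun _ => 0).calc fun b => (Pi.single u 1 : Reg k → ℂ) fun i => b (j, i)
  basis_star_mul : ∀ u, onFactor j (basis u)ᴴ * M =
    M * (H.pvm fun _ => 0).calc fun b => (Pi.single u 1 : Reg k → ℂ) fun i => b (j, i)

variable {M : Matrix (∀ j, p j) Y ℂ} {n : (Site N k → Fin 3) → (Site N k → Fin 2) → Matrix Y Y ℂ}

/-- Characters and indicators are real, so their operators on the right are Hermitian. Hence a local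
mirror and its adjoint, although perhaps different operators, act on `M` in the same way. -/
theorem IsMirrored.exists_localMirror (H : IsMirrored M n) (j : Fin N) :
    Nonempty (LocalMirror M H j) := by
  have h1 : ∀ (y : Site N k → Fin 3) (g : Reg k → ℂ), star g = g → ∃ T : Matrix (p j) (p j) ℂ,
      onFactor j T * M = M * (H.pvm y).calc (fun b => g fun i => b (j, i)) ∧
      onFactor j Tᴴ * M = M * (H.pvm y).calc fun b => g fun i => b (j, i) := by
    intro y g hg
    obtain ⟨T, h1, h2⟩ := H.party y j g
    refine ⟨T, h1, h2.trans ?_⟩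
    rw [IsPVM.calc_star]
    congr 2
    funext b
    exact congrFun hg _
  have h2 : ∀ u : Reg k, star (Pi.single u 1 : Reg k → ℂ) = Pi.single u 1 := fun u => by
    funext b
    simp only [Pi.star_apply, Pi.single_apply, apply_ite star, star_one, star_zero]
  choose X hX hX' using fun u => h1 (fun _ => 1) (chi u) (star_chi u)
  choose Q hQ hQ' using fun u => h1 (fun _ => 0) (Pi.single u 1) (h2 u)
  exact ⟨⟨X, Q, hX, hX', hQ, hQ'⟩⟩

namespace LocalMirror

variable {H : IsMirrored M n}

theorem tensor_flip_mul (T : ∀ j, LocalMirror M H j) (w : Fin N → Reg k) :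
    tensor (fun j => (T j).flip (w j)) * M = M * (H.flip (flat w)).1 := by
  refine (H.tensor_mul_eq (fun _ => 1) (fun j => chi (w j)) _ fun j => (T j).flip_mul _).trans ?_
  change _ = M * (H.pvm fun _ => 1).calc (chi (flat w))
  congr 2
  funext b
  rw [chi_flat]

theorem tensor_basis_mul (T : ∀ j, LocalMirror M H j) (u : Fin N → Reg k) :
    tensor (fun j => (T j).basis (u j)) * M = M * (H.basis (flat u)).1 := by
  refine (H.tensor_mul_eq (fun _ => 0) (fun j => Pi.single (u j) 1) _
    fun j => (T j).basis_mul _).trans ?_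
  change _ = M * (H.pvm fun _ => 0).calc (Pi.single (flat u) 1)
  congr 2
  funext b
  rw [single_flat]

/-- A local flip need not be unitary, but it preserves norms on the state, since the operator that
it mirrors is an involution. -/
theorem flip_star_mul_flip (T : ∀ j, LocalMirror M H j) (j : Fin N) (u : Reg k) :
    onFactor j ((T j).flip u)ᴴ * (onFactor j ((T j).flip u) * M) = M := by
  rw [(T j).flip_mul, ← Matrix.mul_assoc, (T j).flip_star_mul, Matrix.mul_assoc, ← map_mul]
  have : (fun b : Site N k → Fin 2 => chi u fun i => b (j, i)) *
      (fun b => chi u fun i => b (j, i)) = 1 := by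
    funext b
    have := congrFun (chi_mul u u) fun i => b (j, i)
    rwa [bits_add_self, chi_zero] at this
  rw [this, map_one, Matrix.mul_one]

theorem sum_basis_star_mul_basis (T : ∀ j, LocalMirror M H j) (j : Fin N) :
    ∑ u, onFactor j ((T j).basis u)ᴴ * (onFactor j ((T j).basis u) * M) = M := by
  have h1 : ∀ u, onFactor j ((T j).basis u)ᴴ * (onFactor j ((T j).basis u) * M) =
      M * (H.pvm fun _ => 0).calc fun b => (Pi.single u 1 : Reg k → ℂ) fun i => b (j, i) := by
    intro u
    rw [(T j).basis_mul, ← Matrix.mul_assoc, (T j).basis_star_mul, Matrix.mul_assoc, ← map_mul]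
    congr 2
    funext b
    simp [Pi.single_apply]
  simp only [h1]
  rw [← Matrix.mul_sum, ← map_sum]
  have : ∑ u : Reg k, (fun b : Site N k → Fin 2 =>
      (Pi.single u 1 : Reg k → ℂ) fun i => b (j, i)) = 1 := by
    funext b
    simp [Finset.sum_apply, Pi.single_apply]
  rw [this, map_one, Matrix.mul_one]

end LocalMirror

/-- The projection of a party onto the support of its reduced state. -/
structure Support (M : Matrix (∀ j, p j) Y ℂ) (j : Fin N) where
  proj : Matrix (p j) (p j) ℂ
  star_eq : projᴴ = proj
  mul_self : proj * proj = proj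
  mul_eq : onFactor j proj * M = M
  mul_eq_zero : ∀ T, onFactor j T * M = 0 → T * proj = 0

/-- The support of the reduced state of party `j` is the column space of `M` reshaped with the index
of this party alone as row index. -/
theorem exists_support (M : Matrix (∀ j, p j) Y ℂ) (j : Fin N) : Nonempty (Support M j) := by
  -- The columns are the slices of `M` along coordinate `j`. The entry `r.1 j` is overwritten, so
  -- slices are repeated, which does not change their span.
  let C : Matrix (p j) ((∀ j, p j) × Y) ℂ := fun h r => M (Function.update r.1 j h) r.2
  have hC : ∀ T : Matrix (p j) (p j) ℂ, ∀ h r,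
      (T * C) h r = (onFactor j T * M) (Function.update r.1 j h) r.2 := by
    intro T h r
    rw [onFactor_mul_apply]
    simp only [Function.update_self, Function.update_idem]
    rfl
  obtain ⟨Q, h1, h2, h3, D, h4⟩ := exists_range_projection C
  refine ⟨⟨Q, h1, h2, ?_, fun T hT => ?_⟩⟩
  · ext u q
    have := hC Q (u j) (u, q)
    rw [h3] at this
    simpa [C] using this.symm
  · have : T * C = 0 := by
      ext h r
      rw [hC, hT]
      rfl
    rw [h4, ← Matrix.mul_assoc, this, Matrix.zero_mul]

theorem Support.eq_mul (Q : ∀ j, Support M j) : tensor (fun j => (Q j).proj) * M = M := by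
  have := NetworkSelfTest.tensor_mul_eq (M := M) (fun j => (Q j).proj) (fun _ => 1)
    (fun j => by rw [(Q j).mul_eq, Matrix.mul_one]) (fun _ => 1) rfl fun _ _ _ => by simp
  rwa [Matrix.mul_one] at this

/-- Operators of a party that act on `M` in the same way agree on the support. -/
theorem Support.mul_congr {j : Fin N} (Q : Support M j) {S T : Matrix (p j) (p j) ℂ}
    (h : onFactor j S * M = onFactor j T * M) : S * Q.proj = T * Q.proj := by
  rw [← sub_eq_zero, ← Matrix.sub_mul]
  refine Q.mul_eq_zero _ ?_
  rw [onFactor_sub, Matrix.sub_mul, h, sub_self]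

end Sites

/-! ### Sums of squares -/

section SumOfSquares

variable {X Y : Type*} [Fintype X] [DecidableEq X] [Fintype Y] [DecidableEq Y]

theorem trace_conjTranspose_mul_self_nonneg (C : Matrix X Y ℂ) : 0 ≤ (Cᴴ * C).trace :=
  (posSemidef_conjTranspose_mul_self C).trace_nonneg

/-- The square root of two as a complex number. -/
noncomputable def rt : ℂ := ((Real.sqrt 2 : ℝ) : ℂ)

theorem rt_mul_self : rt * rt = 2 := by
  rw [rt, ← Complex.ofReal_mul, Real.mul_self_sqrt (by norm_num)]
  norm_num

theorem star_rt : star rt = rt := Complex.conj_ofReal _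

/-- The CHSH expression of observables that act on `M` from the left and from the right. -/
noncomputable def chshValue (M : Matrix X Y ℂ) (A A' : Matrix X X ℂ) (b b' : Matrix Y Y ℂ) : ℂ :=
  (Mᴴ * (A * M * b)).trace + (Mᴴ * (A * M * b')).trace + (Mᴴ * (A' * M * b)).trace -
    (Mᴴ * (A' * M * b')).trace

theorem chsh_sum_of_squares {M : Matrix X Y ℂ} (hM : (Mᴴ * M).trace = 1) {A A' : Matrix X X ℂ}
    {b b' : Matrix Y Y ℂ} (hA : Aᴴ = A) (hA' : A'ᴴ = A') (hb : bᴴ = b) (hb' : b'ᴴ = b')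
    (hAA : A * A = 1) (hAA' : A' * A' = 1) (hbb : b * b = 1) (hbb' : b' * b' = 1) :
    ((rt • (A * M) - M * (b + b'))ᴴ * (rt • (A * M) - M * (b + b'))).trace +
      ((rt • (A' * M) - M * (b - b'))ᴴ * (rt • (A' * M) - M * (b - b'))).trace =
      8 - 2 * rt * chshValue M A A' b b' := by
  have e1 : ∀ A : Matrix X X ℂ, Aᴴ = A → A * A = 1 → ∀ d : Matrix Y Y ℂ, dᴴ = d →
      ((rt • (A * M) - M * d)ᴴ * (rt • (A * M) - M * d)).trace =
        2 - 2 * rt * (Mᴴ * (A * M * d)).trace + (Mᴴ * M * (d * d)).trace := by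
    intro A hA hAA d hd
    have h1 : (rt • (A * M) - M * d)ᴴ * (rt • (A * M) - M * d) =
        (rt * rt) • (Mᴴ * M) - rt • (Mᴴ * (A * M * d)) - rt • (d * (Mᴴ * (A * M))) +
          d * (Mᴴ * M * d) := by
      have h2 : Mᴴ * A * (A * M) = Mᴴ * M := by
        rw [Matrix.mul_assoc, ← Matrix.mul_assoc A, hAA, Matrix.one_mul]
      simp only [conjTranspose_sub, conjTranspose_smul, conjTranspose_mul, star_rt, hA, hd,
        Matrix.sub_mul, Matrix.mul_sub, Matrix.smul_mul, Matrix.mul_smul, h2]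
      simp only [Matrix.mul_assoc]
      module
    rw [h1, trace_add, trace_sub, trace_sub, trace_smul, trace_smul, trace_smul, rt_mul_self, hM,
      trace_mul_comm d, trace_mul_comm d]
    simp only [Matrix.mul_assoc, smul_eq_mul]
    ring
  have h2 : (Mᴴ * M * ((b + b') * (b + b'))).trace + (Mᴴ * M * ((b - b') * (b - b'))).trace =
      4 := by
    have : (b + b') * (b + b') + (b - b') * (b - b') = (4 : ℂ) • 1 := by
      simp only [Matrix.add_mul, Matrix.mul_add, Matrix.sub_mul, Matrix.mul_sub, hbb, hbb']
      module
    rw [← trace_add, ← Matrix.mul_add, this, Matrix.mul_smul, trace_smul, Matrix.mul_one, hM]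
    simp
  rw [e1 A hA hAA _ (by rw [conjTranspose_add, hb, hb']),
    e1 A' hA' hAA' _ (by rw [conjTranspose_sub, hb, hb'])]
  have h3 : chshValue M A A' b b' =
      (Mᴴ * (A * M * (b + b'))).trace + (Mᴴ * (A' * M * (b - b'))).trace := by
    simp only [chshValue, Matrix.mul_add, Matrix.mul_sub, trace_add, trace_sub]
    ring
  rw [h3]
  linear_combination h2

/-- If an operator that acts unitarily on `M` is perfectly correlated with a projective measurement
whose outcomes are equally likely, then the outcomes determine its value. -/
theorem mul_eq_smul_of_correlated {M : Matrix X Y ℂ} (hM : (Mᴴ * M).trace = 1) {o : Type*}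
    [Fintype o] [Nonempty o] {P : o → Matrix Y Y ℂ} (hP : IsPVM P) {O : Matrix X X ℂ}
    {t : Matrix Y Y ℂ} (hO : O * M = M * t) (hOO : Oᴴ * (O * M) = M) {e : o → ℂ}
    (he : ∀ c, star (e c) = e c) (hee : ∀ c, e c * e c = 1)
    (h : ∀ c, (Mᴴ * (M * t * P c)).trace = 1 / Fintype.card o * e c) (c : o) :
    M * t * P c = e c • (M * P c) := by
  -- With `p c` the probability of `c`, the squared norm of the error is `2 * (p c - 1 / card)`.
  -- These numbers are nonnegative and sum to zero because the `p c` sum to one, so all vanish;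
  -- uniformity of the outcomes is a consequence.
  have h1 : ∀ c, ((M * t * P c - e c • (M * P c))ᴴ * (M * t * P c - e c • (M * P c))).trace =
      2 * (Mᴴ * M * P c).trace - 2 * (1 / Fintype.card o) := by
    intro c
    have hp : (P c)ᴴ = P c := hP.hermitian c
    have h2 : (P c * (Mᴴ * O * M) * P c).trace = 1 / Fintype.card o * e c := by
      rw [trace_mul_comm, ← Matrix.mul_assoc, hP.idem, trace_mul_comm, ← h]
      simp only [Matrix.mul_assoc, ← hO]
    have h3 : (P c * (Mᴴ * Oᴴ * M) * P c).trace = 1 / Fintype.card o * e c := by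
      have := congrArg star h2
      rw [← trace_conjTranspose] at this
      simpa [Matrix.mul_assoc, hp, he c] using this
    have h4 : (P c * (Mᴴ * M) * P c).trace = (Mᴴ * M * P c).trace := by
      rw [trace_mul_comm, ← Matrix.mul_assoc, hP.idem, trace_mul_comm]
    have h5 : (M * t * P c - e c • (M * P c))ᴴ * (M * t * P c - e c • (M * P c)) =
        P c * (Mᴴ * M) * P c - e c • (P c * (Mᴴ * Oᴴ * M) * P c) -
          e c • (P c * (Mᴴ * O * M) * P c) + (e c * e c) • (P c * (Mᴴ * M) * P c) := by
      have h6 : Mᴴ * (Oᴴ * (O * (M * P c))) = Mᴴ * (M * P c) := by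
        rw [← Matrix.mul_assoc O, ← Matrix.mul_assoc Oᴴ, hOO]
      rw [← hO]
      simp only [conjTranspose_sub, conjTranspose_smul, conjTranspose_mul, he, hp,
        Matrix.sub_mul, Matrix.mul_sub, Matrix.smul_mul, Matrix.mul_smul,
        Matrix.mul_assoc, h6]
      module
    rw [h5, trace_add, trace_sub, trace_sub, trace_smul, trace_smul, trace_smul, h2, h3, h4, hee]
    simp only [smul_eq_mul]
    linear_combination (-2 / (Fintype.card o : ℂ)) * hee c
  have h2 : ∑ c, ((M * t * P c - e c • (M * P c))ᴴ *
      (M * t * P c - e c • (M * P c))).trace = 0 := by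
    simp only [h1, Finset.sum_sub_distrib, ← Finset.mul_sum, ← trace_sum, hP.sum_eq_one,
      Matrix.mul_one, hM]
    have : (Fintype.card o : ℂ) ≠ 0 := by simp
    simp [this]
  have h3 := (Finset.sum_eq_zero_iff_of_nonneg
    fun c _ => trace_conjTranspose_mul_self_nonneg _).mp h2 c (Finset.mem_univ c)
  exact sub_eq_zero.mp (trace_conjTranspose_mul_self_eq_zero_iff.mp h3)

end SumOfSquares

theorem mul_self_eq_neg_one_of_anticomm {A : Type*} [Ring A] {z x w : A} (q0 : z * z = 1)
    (q1 : x * x = 1) (q2 : w * w = 1) (h01 : z * x = -(x * z)) (h02 : z * w = -(w * z))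
    (h12 : x * w = -(w * x)) : z * x * w * (z * x * w) = -1 := by
  have e2 : w * z = -(z * w) := by rw [h02, neg_neg]
  have e4 : x * z = -(z * x) := by rw [h01, neg_neg]
  have e5 : w * x = -(x * w) := by rw [h12, neg_neg]
  calc z * x * w * (z * x * w) = z * x * (w * z) * (x * w) := by noncomm_ring
    _ = -(z * (x * z) * (w * x) * w) := by rw [e2]; noncomm_ring
    _ = -((z * z) * (x * x) * (w * w)) := by rw [e4, e5]; noncomm_ring
    _ = -1 := by rw [q0, q1, q2]; simp

/-- Moving primed letters past unprimed ones turns `h` into `g * g' = -1` for the two triple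
products; multiplication by `g'` with `g' * g' = -1` gives `g = g'`. -/
theorem eq_of_mul_eq_neg_one {A : Type*} [Ring A] {z x w z' x' w' : A} (h1 : x * z' = z' * x)
    (h2 : w * z' = z' * w) (h3 : w * x' = x' * w) (h : z * z' * (x * x') * (w * w') = -1)
    (hg : z' * x' * w' * (z' * x' * w') = -1) : z * x * w = z' * x' * w' := by
  have h4 : z * x * w * (z' * x' * w') = -1 := by
    rw [← h]
    calc _ = z * (x * (w * z')) * x' * w' := by noncomm_ring
      _ = z * (x * z') * (w * x') * w' := by rw [h2]; noncomm_ring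
      _ = _ := by rw [h1, h3]; noncomm_ring
  have h5 : z * x * w * (z' * x' * w' * (z' * x' * w')) = -(z' * x' * w') := by
    rw [← mul_assoc, h4, neg_one_mul]
  rw [hg] at h5
  simpa using h5

theorem IsPVM.marginal {o o' ι : Type*} [Fintype o] [Fintype o'] [DecidableEq o'] [Fintype ι]
    [DecidableEq ι] {P : o → Matrix ι ι ℂ} (hP : IsPVM P) (f : o → o') :
    IsPVM fun c => ∑ b with f b = c, P b := by
  have h1 : ∀ c, ∑ b with f b = c, P b = hP.calc fun b => if f b = c then 1 else 0 := fun c => by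
    rw [hP.calc_apply, Finset.sum_filter]
    simp
  have h2 : ∀ c c', (fun b => if f b = c then 1 else 0 : o → ℂ) *
      (fun b => if f b = c' then 1 else 0) = fun b => if f b = c ∧ f b = c' then 1 else 0 := by
    intro c c'
    funext b
    simp only [Pi.mul_apply, ite_and, ite_mul, one_mul, zero_mul]
  simp only [h1]
  refine ⟨fun c => ?_, fun c => ?_, fun c c' hc => ?_, ?_⟩
  · rw [IsHermitian, hP.calc_star]
    congr 1
    funext b
    simp only [Pi.star_apply, apply_ite star, star_one, star_zero]
  · rw [← map_mul, h2]
    simp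
  · rw [← map_mul, h2, ← map_zero hP.calc]
    congr 1
    funext b
    rw [if_neg fun h => hc (h.1.symm.trans h.2)]
    rfl
  · rw [← map_sum, ← map_one hP.calc]
    congr 1
    funext b
    simp [Finset.sum_apply]

theorem IsState.exists_ne_zero {ι : Type*} [Fintype ι] {v : ι → ℂ} (hv : IsState v) :
    ∃ i, v i ≠ 0 := by
  by_contra hcon
  push Not at hcon
  rw [IsState, show v = 0 from funext hcon] at hv
  simp at hv

/-! ### The observables of an experiment with maximal CHSH violations -/

namespace Experiment

variable {N k : ℕ} {α τ β : Fin N → Type*}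
  [∀ j, Fintype (α j)] [∀ j, DecidableEq (α j)]
  [∀ j, Fintype (τ j)] [∀ j, DecidableEq (τ j)]
  [∀ j, Fintype (β j)] [∀ j, DecidableEq (β j)]
  (R : Experiment N k α τ β)

/-- The state of an experiment as a matrix between the auxiliary and the main parties. -/
def mat : Matrix (∀ j, α j × τ j) (∀ j, β j) ℂ := toMat R.state

/-- The observable of the bit of a main party for one of its sites. -/
noncomputable def localA (s : Site N k) (x : Site N k → Fin 6) :
    Matrix (α s.1 × τ s.1) (α s.1 × τ s.1) ℂ :=
  (R.main_isPVM s.1 fun i => x (s.1, i)).calc fun a => sgn (a s.2)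

theorem localA_conjTranspose (s : Site N k) (x : Site N k → Fin 6) :
    (R.localA s x)ᴴ = R.localA s x := by
  rw [localA, IsPVM.calc_star]
  congr 1
  funext a
  exact star_sgn _

theorem obsA_eq (s : Site N k) (x : Site N k → Fin 6) :
    R.obsA s x = onFactor (p := fun j => α j × τ j) s.1 (R.localA s x) := rfl

theorem obsA_conjTranspose (s : Site N k) (x : Site N k → Fin 6) :
    (R.obsA s x)ᴴ = R.obsA s x := by
  rw [obsA_eq, onFactor_conjTranspose, localA_conjTranspose]

theorem obsA_mul_self (s : Site N k) (x : Site N k → Fin 6) :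
    R.obsA s x * R.obsA s x = 1 := by
  rw [obsA_eq, onFactor_mul, localA, ← map_mul]
  have : ((fun a => sgn (a s.2)) * fun a => sgn (a s.2) : Reg k → ℂ) = 1 :=
    funext fun a => sgn_mul_self _
  rw [this, map_one, onFactor_one]

/-- The measurements of the auxiliary party in their action on the state matrix. -/
theorem auxT_isPVM (y : Site N k → Fin 3) : IsPVM fun b => (R.aux y b)ᵀ :=
  (R.aux_isPVM y).transpose

/-- The observable of the auxiliary party for a site in its action on the state matrix. -/
noncomputable def obsT (s : Site N k) (y : Site N k → Fin 3) : Matrix (∀ j, β j) (∀ j, β j) ℂ :=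
  (R.auxT_isPVM y).calc fun b => sgn (b s)

theorem obsB_transpose (s : Site N k) (y : Site N k → Fin 3) : (R.obsB s y)ᵀ = R.obsT s y := by
  simp [obsB, obsT, IsPVM.calc_apply, transpose_sum]

theorem obsT_conjTranspose (s : Site N k) (y : Site N k → Fin 3) :
    (R.obsT s y)ᴴ = R.obsT s y := by
  rw [obsT, IsPVM.calc_star]
  congr 1
  funext a
  exact star_sgn _

theorem obsT_mul_self (s : Site N k) (y : Site N k → Fin 3) : R.obsT s y * R.obsT s y = 1 := by
  rw [obsT, ← map_mul]
  have : ((fun a => sgn (a s)) * fun a => sgn (a s) : (Site N k → Fin 2) → ℂ) = 1 :=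
    funext fun a => sgn_mul_self _
  rw [this, map_one]

theorem corr_eq (s : Site N k) (x : Site N k → Fin 6) (y : Site N k → Fin 3) :
    R.corr s x y = (R.matᴴ * (R.obsA s x * R.mat * R.obsT s y)).trace := by
  rw [corr, expect_kronecker, obsB_transpose]
  rfl

theorem trace_mat : (R.matᴴ * R.mat).trace = 1 := by
  have hs : ∀ j, ∑ a, ∑ b, star (R.source j (a, b)) * R.source j (a, b) = 1 := by
    intro j
    have := R.source_isState j
    rw [IsState, dotProduct, Fintype.sum_prod_type] at this
    exact this
  have ht : ∑ u, star (R.shared u) * R.shared u = 1 := R.shared_isState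
  rw [mat, ← star_dotProduct_eq_trace, dotProduct, Fintype.sum_prod_type]
  have h1 : ∀ (a : ∀ j, α j) (u : ∀ j, τ j), ∑ b : ∀ j, β j,
      star R.state ((Equiv.arrowProdEquivProdArrow _ α τ).symm (a, u), b) *
        R.state ((Equiv.arrowProdEquivProdArrow _ α τ).symm (a, u), b) =
      (∏ j, ∑ b, star (R.source j (a j, b)) * R.source j (a j, b)) *
        (star (R.shared u) * R.shared u) := by
    intro a u
    rw [Finset.prod_univ_sum, Fintype.piFinset_univ, Finset.sum_mul]
    refine Finset.sum_congr rfl fun b _ => ?_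
    simp only [Pi.star_apply, state, Equiv.arrowProdEquivProdArrow, Equiv.coe_fn_symm_mk, star_mul',
      star_prod, Finset.prod_mul_distrib]
    ring
  rw [← Equiv.sum_comp (Equiv.arrowProdEquivProdArrow _ α τ).symm, Fintype.sum_prod_type]
  simp only [h1, ← Finset.mul_sum, ht, mul_one]
  have h2 := Finset.prod_univ_sum (fun j => (Finset.univ : Finset (α j)))
    fun j a => ∑ b, star (R.source j (a, b)) * R.source j (a, b)
  rw [Fintype.piFinset_univ] at h2
  rw [← h2]
  simp only [hs, Finset.prod_const_one]

/-- The sums of squares of the three CHSH expressions add up to `24 - 2√2 · 6√2 = 0`. So each of the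
six squares vanishes, whatever the inputs at the other sites. -/
theorem chsh_relations (h : R.MaximalCHSH) (s : Site N k) (x : Fin 6 → Site N k → Fin 6)
    (y : Fin 3 → Site N k → Fin 3) (hx : ∀ m, x m s = m) (hy : ∀ m, y m s = m) :
    (rt • (R.obsA s (x 0) * R.mat) = R.mat * (R.obsT s (y 0) + R.obsT s (y 1)) ∧
      rt • (R.obsA s (x 1) * R.mat) = R.mat * (R.obsT s (y 0) - R.obsT s (y 1))) ∧
    (rt • (R.obsA s (x 2) * R.mat) = R.mat * (R.obsT s (y 0) + R.obsT s (y 2)) ∧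
      rt • (R.obsA s (x 3) * R.mat) = R.mat * (R.obsT s (y 0) - R.obsT s (y 2))) ∧
    (rt • (R.obsA s (x 4) * R.mat) = R.mat * (R.obsT s (y 1) + R.obsT s (y 2)) ∧
      rt • (R.obsA s (x 5) * R.mat) = R.mat * (R.obsT s (y 1) - R.obsT s (y 2))) := by
  have e : ∀ x x' y y', _ := fun x x' y y' =>
    chsh_sum_of_squares R.trace_mat (R.obsA_conjTranspose s x) (R.obsA_conjTranspose s x')
      (R.obsT_conjTranspose s y) (R.obsT_conjTranspose s y') (R.obsA_mul_self s x)
      (R.obsA_mul_self s x') (R.obsT_mul_self s y) (R.obsT_mul_self s y')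
  have e1 := e (x 0) (x 1) (y 0) (y 1)
  have e2 := e (x 2) (x 3) (y 0) (y 2)
  have e3 := e (x 4) (x 5) (y 1) (y 2)
  have h1 := h s x y hx hy
  have h2 : ((6 * Real.sqrt 2 : ℝ) : ℂ) = 6 * rt := by simp [rt]
  simp only [CHSH, corr_eq, h2] at h1
  simp only [chshValue] at e1 e2 e3
  have nn := fun C : Matrix (∀ j, α j × τ j) (∀ j, β j) ℂ =>
    trace_conjTranspose_mul_self_nonneg C
  have key : ∀ a b c d e f : ℂ, 0 ≤ a → 0 ≤ b → 0 ≤ c → 0 ≤ d → 0 ≤ e → 0 ≤ f →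
      (a + b) + (c + d) + (e + f) = 0 → (a = 0 ∧ b = 0) ∧ (c = 0 ∧ d = 0) ∧ (e = 0 ∧ f = 0) := by
    intro a b c d e f ha hb hc hd he hf hsum
    rw [add_eq_zero_iff_of_nonneg (by positivity) (by positivity),
      add_eq_zero_iff_of_nonneg (by positivity) (by positivity),
      add_eq_zero_iff_of_nonneg ha hb, add_eq_zero_iff_of_nonneg hc hd,
      add_eq_zero_iff_of_nonneg he hf] at hsum
    tauto
  have h3 := key _ _ _ _ _ _
    (nn (rt • (R.obsA s (x 0) * R.mat) - R.mat * (R.obsT s (y 0) + R.obsT s (y 1))))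
    (nn (rt • (R.obsA s (x 1) * R.mat) - R.mat * (R.obsT s (y 0) - R.obsT s (y 1))))
    (nn (rt • (R.obsA s (x 2) * R.mat) - R.mat * (R.obsT s (y 0) + R.obsT s (y 2))))
    (nn (rt • (R.obsA s (x 3) * R.mat) - R.mat * (R.obsT s (y 0) - R.obsT s (y 2))))
    (nn (rt • (R.obsA s (x 4) * R.mat) - R.mat * (R.obsT s (y 1) + R.obsT s (y 2))))
    (nn (rt • (R.obsA s (x 5) * R.mat) - R.mat * (R.obsT s (y 1) - R.obsT s (y 2)))) (by
      rw [e1, e2, e3]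
      linear_combination (-2 * rt) * h1 - 12 * rt_mul_self)
  simpa only [trace_conjTranspose_mul_self_eq_zero_iff, sub_eq_zero] using h3

/-- Local operators of the main parties that act on the state as the observables of the auxiliary
party. -/
noncomputable def mirrorObs (s : Site N k) : Fin 3 → Matrix (α s.1 × τ s.1) (α s.1 × τ s.1) ℂ :=
  ![(rt / 2) • (R.localA s (fun _ => 0) + R.localA s fun _ => 1),
    (rt / 2) • (R.localA s (fun _ => 0) - R.localA s fun _ => 1),
    (rt / 2) • (R.localA s (fun _ => 2) - R.localA s fun _ => 3)]

theorem mirrorObs_conjTranspose (s : Site N k) (m : Fin 3) :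
    (R.mirrorObs s m)ᴴ = R.mirrorObs s m := by
  fin_cases m <;> simp [mirrorObs, localA_conjTranspose, star_rt, -RCLike.star_def]

/-- Adding and subtracting the two relations of a CHSH pair solves for the observables of the
auxiliary party. The mirror uses fixed constant inputs of the main party; hence the action of
`R.obsT s y` on the state depends on `y` only through `y s`. -/
theorem mirrorObs_mul (h : R.MaximalCHSH) (s : Site N k) (y : Site N k → Fin 3) :
    onFactor (p := fun j => α j × τ j) s.1 (R.mirrorObs s (y s)) * R.mat =
      R.mat * R.obsT s y := by
  -- The three inputs of the auxiliary party are constant, except that the one with entry `y s` at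
  -- the site is `y` itself.
  have h1 := R.chsh_relations h s (fun m _ => m) (Function.update (fun m _ => m) (y s) y)
    (fun _ => rfl) (fun m => by
      by_cases hm : m = y s
      · subst hm; simp
      · simp [hm])
  have h2 : R.obsT s y = R.obsT s (Function.update (fun m _ => m) (y s) y (y s)) := by simp
  rw [h2]
  generalize Function.update (fun (m : Fin 3) (_ : Site N k) => m) (y s) y = y' at h1
  generalize y s = m
  obtain ⟨⟨e0, e1⟩, ⟨e2, e3⟩, -⟩ := h1
  have hr : rt / 2 * rt = 1 := by rw [div_mul_eq_mul_div, rt_mul_self]; norm_num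
  fin_cases m
  all_goals
    simp only [mirrorObs, Fin.zero_eta, Fin.mk_one, Fin.reduceFinMk, Matrix.cons_val,
      onFactor_smul, onFactor_add,
      onFactor_sub, ← obsA_eq, Matrix.smul_mul, Matrix.add_mul, Matrix.sub_mul]
  · have : R.mat * R.obsT s (y' 0) = (1 / 2 : ℂ) • (rt • (R.obsA s (fun _ => 0) * R.mat) +
        rt • (R.obsA s (fun _ => 1) * R.mat)) := by
      rw [e0, e1, Matrix.mul_add, Matrix.mul_sub]; module
    rw [this]; module
  · have : R.mat * R.obsT s (y' 1) = (1 / 2 : ℂ) • (rt • (R.obsA s (fun _ => 0) * R.mat) -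
        rt • (R.obsA s (fun _ => 1) * R.mat)) := by
      rw [e0, e1, Matrix.mul_add, Matrix.mul_sub]; module
    rw [this]; module
  · have : R.mat * R.obsT s (y' 2) = (1 / 2 : ℂ) • (rt • (R.obsA s (fun _ => 2) * R.mat) -
        rt • (R.obsA s (fun _ => 3) * R.mat)) := by
      rw [e2, e3, Matrix.mul_add, Matrix.mul_sub]; module
    rw [this]; module

theorem isMirrored (h : R.MaximalCHSH) : IsMirrored R.mat fun y b => (R.aux y b)ᵀ where
  pvm := R.auxT_isPVM
  sign y s := ⟨R.mirrorObs s (y s), R.mirrorObs_mul h s y, by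
    rw [star_eq_conjTranspose, mirrorObs_conjTranspose]
    exact (R.mirrorObs_mul h s y).trans (by rw [← obsT_conjTranspose]; rfl)⟩

/-- The observable of the auxiliary party for a site in its action on the state. -/
noncomputable def siteObs (h : R.MaximalCHSH) (s : Site N k) (m : Fin 3) :
    MirrorQuot R.mat :=
  (R.isMirrored h).hom (fun _ => m) fun b => sgn (b s)

theorem hom_sign (h : R.MaximalCHSH) (y : Site N k → Fin 3) (s : Site N k) :
    (R.isMirrored h).hom y (fun b => sgn (b s)) = R.siteObs h s (y s) :=
  mirrorMk_eq.mpr ((R.mirrorObs_mul h s y).symm.trans (R.mirrorObs_mul h s fun _ => y s))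

/-- The observable of the auxiliary party for a site as a mirrored operator. -/
noncomputable def siteMirror (h : R.MaximalCHSH) (s : Site N k) (m : Fin 3) : fullMirror R.mat :=
  ⟨R.obsT s fun _ => m, (R.isMirrored h).full _ _⟩

theorem mk_siteMirror (h : R.MaximalCHSH) (s : Site N k) (m : Fin 3) :
    mirrorMk R.mat (R.siteMirror h s m) = R.siteObs h s m := rfl

theorem siteObs_mul_self (h : R.MaximalCHSH) (s : Site N k) (m : Fin 3) :
    R.siteObs h s m * R.siteObs h s m = 1 := by
  rw [← mk_siteMirror, ← map_mul, ← map_one (mirrorMk R.mat), mirrorMk_eq]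
  exact congrArg _ (R.obsT_mul_self s _)

theorem siteObs_comm (h : R.MaximalCHSH) {s t : Site N k} (hst : s ≠ t) (m m' : Fin 3) :
    R.siteObs h s m * R.siteObs h t m' = R.siteObs h t m' * R.siteObs h s m := by
  have h1 := R.hom_sign h (Function.update (fun _ => m') s m) s
  have h2 := R.hom_sign h (Function.update (fun _ => m') s m) t
  rw [Function.update_self] at h1
  rw [Function.update_of_ne hst.symm] at h2
  rw [← h1, ← h2, ← map_mul, mul_comm, map_mul]

/-- The square of an observable of a main party is one, so `(b + b')² = 2` on the state. As `b² =
b'² = 1`, the cross terms cancel. -/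
theorem anticomm_of_relation (s : Site N k) {x : Site N k → Fin 6} {y y' : Site N k → Fin 3}
    (e : rt • (R.obsA s x * R.mat) = R.mat * (R.obsT s y + R.obsT s y')) :
    R.mat * (R.obsT s y * R.obsT s y') = R.mat * -(R.obsT s y' * R.obsT s y) := by
  have h1 : R.mat * ((R.obsT s y + R.obsT s y') * (R.obsT s y + R.obsT s y')) = 
      (2 : ℂ) • R.mat := by
    rw [← Matrix.mul_assoc, ← e, Matrix.smul_mul, Matrix.mul_assoc, ← e, Matrix.mul_smul,
      smul_smul, ← Matrix.mul_assoc, obsA_mul_self, Matrix.one_mul, rt_mul_self]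
  simp only [Matrix.add_mul, Matrix.mul_add, obsT_mul_self, Matrix.mul_one] at h1
  rw [Matrix.mul_neg, eq_neg_iff_add_eq_zero]
  calc _ = (R.mat * (1 + R.obsT s y' * R.obsT s y + (R.obsT s y * R.obsT s y' + 1))) -
        (2 : ℂ) • R.mat := by
        simp only [Matrix.mul_add, Matrix.mul_one]; module
    _ = 0 := by
        rw [← h1, ← sub_eq_zero]
        simp only [Matrix.mul_add, Matrix.mul_one]; abel

theorem siteObs_anticomm (h : R.MaximalCHSH) (s : Site N k) :
    R.siteObs h s 0 * R.siteObs h s 1 = -(R.siteObs h s 1 * R.siteObs h s 0) ∧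
    R.siteObs h s 0 * R.siteObs h s 2 = -(R.siteObs h s 2 * R.siteObs h s 0) ∧
    R.siteObs h s 1 * R.siteObs h s 2 = -(R.siteObs h s 2 * R.siteObs h s 1) := by
  obtain ⟨⟨e0, -⟩, ⟨e2, -⟩, ⟨e4, -⟩⟩ :=
    R.chsh_relations h s (fun m _ => m) (fun m _ => m) (fun _ => rfl) (fun _ => rfl)
  simp only [← mk_siteMirror, ← map_mul, ← map_neg]
  exact ⟨mirrorMk_eq.mpr (R.anticomm_of_relation s e0),
    mirrorMk_eq.mpr (R.anticomm_of_relation s e2), mirrorMk_eq.mpr (R.anticomm_of_relation s e4)⟩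

theorem isAnticommuting (h : R.MaximalCHSH) :
    IsAnticommuting (R.isMirrored h).hom (R.siteObs h) where
  sign := R.hom_sign h
  anticomm s := by rw [(R.siteObs_anticomm h s).1, neg_neg]

/-- The handedness of the observables of a site: it is `± i` if they are Pauli matrices. -/
noncomputable def handedness (h : R.MaximalCHSH) (s : Site N k) : MirrorQuot R.mat :=
  R.siteObs h s 0 * R.siteObs h s 1 * R.siteObs h s 2

theorem handedness_mul_self (h : R.MaximalCHSH) (s : Site N k) :
    R.handedness h s * R.handedness h s = -1 :=
  mul_self_eq_neg_one_of_anticomm (R.siteObs_mul_self h s 0) (R.siteObs_mul_self h s 1)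
    (R.siteObs_mul_self h s 2) (R.siteObs_anticomm h s).1 (R.siteObs_anticomm h s).2.1
    (R.siteObs_anticomm h s).2.2

/-- The handedness of the observables of a site as a mirrored operator. -/
noncomputable def handednessMirror (h : R.MaximalCHSH) (s : Site N k) : fullMirror R.mat :=
  R.siteMirror h s 0 * R.siteMirror h s 1 * R.siteMirror h s 2

theorem mk_handednessMirror (h : R.MaximalCHSH) (s : Site N k) :
    mirrorMk R.mat (R.handednessMirror h s) = R.handedness h s := by
  rw [handednessMirror, map_mul, map_mul, mk_siteMirror, mk_siteMirror, mk_siteMirror, handedness]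

theorem handednessMirror_mul (h : R.MaximalCHSH) (s : Site N k) :
    onFactor (p := fun j => α j × τ j) s.1
      (R.mirrorObs s 0 * R.mirrorObs s 1 * R.mirrorObs s 2) * R.mat =
      R.mat * (R.handednessMirror h s).1 := by
  have e := fun m => R.mirrorObs_mul h s fun _ => m
  have e' : (R.handednessMirror h s).1 =
      R.obsT s (fun _ => 0) * R.obsT s (fun _ => 1) * R.obsT s (fun _ => 2) := rfl
  rw [← onFactor_mul, ← onFactor_mul, Matrix.mul_assoc, e 2, ← Matrix.mul_assoc,
    Matrix.mul_assoc _ _ R.mat, e 1, ← Matrix.mul_assoc, e 0, e', Matrix.mul_assoc,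
    Matrix.mul_assoc, Matrix.mul_assoc]

/-! ### Alignment of the handedness of different sites -/

/-- The observables of the main parties in their action on the state. -/
noncomputable def expandA (s : Site N k) : Fin 6 → Matrix (∀ j, β j) (∀ j, β j) ℂ :=
  let b := fun m : Fin 3 => R.obsT s fun _ => m
  ![(rt / 2) • (b 0 + b 1), (rt / 2) • (b 0 - b 1), (rt / 2) • (b 0 + b 2),
    (rt / 2) • (b 0 - b 2), (rt / 2) • (b 1 + b 2), (rt / 2) • (b 1 - b 2)]

/-- The converse direction of the mirror: observables of the main parties are moved to the auxiliary
party, where correlators of two sites with a projector `P` become traces of products on one side. -/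
theorem obsA_mul_mat (h : R.MaximalCHSH) (s : Site N k) (x : Site N k → Fin 6) :
    R.obsA s x * R.mat = R.mat * R.expandA s (x s) := by
  have h1 := R.chsh_relations h s (Function.update (fun m _ => m) (x s) x) (fun m _ => m)
    (fun m => by
      by_cases hm : m = x s
      · subst hm; simp
      · simp [hm]) (fun _ => rfl)
  have h2 : R.obsA s x = R.obsA s (Function.update (fun m _ => m) (x s) x (x s)) := by simp
  rw [h2]
  generalize Function.update (fun (m : Fin 6) (_ : Site N k) => m) (x s) x = x' at h1
  generalize x s = m
  obtain ⟨⟨e0, e1⟩, ⟨e2, e3⟩, ⟨e4, e5⟩⟩ := h1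
  have hr : rt / 2 * rt = 1 := by rw [div_mul_eq_mul_div, rt_mul_self]; norm_num
  have key : ∀ (A B : Matrix (∀ j, α j × τ j) (∀ j, β j) ℂ), rt • A = B → A = (rt / 2) • B := by
    rintro A _ rfl
    rw [smul_smul, hr, one_smul]
  match m with
  | 0 => exact (key _ _ e0).trans (Matrix.mul_smul _ _ _).symm
  | 1 => exact (key _ _ e1).trans (Matrix.mul_smul _ _ _).symm
  | 2 => exact (key _ _ e2).trans (Matrix.mul_smul _ _ _).symm
  | 3 => exact (key _ _ e3).trans (Matrix.mul_smul _ _ _).symm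
  | 4 => exact (key _ _ e4).trans (Matrix.mul_smul _ _ _).symm
  | 5 => exact (key _ _ e5).trans (Matrix.mul_smul _ _ _).symm

theorem pairCorr_eq (h : R.MaximalCHSH) {s t : Site N k} (hst : s ≠ t) (x : Site N k → Fin 6)
    (p q : Fin 6) (P : Matrix (∀ j, β j) (∀ j, β j) ℂ) :
    R.pairCorr s t x p q P =
      (R.matᴴ * (R.mat * (R.expandA s p * R.expandA t q) * Pᵀ)).trace := by
  rw [pairCorr, expect_kronecker]
  change (R.matᴴ * (R.obsA s _ * R.obsA t _ * R.mat * Pᵀ)).trace = _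
  rw [Matrix.mul_assoc (R.obsA s _), R.obsA_mul_mat h t, ← Matrix.mul_assoc (R.obsA s _),
    R.obsA_mul_mat h s]
  simp only [Function.update_self, Function.update_of_ne hst, Matrix.mul_assoc]

theorem alignCorr_eq (h : R.MaximalCHSH) {s t : Site N k} (hst : s ≠ t) (x : Site N k → Fin 6)
    (p q : Fin 6) (c : ℂ) (P : Matrix (∀ j, β j) (∀ j, β j) ℂ) :
    R.alignCorr s t x p q c P = 1 / 2 * (R.matᴴ * (R.mat * ((R.expandA s p + c • R.expandA s q) *
      (R.expandA t p + c • R.expandA t q)) * Pᵀ)).trace := by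
  simp only [alignCorr, R.pairCorr_eq h hst, Matrix.add_mul, Matrix.mul_add, Matrix.smul_mul,
    Matrix.mul_smul, trace_add, trace_smul, smul_eq_mul]
  ring

theorem expandA_combination (s : Site N k) :
    R.expandA s 0 + (1 : ℂ) • R.expandA s 1 = rt • R.obsT s (fun _ => 0) ∧
    R.expandA s 0 + (-1 : ℂ) • R.expandA s 1 = rt • R.obsT s (fun _ => 1) ∧
    R.expandA s 2 + (-1 : ℂ) • R.expandA s 3 = rt • R.obsT s (fun _ => 2) := by
  simp only [expandA, Matrix.cons_val]
  refine ⟨?_, ?_, ?_⟩ <;> module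

/-- Conditioned on the Bell outcome `c`, the products `σ_z σ_z`, `σ_x σ_x`, `σ_y σ_y` of the two
sites have definite signs, and the product of the three signs is `-1` for every `c`. Summation over
`c` removes the Bell measurement and leaves `g_s * g_t = -1`, that is, `g_s = g_t`. -/
theorem handedness_eq_of_aligned (h : R.MaximalCHSH) {s t : Site N k} (hst : s ≠ t)
    {P : Fin 2 × Fin 2 → Matrix (∀ j, β j) (∀ j, β j) ℂ} (hP : IsPVM P)
    (hA : ∀ c, R.Aligned s t c (P c)) : R.handedness h s = R.handedness h t := by
  let e : Fin 3 → Fin 2 × Fin 2 → ℂ :=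
    ![fun c => sgn c.2, fun c => sgn c.1, fun c => -(sgn c.1 * sgn c.2)]
  have hcorr : ∀ m c, (R.matᴴ * (R.mat * (R.obsT s (fun _ => m) * R.obsT t (fun _ => m)) *
      (P c)ᵀ)).trace = 1 / (Fintype.card (Fin 2 × Fin 2)) * e m c := by
    intro m c
    have h1 := hA c fun _ => 0
    simp only [R.alignCorr_eq h hst, R.expandA_combination, smul_mul_smul_comm, rt_mul_self,
      Matrix.smul_mul, Matrix.mul_smul, trace_smul, smul_eq_mul] at h1
    obtain ⟨h1, h2, h3⟩ := h1
    fin_cases m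
    · simpa [e] using h1
    · simpa [e] using h2
    · simpa [e] using h3
  -- Both sites may belong to one party, whose two mirrors need not commute as operators. So `O m`
  -- is not claimed to be Hermitian or unitary; only its isometric action on the state, `hOO`, is
  -- used.
  let O : Fin 3 → Matrix (∀ j, α j × τ j) (∀ j, α j × τ j) ℂ := fun m =>
    onFactor (p := fun j => α j × τ j) s.1 (R.mirrorObs s m) *
      onFactor (p := fun j => α j × τ j) t.1 (R.mirrorObs t m)
  have hO : ∀ m, O m * R.mat = R.mat * (R.obsT s (fun _ => m) * R.obsT t fun _ => m) := by
    intro m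
    rw [Matrix.mul_assoc, R.mirrorObs_mul h t fun _ => m, ← Matrix.mul_assoc,
      R.mirrorObs_mul h s fun _ => m, Matrix.mul_assoc]
  have hOO : ∀ m, (O m)ᴴ * (O m * R.mat) = R.mat := by
    intro m
    rw [hO, conjTranspose_mul, onFactor_conjTranspose, onFactor_conjTranspose,
      mirrorObs_conjTranspose, mirrorObs_conjTranspose, ← Matrix.mul_assoc,
      Matrix.mul_assoc _ _ R.mat,
      R.mirrorObs_mul h s fun _ => m, ← Matrix.mul_assoc _ R.mat, R.mirrorObs_mul h t fun _ => m]
    rw [Matrix.mul_assoc, Matrix.mul_assoc, ← Matrix.mul_assoc (R.obsT s _), obsT_mul_self,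
      Matrix.one_mul, obsT_mul_self, Matrix.mul_one]
  have hstar : ∀ m c, star (e m c) = e m c := by
    intro m c
    fin_cases m <;> simp [e, star_sgn, -RCLike.star_def]
  have hsq : ∀ m c, e m c * e m c = 1 := by
    intro m c
    have h1 := sgn_mul_self c.1
    have h2 := sgn_mul_self c.2
    fin_cases m
    · exact h2
    · exact h1
    · change -(sgn c.1 * sgn c.2) * -(sgn c.1 * sgn c.2) = 1
      linear_combination sgn c.2 * sgn c.2 * h1 + h2
  have stab := fun m => mul_eq_smul_of_correlated R.trace_mat hP.transpose (hO m) (hOO m)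
    (hstar m) (hsq m) (hcorr m)
  have hprod : ∀ c, R.mat * ((R.obsT s (fun _ => 0) * R.obsT t fun _ => 0) *
      (R.obsT s (fun _ => 1) * R.obsT t fun _ => 1) *
      (R.obsT s (fun _ => 2) * R.obsT t fun _ => 2)) * (P c)ᵀ = -(R.mat * (P c)ᵀ) := by
    intro c
    have h3 : e 2 c * e 1 c * e 0 c = -1 := by
      change -(sgn c.1 * sgn c.2) * sgn c.1 * sgn c.2 = -1
      linear_combination -sgn c.2 * sgn c.2 * sgn_mul_self c.1 - sgn_mul_self c.2
    have stab' : ∀ m, O m * (R.mat * (P c)ᵀ) = e m c • (R.mat * (P c)ᵀ) := fun m => by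
      rw [← Matrix.mul_assoc, hO, stab]
    calc _ = O 0 * (O 1 * (O 2 * (R.mat * (P c)ᵀ))) := by
          rw [← Matrix.mul_assoc (O 2), hO 2, ← Matrix.mul_assoc (O 1), ← Matrix.mul_assoc (O 1),
            hO 1, ← Matrix.mul_assoc (O 0), ← Matrix.mul_assoc (O 0), ← Matrix.mul_assoc (O 0),
            hO 0]
          simp only [Matrix.mul_assoc]
      _ = _ := by
          simp only [stab', Matrix.mul_smul, smul_smul, h3, neg_one_smul]
  have hsum := Finset.sum_congr rfl fun c (_ : c ∈ Finset.univ) => hprod c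
  rw [← Matrix.mul_sum, Finset.sum_neg_distrib, ← Matrix.mul_sum, hP.transpose.sum_eq_one,
    Matrix.mul_one, Matrix.mul_one] at hsum
  have h4 : mirrorMk R.mat (R.siteMirror h s 0 * R.siteMirror h t 0 *
      (R.siteMirror h s 1 * R.siteMirror h t 1) * (R.siteMirror h s 2 * R.siteMirror h t 2)) =
      mirrorMk R.mat (-1) := by
    refine mirrorMk_eq.mpr (hsum.trans ?_)
    change _ = R.mat * (-1)
    rw [Matrix.mul_neg, Matrix.mul_one]
  simp only [map_mul, map_neg, map_one, mk_siteMirror] at h4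
  exact eq_of_mul_eq_neg_one (R.siteObs_comm h hst _ _) (R.siteObs_comm h hst _ _)
    (R.siteObs_comm h hst _ _) h4 (R.handedness_mul_self h t)

theorem siteAt_finProdFinEquiv (s : Site N k) :
    s = siteAt (finProdFinEquiv s : Fin (N * k)) (finProdFinEquiv s : Fin (N * k)).isLt := by
  rw [siteAt, Fin.eta, Equiv.symm_apply_apply]

theorem siteAt_injective {a b : ℕ} (ha : a < N * k) (hb : b < N * k)
    (hab : (siteAt a ha : Site N k) = siteAt b hb) : a = b := by
  exact congrArg Fin.val (finProdFinEquiv.symm.injective hab)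

/-- Neighbouring sites are compared through `white` or `black` according to the parity of their
position. The chain from the first site to the last never uses the pair that wraps around. -/
theorem handedness_eq (h : R.MaximalCHSH) (hB : R.BellAlignment) (s t : Site N k) :
    R.handedness h s = R.handedness h t := by
  have hm : ∀ (Q : (Fin (N * k / 2) → Fin 2 × Fin 2) → Matrix (∀ j, β j) (∀ j, β j) ℂ),
      IsPVM Q → ∀ m, IsPVM (marginal Q m) := fun Q hQ m => hQ.marginal fun b => b m
  have step : ∀ a (ha : a + 1 < N * k), R.handedness h (siteAt a (Nat.lt_of_succ_lt ha)) =
      R.handedness h (siteAt (a + 1) ha) := by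
    intro a ha
    have hne : (siteAt a (Nat.lt_of_succ_lt ha) : Site N k) ≠ siteAt (a + 1) ha := fun heq => by
      have := siteAt_injective _ _ heq
      omega
    obtain ⟨m, hm' | hm'⟩ : ∃ m, a = 2 * m ∨ a = 2 * m + 1 := ⟨a / 2, by omega⟩
    · subst hm'
      exact R.handedness_eq_of_aligned h hne (hm _ R.white_isPVM ⟨m, by omega⟩)
        fun c => (hB ⟨m, by omega⟩ c).1
    · subst hm'
      have hA := fun c => (hB ⟨m, by omega⟩ c).2
      have e : (pairBlack (⟨m, by omega⟩ : Fin (N * k / 2)) : Site N k × Site N k) =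
          (siteAt (2 * m + 1) (Nat.lt_of_succ_lt ha), siteAt (2 * m + 1 + 1) ha) := by
        simp only [pairBlack, Nat.mod_eq_of_lt ha]
      rw [e] at hA
      exact R.handedness_eq_of_aligned h hne (hm _ R.black_isPVM ⟨m, by omega⟩) hA
  have all : ∀ a (ha : a < N * k), R.handedness h (siteAt a ha) =
      R.handedness h (siteAt 0 (Nat.zero_lt_of_lt ha)) := by
    intro a
    induction a with
    | zero => intro ha; rfl
    | succ a ih => intro ha; rw [← step a ha, ih]
  rw [siteAt_finProdFinEquiv s, siteAt_finProdFinEquiv t, all,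
    all (finProdFinEquiv t : Fin (N * k))]

/-! ### Independence of the sources makes the common handedness a number. -/

theorem mat_apply (u : ∀ j, α j × τ j) (b : ∀ j, β j) :
    R.mat u b = (∏ j, R.source j ((u j).1, b j)) * R.shared fun j => (u j).2 := rfl

/-- As the sources are independent, an operation that can be carried out by each of two main
parties and by the auxiliary party acts on the state as a scalar. -/
theorem mul_eq_smul_of_two_parties {j j' : Fin N} (hj : j ≠ j')
    {T : Matrix (α j × τ j) (α j × τ j) ℂ}
    {T' : Matrix (α j' × τ j') (α j' × τ j') ℂ} {t : Matrix (∀ j, β j) (∀ j, β j) ℂ}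
    (h : onFactor (p := fun j => α j × τ j) j T * R.mat = R.mat * t)
    (h' : onFactor (p := fun j => α j × τ j) j' T' * R.mat = R.mat * t) :
    ∃ c : ℂ, R.mat * t = c • R.mat := by
  -- Reference points at which the shared state and all sources have nonzero amplitude; they permit
  -- the divisions below.
  obtain ⟨τ₀, hτ⟩ := R.shared_isState.exists_ne_zero
  have hs := fun i => (R.source_isState i).exists_ne_zero
  choose e he using hs
  let S : (∀ j, α j) → (∀ j, β j) → ∀ i, ℂ := fun a b i => R.source i (a i, b i)
  -- `K` is the effect of `t` on the product of the sources alone; the shared state is a spectator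
  -- because `t` acts on the systems `β` only.
  let K : (∀ j, α j) → (∀ j, β j) → ℂ := fun a b => ∑ b', (∏ i, S a b' i) * t b' b
  have hK : ∀ u b, (R.mat * t) u b = K (fun i => (u i).1) b * R.shared fun i => (u i).2 := by
    intro u b
    simp only [mul_apply, mat_apply, K, Finset.sum_mul, S]
    exact Finset.sum_congr rfl fun _ _ => by ring
  -- Seen from party `j`, the operation changes only the factor of source `j`: up to the amplitude
  -- at `τ₀`, `K` is the product of the other sources with a new function `l` of the pair `(a j, b
  -- j)`.
  have hl : ∀ (j : Fin N) (T : Matrix (α j × τ j) (α j × τ j) ℂ),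
      onFactor (p := fun j => α j × τ j) j T * R.mat = R.mat * t →
      ∃ l : α j → β j → ℂ, ∀ a b, K a b * R.shared τ₀ =
        l (a j) (b j) * ∏ i ∈ Finset.univ.erase j, S a b i := by
    intro j T h
    refine ⟨fun x y => ∑ z : α j × τ j, T (x, τ₀ j) z * (R.source j (z.1, y) *
      R.shared (Function.update τ₀ j z.2)), fun a b => ?_⟩
    have h1 := congrFun (congrFun h fun i => (a i, τ₀ i)) b
    rw [onFactor_mul_apply, hK] at h1
    rw [← h1, Finset.sum_mul]
    refine Finset.sum_congr rfl fun z _ => ?_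
    rw [mat_apply, ← Finset.mul_prod_erase _ _ (Finset.mem_univ j), Function.update_self]
    have h2 : (fun i => (Function.update (fun i => (a i, τ₀ i)) j z i).2) =
        Function.update τ₀ j z.2 := by
      funext i
      by_cases hi : i = j
      · subst hi; simp
      · simp [hi]
    have h3 : ∏ i ∈ Finset.univ.erase j,
        R.source i ((Function.update (fun i => (a i, τ₀ i)) j z i).1, b i) =
        ∏ i ∈ Finset.univ.erase j, S a b i := by
      refine Finset.prod_congr rfl fun i hi => ?_
      rw [Function.update_of_ne (Finset.ne_of_mem_erase hi)]
    rw [h2, h3]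
    ring
  obtain ⟨l, hl1⟩ := hl j T h
  obtain ⟨l', hl2⟩ := hl j' T' h'
  have hj1 : j' ∈ Finset.univ.erase j := Finset.mem_erase.mpr ⟨hj.symm, Finset.mem_univ _⟩
  have hj2 : j ∈ Finset.univ.erase j' := Finset.mem_erase.mpr ⟨hj, Finset.mem_univ _⟩
  let c : ℂ := l' (e j').1 (e j').2 / R.source j' (e j')
  -- Seen from `j'`, source `j` is unchanged. Comparing both descriptions, with all sources other
  -- than `j` frozen at `e`, makes `l` proportional to source `j`.
  have hc : ∀ x y, l x y = c * R.source j (x, y) := by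
    intro x y
    let a := Function.update (fun i => (e i).1) j x
    let b := Function.update (fun i => (e i).2) j y
    have h1 := (hl1 a b).symm.trans (hl2 a b)
    rw [← Finset.mul_prod_erase _ _ hj1, ← Finset.mul_prod_erase _ _ hj2,
      Finset.erase_right_comm] at h1
    have hR : ∏ i ∈ (Finset.univ.erase j').erase j, S a b i ≠ 0 := by
      refine Finset.prod_ne_zero_iff.mpr fun i hi => ?_
      have : i ≠ j := Finset.ne_of_mem_erase hi
      simp only [S, a, b, Function.update_of_ne this]
      exact he i
    have h2 : S a b j' = R.source j' (e j') := by
      simp only [S, a, b, Function.update_of_ne hj.symm]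
    have h3 : S a b j = R.source j (x, y) := by
      simp only [S, a, b, Function.update_self]
    have h4 : a j' = (e j').1 := Function.update_of_ne hj.symm _ _
    have h5 : b j' = (e j').2 := Function.update_of_ne hj.symm _ _
    have h6 : a j = x := Function.update_self _ _ _
    have h7 : b j = y := Function.update_self _ _ _
    rw [h2, h3, h4, h5, h6, h7, ← mul_assoc, ← mul_assoc] at h1
    have h8 := mul_right_cancel₀ hR h1
    have := he j'
    simp only [c]
    field_simp
    linear_combination h8
  refine ⟨c / R.shared τ₀, ?_⟩
  ext u b
  rw [hK, Matrix.smul_apply, smul_eq_mul, mat_apply]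
  have h1 := hl1 (fun i => (u i).1) b
  rw [hc, mul_assoc, Finset.mul_prod_erase _ (S (fun i => (u i).1) b) (Finset.mem_univ j)] at h1
  rw [eq_div_of_mul_eq hτ h1]
  ring

/-- With at least two main parties, the handedness of the observables is a common number. -/
theorem exists_phase (h : R.MaximalCHSH) (hB : R.BellAlignment) (hN : N ≠ 1) :
    ∃ c : ℂ, IsPauliCalculus (R.isMirrored h).hom (R.siteObs h) c := by
  have key : ∃ c : ℂ, (c = Complex.I ∨ c = -Complex.I) ∧
      ∀ s, R.handedness h s = algebraMap ℂ _ c := by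
    by_cases hsite : IsEmpty (Site N k)
    · exact ⟨Complex.I, Or.inl rfl, fun s => hsite.elim s⟩
    rw [not_isEmpty_iff] at hsite
    obtain ⟨⟨j, i⟩⟩ := hsite
    have : ∃ j', j' ≠ j := by
      have : Nontrivial (Fin N) := Fin.nontrivial_iff_two_le.mpr (by have := j.isLt; omega)
      exact exists_ne j
    obtain ⟨j', hj⟩ := this
    have hst : R.mat * (R.handednessMirror h (j, i)).1 =
        R.mat * (R.handednessMirror h (j', i)).1 := by
      refine mirrorMk_eq.mp ?_
      simpa only [mk_handednessMirror] using R.handedness_eq h hB (j, i) (j', i)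
    obtain ⟨c, hc⟩ := R.mul_eq_smul_of_two_parties hj.symm (R.handednessMirror_mul h (j, i))
      ((R.handednessMirror_mul h (j', i)).trans hst.symm)
    have hg : R.handedness h (j, i) = algebraMap ℂ _ c := by
      have : mirrorMk R.mat (R.handednessMirror h (j, i)) = mirrorMk R.mat (algebraMap ℂ _ c) := by
        exact mirrorMk_eq.mpr (hc.trans (mul_coe_algebraMap _ _).symm)
      rwa [AlgHom.commutes, mk_handednessMirror] at this
    refine ⟨c, ?_, fun s => (R.handedness_eq h hB s (j, i)).trans hg⟩
    have h1 : mirrorMk R.mat (algebraMap ℂ _ (c * c)) = mirrorMk R.mat (algebraMap ℂ _ (-1)) := by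
      rw [AlgHom.commutes, AlgHom.commutes, map_mul, map_neg, map_one, ← hg, handedness_mul_self]
    -- The equation `c² = -1` is evaluated on the state, whose norm is one; a vanishing quotient
    -- algebra is thereby excluded.
    have h2 := mirrorMk_eq.mp h1
    rw [mul_coe_algebraMap, mul_coe_algebraMap] at h2
    have h3 := congrArg (fun C => (R.matᴴ * C).trace) h2
    simp only [Matrix.mul_smul, trace_smul, R.trace_mat, smul_eq_mul, mul_one] at h3
    have h4 : (c - Complex.I) * (c + Complex.I) = 0 := by
      linear_combination h3 - Complex.I_mul_I
    rcases mul_eq_zero.mp h4 with h5 | h5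
    · exact Or.inl (sub_eq_zero.mp h5)
    · exact Or.inr (eq_neg_of_add_eq_zero_left h5)
  obtain ⟨c, hc, hs⟩ := key
  refine ⟨c, R.isAnticommuting h, hc, fun s => ?_⟩
  · calc R.siteObs h s 2 = R.siteObs h s 1 * (R.siteObs h s 0 * R.siteObs h s 0) *
        R.siteObs h s 1 * R.siteObs h s 2 := by
          rw [siteObs_mul_self, mul_one, siteObs_mul_self, one_mul]
      _ = R.siteObs h s 1 * R.siteObs h s 0 * R.handedness h s := by
          simp only [handedness, mul_assoc]
      _ = _ := by
          rw [hs, Algebra.algebraMap_eq_smul_one, mul_smul_comm, mul_one]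

end Experiment

/-! ### Isometries that add two registers -/

section Stack

variable {P I : Type*} [Fintype P] [DecidableEq P] [Fintype I] [DecidableEq I] [Zero I]

/-- The operator `v ↦ ∑ u, (B u v) ⊗ |u⟩ ⊗ |0⟩`. -/
def stack (B : I → Matrix P P ℂ) : Matrix (P × I × I) P ℂ :=
  fun r h => if r.2.2 = 0 then B r.2.1 r.1 h else 0

theorem stack_mul (B : I → Matrix P P ℂ) (T : Matrix P P ℂ) :
    stack B * T = stack fun u => B u * T := by
  ext r h
  by_cases hr : r.2.2 = 0 <;> simp [stack, mul_apply, hr]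

theorem stack_conjTranspose_mul (B : I → Matrix P P ℂ) :
    (stack B)ᴴ * stack B = ∑ u, (B u)ᴴ * B u := by
  ext h h'
  simp only [mul_apply, conjTranspose_apply, stack, Fintype.sum_prod_type, Matrix.sum_apply]
  rw [Finset.sum_comm]
  refine Finset.sum_congr rfl fun u _ => Finset.sum_congr rfl fun x _ => ?_
  simp [apply_ite star]

theorem tensor_stack_mul_apply {J : Type*} [Fintype J] [DecidableEq J] {p : J → Type*}
    [∀ j, Fintype (p j)] {Y : Type*} [Fintype Y] (B : ∀ j, I → Matrix (p j) (p j) ℂ)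
    (M : Matrix (∀ j, p j) Y ℂ) (r : ∀ j, p j × I × I) (q : Y) :
    (tensor (fun j => stack (B j)) * M) r q =
      if ∀ j, (r j).2.2 = 0 then (tensor (fun j => B j (r j).2.1) * M) (fun j => (r j).1) q
      else 0 := by
  have h : ∀ v, tensor (fun j => stack (B j)) r v =
      if ∀ j, (r j).2.2 = 0 then tensor (fun j => B j (r j).2.1) (fun j => (r j).1) v else 0 := by
    intro v
    simp only [tensor, stack, Finset.prod_ite_zero, Finset.mem_univ, true_imp_iff]
  simp only [mul_apply, h]
  split_ifs <;> simp

/-- The isometry that acts as `B` on the range of `Q` and adds empty registers on its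
complement. -/
noncomputable def completeStack (B : I → Matrix P P ℂ) (Q : Matrix P P ℂ) :
    Matrix (P × I × I) P ℂ :=
  stack fun u => B u * Q + if u = 0 then 1 - Q else 0

/-- The complement of `Q` is sent to label `0`, where it could overlap with `B 0 * Q`. The
hypothesis `h0`, that `B 0` maps the range of `Q` into itself, makes the two parts orthogonal. -/
theorem completeStack_isometry {B : I → Matrix P P ℂ} {Q : Matrix P P ℂ} (hQ : Qᴴ = Q)
    (hQQ : Q * Q = Q) (h0 : Q * (B 0 * Q) = B 0 * Q) (hB : (∑ u, (B u)ᴴ * B u) * Q = Q) :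
    (completeStack B Q)ᴴ * completeStack B Q = 1 := by
  have h1 : (1 - Q) * (B 0 * Q) = 0 := by rw [Matrix.sub_mul, Matrix.one_mul, h0, sub_self]
  have h2 : (B 0 * Q)ᴴ * (1 - Q) = 0 := by
    have := congrArg conjTranspose h1
    rwa [conjTranspose_mul, conjTranspose_sub, hQ, conjTranspose_one, conjTranspose_zero] at this
  have h3 : (1 - Q) * (1 - Q) = 1 - Q := by
    rw [Matrix.sub_mul, Matrix.mul_sub, Matrix.mul_sub, hQQ]
    simp
  have h4 : ∀ u : I, (B u * Q + if u = 0 then 1 - Q else 0)ᴴ *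
      (B u * Q + if u = 0 then 1 - Q else 0) =
      Q * ((B u)ᴴ * B u * Q) + if u = 0 then 1 - Q else 0 := by
    intro u
    split_ifs with hu
    · subst hu
      rw [conjTranspose_add, conjTranspose_sub, hQ, conjTranspose_one, Matrix.add_mul,
        Matrix.mul_add, Matrix.mul_add, h1, h2, h3, conjTranspose_mul, hQ, add_zero, zero_add]
      simp only [Matrix.mul_assoc]
    · rw [add_zero, add_zero, conjTranspose_mul, hQ]
      simp only [Matrix.mul_assoc]
  rw [completeStack, stack_conjTranspose_mul]
  simp only [h4, Finset.sum_add_distrib, ← Finset.mul_sum, ← Finset.sum_mul, hB, hQQ]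
  simp

theorem completeStack_mul {B : I → Matrix P P ℂ} {Q : Matrix P P ℂ} (hQQ : Q * Q = Q) :
    completeStack B Q * Q = stack B * Q := by
  rw [completeStack, stack_mul, stack_mul]
  congr 1
  funext u
  rw [Matrix.add_mul, Matrix.mul_assoc, hQQ]
  split_ifs <;> simp [Matrix.sub_mul, hQQ]

end Stack

/-! ### Extraction of maximally entangled states -/

section Extraction

variable {N k : ℕ} {p : Fin N → Type*} [∀ j, Fintype (p j)] [∀ j, DecidableEq (p j)]
  {Y : Type*} [Fintype Y] [DecidableEq Y] {M : Matrix (∀ j, p j) Y ℂ}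
  {n : (Site N k → Fin 3) → (Site N k → Fin 2) → Matrix Y Y ℂ} {H : IsMirrored M n}

/-- The isometry of a main party. -/
noncomputable def isoA (T : ∀ j, LocalMirror M H j) (Q : ∀ j, Support M j) (j : Fin N) :
    Matrix (p j × Reg k × Reg k) (p j) ℂ :=
  completeStack (fun u => (T j).flip u * (T j).basis u) (Q j).proj

/-- Both conditions of `completeStack_isometry` concern local operators on the support, where
`Support.mul_congr` reduces them to the action on `M`. There flips are isometric and the squares of
the basis operators sum to one. -/
theorem isoA_isometry (T : ∀ j, LocalMirror M H j) (Q : ∀ j, Support M j) (j : Fin N) :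
    (isoA T Q j)ᴴ * isoA T Q j = 1 := by
  refine completeStack_isometry (Q j).star_eq (Q j).mul_self ?_ ?_
  · rw [← Matrix.mul_assoc]
    refine (Q j).mul_congr ?_
    rw [← onFactor_mul, ← onFactor_mul, Matrix.mul_assoc, Matrix.mul_assoc, (T j).basis_mul,
      ← Matrix.mul_assoc (onFactor j ((T j).flip 0)), (T j).flip_mul, ← Matrix.mul_assoc,
      ← Matrix.mul_assoc, (Q j).mul_eq]
  · rw [show (Q j).proj = 1 * (Q j).proj from (Matrix.one_mul _).symm, ← Matrix.mul_assoc,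
      Matrix.mul_one]
    refine (Q j).mul_congr ?_
    rw [onFactor_sum, Matrix.sum_mul, onFactor_one, Matrix.one_mul]
    refine Eq.trans (Finset.sum_congr rfl fun u _ => ?_) (LocalMirror.sum_basis_star_mul_basis T j)
    rw [conjTranspose_mul]
    simp only [← onFactor_mul, Matrix.mul_assoc]
    congr 1
    rw [(T j).basis_mul, ← Matrix.mul_assoc (onFactor j ((T j).flip u)), ← Matrix.mul_assoc,
      LocalMirror.flip_star_mul_flip]

theorem tensor_isoA_mul (T : ∀ j, LocalMirror M H j) (Q : ∀ j, Support M j) :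
    tensor (isoA T Q) * M =
      tensor (fun j => stack fun u => (T j).flip u * (T j).basis u) * M := by
  have h : (fun j => isoA T Q j * (Q j).proj) =
      fun j => (stack fun u => (T j).flip u * (T j).basis u) * (Q j).proj :=
    funext fun j => completeStack_mul (Q j).mul_self
  have h1 := congrArg (fun S => tensor S * M) h
  simp only [← tensor_mul, Matrix.mul_assoc, Support.eq_mul] at h1
  exact h1

theorem tensor_isoA_mul_apply (T : ∀ j, LocalMirror M H j) (Q : ∀ j, Support M j)
    (r : ∀ j, p j × Reg k × Reg k) (q : Y) :
    (tensor (isoA T Q) * M) r q = if ∀ j, (r j).2.2 = 0 then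
      (M * ((H.flip (flat fun j => (r j).2.1)).1 * (H.basis (flat fun j => (r j).2.1)).1))
        (fun j => (r j).1) q else 0 := by
  rw [tensor_isoA_mul, tensor_stack_mul_apply, ← tensor_mul, Matrix.mul_assoc,
    LocalMirror.tensor_basis_mul T fun j => (r j).2.1, ← Matrix.mul_assoc,
    LocalMirror.tensor_flip_mul T fun j => (r j).2.1, Matrix.mul_assoc]
  by_cases hr : ∀ j, (r j).2.2 = 0
  · rw [if_pos hr, if_pos hr]
  · rw [if_neg hr, if_neg hr]

theorem tensor_isoA_mul_mul_apply (T : ∀ j, LocalMirror M H j) (Q : ∀ j, Support M j)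
    (S : Matrix Y Y ℂ) (r : ∀ j, p j × Reg k × Reg k) (q : Y) :
    (tensor (isoA T Q) * M * S) r q = if ∀ j, (r j).2.2 = 0 then
      (M * ((H.flip (flat fun j => (r j).2.1)).1 * (H.basis (flat fun j => (r j).2.1)).1 * S))
        (fun j => (r j).1) q else 0 := by
  rw [mul_apply]
  simp only [tensor_isoA_mul_apply]
  split_ifs
  · exact congrFun (congrFun (Matrix.mul_assoc M (_ * _) S) _) q
  · simp

/-- The isometry of the auxiliary party. -/
noncomputable def isoB (H : IsMirrored M n) : Matrix (Y × (Fin N → Reg k) × (Fin N → Reg k)) Y ℂ :=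
  stack fun w => ((H.basis (flat w)).1 * (H.flip (flat w)).1)ᵀ

/-- In contrast to the mirrors of the main parties, the flips and basis projectors of the auxiliary
party are exact unitaries and projectors of its measurements; no restriction to a support is needed.
-/
theorem isoB_isometry (H : IsMirrored M n) : (isoB H)ᴴ * isoB H = 1 := by
  rw [isoB, stack_conjTranspose_mul]
  have h1 : ∀ w, (((H.basis (flat w)).1 * (H.flip (flat w)).1)ᵀ)ᴴ *
      ((H.basis (flat w)).1 * (H.flip (flat w)).1)ᵀ = (n (fun _ => 0) (flat w))ᵀ := by
    intro w
    have h2 : ∀ B : Matrix Y Y ℂ, (Bᵀ)ᴴ = (Bᴴ)ᵀ := fun B => rfl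
    have hb : (H.basis (flat w)).1ᴴ = (H.basis (flat w)).1 := by
      rw [H.basis_eq]; exact (H.pvm _).hermitian _
    rw [h2, ← transpose_mul, conjTranspose_mul, H.flip_conjTranspose, hb, Matrix.mul_assoc,
      ← Matrix.mul_assoc (H.flip (flat w)).1, H.flip_mul_self, Matrix.one_mul, H.basis_eq,
      (H.pvm _).idem]
  simp only [h1]
  rw [← transpose_sum, Equiv.sum_comp flat (n fun _ => 0), (H.pvm _).sum_eq_one, transpose_one]

theorem mul_isoB_transpose_apply (H : IsMirrored M n) {R : Type*} (S : Matrix R Y ℂ) (r : R)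
    (q : Y × (Fin N → Reg k) × (Fin N → Reg k)) :
    (S * (isoB H)ᵀ) r q = if q.2.2 = 0 then
      (S * ((H.basis (flat q.2.1)).1 * (H.flip (flat q.2.1)).1)) r q.1 else 0 := by
  by_cases hq : q.2.2 = 0
  · rw [if_pos hq, mul_apply, mul_apply]
    simp only [transpose_apply, isoB, stack, if_pos hq]
  · rw [if_neg hq, mul_apply]
    simp only [transpose_apply, isoB, stack, if_neg hq, mul_zero, Finset.sum_const_zero]

theorem prod_maxEntangled (u w : Fin N → Reg k) :
    ∏ j, maxEntangled k (u j, w j) = if u = w then (1 / rt) ^ (N * k) else 0 := by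
  have h1 : ∀ a b, phiPlus a b = if a = b then 1 / rt else 0 := by
    intro a b
    simp [phiPlus, rt]
  simp only [maxEntangled, h1, Finset.prod_ite_zero, Finset.prod_const, Finset.card_univ,
    Fintype.card_fin]
  have h2 : (∀ j ∈ Finset.univ, ∀ i ∈ Finset.univ, u j i = w j i) ↔ u = w := by
    simp only [Finset.mem_univ, true_imp_iff, funext_iff]
  by_cases h : u = w
  · rw [if_pos h, if_pos (h2.mpr h), mul_comm, pow_mul]
  · rw [if_neg h, if_neg fun h' => h (h2.mp h')]

theorem rt_ne_zero : rt ≠ 0 := fun h => by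
  have := rt_mul_self
  rw [h] at this
  norm_num at this

/-- The isometries of the parties extract maximally entangled states. -/
theorem iso_mul_mul_iso (T : ∀ j, LocalMirror M H j) (Q : ∀ j, Support M j)
    {β : Site N k → Fin 3 → MirrorQuot M} (hH : IsAnticommuting H.hom β)
    (r : ∀ j, p j × Reg k × Reg k) (q : Y × (Fin N → Reg k) × (Fin N → Reg k)) :
    (tensor (isoA T Q) * M * (isoB H)ᵀ) r q =
      (if (∀ j, (r j).2.2 = 0) ∧ q.2.2 = 0 then rt ^ (N * k) * (M * (H.basis 0).1)
        (fun j => (r j).1) q.1 else 0) * ∏ j, maxEntangled k ((r j).2.1, q.2.1 j) := by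
  rw [mul_isoB_transpose_apply, tensor_isoA_mul_mul_apply, prod_maxEntangled]
  -- In matrix units, the main parties contribute `|0⟩⟨a|` and the auxiliary party `|b⟩⟨0|`. Their
  -- product is diagonal in the labels and otherwise independent of them, which is the maximally
  -- entangled state up to the factor `rt ^ (N * k)`.
  have h1 : ∀ a b : Site N k → Fin 2,
      M * ((H.flip a).1 * (H.basis a).1 * ((H.basis b).1 * (H.flip b).1)) =
        if a = b then M * (H.basis 0).1 else 0 := by
    intro a b
    have h2 : mirrorMk M (H.flip a * H.basis a * (H.basis b * H.flip b)) =
        if a = b then mirrorMk M (H.basis 0) else mirrorMk M 0 := by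
      simp only [map_mul, H.mk_flip, H.mk_basis, hH.flipOp_mul_basisProj_self,
        hH.basisProj_mul_flipOp_self, hH.matUnit_mul, hH.matUnit_self, map_zero]
    split_ifs at h2 ⊢ with hab
    · exact mirrorMk_eq.mp h2
    · exact (mirrorMk_eq.mp h2).trans (Matrix.mul_zero _)
  rw [h1]
  have h3 : rt ^ (N * k) * (1 / rt) ^ (N * k) = 1 := by
    rw [← mul_pow, mul_one_div_cancel rt_ne_zero, one_pow]
  by_cases hq : q.2.2 = 0
  · by_cases hr : ∀ j, (r j).2.2 = 0
    · by_cases huw : (fun j => (r j).2.1) = q.2.1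
      · rw [if_pos hq, if_pos hr, if_pos (congrArg flat huw), if_pos ⟨hr, hq⟩, if_pos huw]
        linear_combination -(M * (H.basis 0).1) (fun j => (r j).1) q.1 * h3
      · rw [if_pos hq, if_pos hr, if_neg fun h => huw (flat.injective h), if_neg huw, mul_zero]
        rfl
    · rw [if_pos hq, if_neg hr, if_neg fun h => hr h.1, zero_mul]
  · rw [if_neg hq, if_neg fun h => hq h.2, zero_mul]

end Extraction

/-! ### Pauli tomography -/

theorem exists_pauliProj_combination (c d : Fin 2) : ∃ κ : Fin 3 × Fin 2 → ℂ, ∀ w w',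
    ∑ g, κ g * pauliProj g.1 g.2 w w' = if w = c ∧ w' = d then 1 else 0 := by
  have h : ∀ (κ : Fin 3 × Fin 2 → ℂ) w w', ∑ g, κ g * pauliProj g.1 g.2 w w' =
      κ (0, 0) * pauliProj 0 0 w w' + κ (0, 1) * pauliProj 0 1 w w' +
      (κ (1, 0) * pauliProj 1 0 w w' + κ (1, 1) * pauliProj 1 1 w w') +
      (κ (2, 0) * pauliProj 2 0 w w' + κ (2, 1) * pauliProj 2 1 w w') := by
    intro κ w w'
    simp only [Fintype.sum_prod_type, Fin.sum_univ_three, Fin.sum_univ_two]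
  let I := Complex.I
  -- Coefficients of `|0⟩⟨0|` and `|1⟩⟨1|`, which are projectors of `σ_z`, and of the off-diagonal
  -- units `(σ_x ± i σ_y) / 2`, with each Pauli matrix the difference of its two projectors.
  let K : Fin 2 → Fin 2 → Fin 3 → Fin 2 → ℂ :=
    ![![![![1, 0], ![0, 0], ![0, 0]], ![![0, 0], ![1 / 2, -1 / 2], ![I / 2, -I / 2]]],
      ![![![0, 0], ![1 / 2, -1 / 2], ![-I / 2, I / 2]], ![![0, 1], ![0, 0], ![0, 0]]]]
  refine ⟨fun g => K c d g.1 g.2, fun w w' => ?_⟩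
  rw [h]
  have hI : Complex.I * Complex.I = -1 := Complex.I_mul_I
  fin_cases c <;> fin_cases d <;> fin_cases w <;> fin_cases w' <;>
    simp [K, I, pauliProj, pauli, sgn] <;> ring_nf <;> simp <;> norm_num

/-- A matrix is determined by its overlaps with products of Pauli projectors. -/
theorem eq_zero_of_pauliProj {σ : Type*} [Fintype σ] [DecidableEq σ]
    (G : (σ → Fin 2) → (σ → Fin 2) → ℂ)
    (h : ∀ (y : σ → Fin 3) (b : σ → Fin 2),
      ∑ w, ∑ w', (tensor fun s => pauliProj (y s) (b s)) w w' * G w w' = 0)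
    (c d : σ → Fin 2) : G c d = 0 := by
  choose κ hκ using exists_pauliProj_combination
  have h1 : ∀ w w' : σ → Fin 2, (∑ g : σ → Fin 3 × Fin 2, (∏ s, κ (c s) (d s) (g s)) *
      (tensor fun s => pauliProj (g s).1 (g s).2) w w') = if w = c ∧ w' = d then 1 else 0 := by
    intro w w'
    simp only [tensor, ← Finset.prod_mul_distrib]
    have h2 := Finset.prod_univ_sum (fun _ : σ => (Finset.univ : Finset (Fin 3 × Fin 2)))
      fun s g => κ (c s) (d s) g * pauliProj g.1 g.2 (w s) (w' s)
    rw [Fintype.piFinset_univ] at h2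
    rw [← h2]
    simp only [hκ, Finset.prod_ite_zero, Finset.prod_const_one]
    refine if_congr ?_ rfl rfl
    simp only [Finset.mem_univ, true_imp_iff, funext_iff, forall_and]
  calc G c d = ∑ w, ∑ w', (if w = c ∧ w' = d then 1 else 0) * G w w' := by
        simp [ite_and]
    _ = ∑ g : σ → Fin 3 × Fin 2, (∏ s, κ (c s) (d s) (g s)) *
        ∑ w, ∑ w', (tensor fun s => pauliProj (g s).1 (g s).2) w w' * G w w' := by
        simp only [← h1, Finset.sum_mul, Finset.mul_sum, mul_assoc]
        rw [Finset.sum_comm_cycle]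
    _ = 0 := Finset.sum_eq_zero fun g _ => by
        rw [h (fun s => (g s).1) (fun s => (g s).2), mul_zero]

theorem teleU_mul_conjTranspose (a : Fin 2 × Fin 2) : teleU a * (teleU a)ᴴ = 1 := by
  obtain ⟨a, b⟩ := a
  ext i j
  fin_cases a <;> fin_cases b <;> fin_cases i <;> fin_cases j <;>
    simp [teleU, pauli, mul_apply, Fin.sum_univ_two]

theorem star_teleU (a : Fin 2 × Fin 2) (i j : Fin 2) : star (teleU a i j) = teleU a i j := by
  obtain ⟨a, b⟩ := a
  fin_cases a <;> fin_cases b <;> fin_cases i <;> fin_cases j <;>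
    simp [teleU, pauli, mul_apply, Fin.sum_univ_two]

/-- The average of an operator over the teleportation unitaries. -/
theorem sum_teleU_conj (P : Matrix (Fin 2) (Fin 2) ℂ) :
    ∑ a, (teleU a)ᴴ * P * teleU a = (2 * P.trace) • 1 := by
  ext i j
  fin_cases i <;> fin_cases j <;>
    simp [Fintype.sum_prod_type, Fin.sum_univ_two, teleU, pauli, mul_apply, Matrix.add_apply,
      Matrix.trace, vecHead, vecTail] <;> ring_nf

theorem trace_pauliProj (y : Fin 3) (b : Fin 2) : (pauliProj y b).trace = 1 := by
  fin_cases y <;> simp [pauliProj, pauli, Matrix.trace, Fin.sum_univ_two] <;> ring_nf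

/-! ### The teleportation unitaries of all parties. -/

section Tele

variable {N k : ℕ}

/-- The teleportation unitary of all parties. -/
noncomputable def teleAll (a : Fin N → Fin k → Fin 2 × Fin 2) :
    Matrix (Fin N → Reg k) (Fin N → Reg k) ℂ :=
  tensor fun j => tensor fun i => teleU (a j i)

theorem teleAll_mul_conjTranspose (a : Fin N → Fin k → Fin 2 × Fin 2) :
    teleAll a * (teleAll a)ᴴ = 1 := by
  simp only [teleAll, tensor_conjTranspose, tensor_mul, teleU_mul_conjTranspose, tensor_one]

theorem teleAll_conjTranspose_mul (a : Fin N → Fin k → Fin 2 × Fin 2) :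
    (teleAll a)ᴴ * teleAll a = 1 :=
  mul_eq_one_comm.mp (teleAll_mul_conjTranspose a)

theorem star_teleAll_mulVec (a : Fin N → Fin k → Fin 2 × Fin 2) (ψ : (Fin N → Reg k) → ℂ) :
    star (teleAll a *ᵥ ψ) = teleAll a *ᵥ star ψ := by
  funext w
  simp only [Pi.star_apply, mulVec, dotProduct, star_sum, star_mul', teleAll, tensor, star_prod,
    star_teleU]

/-- The product of Pauli projectors for all parties. -/
noncomputable def pauliAll (y : Site N k → Fin 3) (b : Site N k → Fin 2) :
    Matrix (Fin N → Reg k) (Fin N → Reg k) ℂ :=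
  tensor fun j => tensor fun i => pauliProj (y (j, i)) (b (j, i))

theorem pauliAll_apply (y : Site N k → Fin 3) (b : Site N k → Fin 2) (w w' : Fin N → Reg k) :
    pauliAll y b w w' = (tensor fun s => pauliProj (y s) (b s)) (flat w) (flat w') := by
  simp only [pauliAll, tensor, Fintype.prod_prod_type, flat_apply]

theorem expect_tele (a : Fin N → Fin k → Fin 2 × Fin 2) (y : Site N k → Fin 3)
    (b : Site N k → Fin 2) (ψ : (Fin N → Reg k) → ℂ) :
    expect ψ (tensor fun j => tensor fun i =>
      (teleU (a j i))ᴴ * pauliProj (y (j, i)) (b (j, i)) * teleU (a j i)) =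
    ∑ w, ∑ w', pauliAll y b w w' * (star ((teleAll a *ᵥ ψ) w) * (teleAll a *ᵥ ψ) w') := by
  have h : (tensor fun j => tensor fun i =>
      (teleU (a j i))ᴴ * pauliProj (y (j, i)) (b (j, i)) * teleU (a j i)) =
      (teleAll a)ᴴ * pauliAll y b * teleAll a := by
    simp only [teleAll, pauliAll, tensor_conjTranspose, tensor_mul]
  rw [h, expect, ← mulVec_mulVec, ← mulVec_mulVec, dotProduct_mulVec, ← star_mulVec]
  simp only [dotProduct, mulVec, Finset.mul_sum, Pi.star_apply]
  exact Finset.sum_congr rfl fun w _ => Finset.sum_congr rfl fun w' _ =>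
    Finset.sum_congr rfl fun _ _ => mul_left_comm _ _ _

/-- Summed over all teleportation outcomes the Pauli twirl erases the state, so the sum does not
depend on `ψ`. This later fixes the probabilities `p(b|y)`. -/
theorem sum_expect_tele (y : Site N k → Fin 3) (b : Site N k → Fin 2) {ψ : (Fin N → Reg k) → ℂ}
    (hψ : IsState ψ) :
    ∑ a : Fin N → Fin k → Fin 2 × Fin 2, expect ψ (tensor fun j => tensor fun i =>
      (teleU (a j i))ᴴ * pauliProj (y (j, i)) (b (j, i)) * teleU (a j i)) = 2 ^ (N * k) := by
  have h1 : ∑ a : Fin N → Fin k → Fin 2 × Fin 2, (tensor fun j => tensor fun i =>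
      (teleU (a j i))ᴴ * pauliProj (y (j, i)) (b (j, i)) * teleU (a j i)) =
      (2 : ℂ) ^ (N * k) • 1 := by
    rw [← tensor_sum (fun j (a : Fin k → Fin 2 × Fin 2) => tensor fun i =>
      (teleU (a i))ᴴ * pauliProj (y (j, i)) (b (j, i)) * teleU (a i))]
    have h2 : ∀ j : Fin N, (∑ a : Fin k → Fin 2 × Fin 2, tensor fun i =>
        (teleU (a i))ᴴ * pauliProj (y (j, i)) (b (j, i)) * teleU (a i)) = (2 : ℂ) ^ k • 1 := by
      intro j
      rw [← tensor_sum (fun i (a : Fin 2 × Fin 2) =>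
        (teleU a)ᴴ * pauliProj (y (j, i)) (b (j, i)) * teleU a)]
      simp only [sum_teleU_conj, trace_pauliProj, mul_one]
      rw [tensor_smul, tensor_one, Finset.prod_const, Finset.card_univ, Fintype.card_fin]
    simp only [h2]
    rw [tensor_smul, tensor_one, Finset.prod_const, Finset.card_univ, Fintype.card_fin, ← pow_mul,
      mul_comm]
  have h3 := congrArg (expect ψ) h1
  have h4 : ∀ f : (Fin N → Fin k → Fin 2 × Fin 2) → Matrix (Fin N → Reg k) (Fin N → Reg k) ℂ,
      expect ψ (∑ a, f a) = ∑ a, expect ψ (f a) := by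
    intro f
    simp only [expect, Matrix.sum_mulVec, dotProduct_sum]
  rw [h4] at h3
  rw [h3, expect, smul_mulVec, one_mulVec, dotProduct_smul, hψ, smul_eq_mul, mul_one]

end Tele

/-! ### Extraction of the shared state -/

section Extraction

variable {N k : ℕ} {p : Fin N → Type*} [∀ j, Fintype (p j)] [∀ j, DecidableEq (p j)]
  {Y : Type*} [Fintype Y] [DecidableEq Y] {M : Matrix (∀ j, p j) Y ℂ}
  {n : (Site N k → Fin 3) → (Site N k → Fin 2) → Matrix Y Y ℂ} {H : IsMirrored M n}

theorem sum_star_mul_of_unitary {I : Type*} [Fintype I] [DecidableEq I] {U : Matrix I I ℂ}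
    (hU : U * Uᴴ = 1) (x x' : I → ℂ) :
    ∑ z, star (∑ w, star (U w z) * x w) * (∑ w, star (U w z) * x' w) = ∑ w, star (x w) * x' w := by
  have h : star (Uᴴ *ᵥ x) ⬝ᵥ (Uᴴ *ᵥ x') = star x ⬝ᵥ x' := by
    rw [star_mulVec, conjTranspose_conjTranspose, ← dotProduct_mulVec, mulVec_mulVec, hU,
      one_mulVec]
  exact h

/-- Channels on isometrically embedded systems that act through the given operators. -/
theorem exists_channels_of_isometry (Q : ∀ j, Support M j) {m l ι : Fin N → Type*}
    [∀ j, Fintype (m j)] [∀ j, DecidableEq (m j)] [∀ j, Fintype (l j)] [∀ j, DecidableEq (l j)]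
    [∀ j, Fintype (ι j)] {V : ∀ j, Matrix (m j) (p j) ℂ} (hV : ∀ j, (V j)ᴴ * V j = 1)
    (K : ∀ j, ι j → Matrix (l j) (p j) ℂ)
    (hK : ∀ j, (∑ i, (K j i)ᴴ * K j i) * (Q j).proj = (Q j).proj) (o : ∀ j, l j) :
    ∃ Φ : ∀ j, Channel (m j) (l j), ∀ s : Matrix Y Y ℂ,
      Channel.tensorApply Φ ((tensor V * (M * s)) * (tensor V * (M * s))ᴴ) =
        ∑ i : ∀ j, ι j, (tensor (fun j => K j (i j)) * (M * s)) *
          (tensor (fun j => K j (i j)) * (M * s))ᴴ := by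
  have hVP : ∀ j, V j * (Q j).proj * (V j)ᴴ * V j = V j * (Q j).proj := fun j => by
    rw [Matrix.mul_assoc _ (V j)ᴴ, hV, Matrix.mul_one]
  -- The inverse `(V j)ᴴ` undoes the isometry before `K` acts. The resulting family preserves the
  -- trace only on the embedded support, and is then completed to a channel.
  obtain ⟨Φ, hΦ⟩ := exists_channels (fun j i => K j i * (Q j).proj * (V j)ᴴ)
    (fun j => V j * (Q j).proj * (V j)ᴴ)
    (fun j => by
      rw [conjTranspose_mul, conjTranspose_mul, conjTranspose_conjTranspose, (Q j).star_eq,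
        Matrix.mul_assoc])
    (fun j => by
      rw [← Matrix.mul_assoc, ← Matrix.mul_assoc, hVP, Matrix.mul_assoc (V j), (Q j).mul_self])
    (fun j => by
      have : ∀ i, (K j i * (Q j).proj * (V j)ᴴ)ᴴ * (K j i * (Q j).proj * (V j)ᴴ) =
          V j * (Q j).proj * ((K j i)ᴴ * K j i) * ((Q j).proj * (V j)ᴴ) := fun i => by
        simp only [conjTranspose_mul, conjTranspose_conjTranspose, (Q j).star_eq, Matrix.mul_assoc]
      simp only [this]
      rw [← Matrix.sum_mul, ← Matrix.mul_sum, Matrix.mul_assoc (_ * _), ← Matrix.mul_assoc (∑ _, _),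
        hK, ← Matrix.mul_assoc, Matrix.mul_assoc (V j), (Q j).mul_self]) o Y
  refine ⟨Φ, fun s => ?_⟩
  rw [hΦ]
  · refine Finset.sum_congr rfl fun i _ => ?_
    have h1 : tensor (fun j => K j (i j) * (Q j).proj * (V j)ᴴ) * (tensor V * (M * s)) =
        tensor (fun j => K j (i j)) * (M * s) := by
      rw [← Matrix.mul_assoc, tensor_mul]
      simp only [Matrix.mul_assoc _ (V _)ᴴ, hV, Matrix.mul_one]
      rw [← tensor_mul, Matrix.mul_assoc, ← Matrix.mul_assoc _ M, Support.eq_mul]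
    rw [h1]
  · intro j
    have h1 : onFactor j (V j * (Q j).proj * (V j)ᴴ) * tensor V =
        tensor V * onFactor j (Q j).proj := by
      rw [onFactor, onFactor, tensor_mul, tensor_mul]
      congr 1
      funext i
      by_cases hi : i = j
      · subst hi
        simp only [Function.update_self, hVP]
      · simp [Function.update_of_ne hi]
    rw [← Matrix.mul_assoc, h1, Matrix.mul_assoc, ← Matrix.mul_assoc _ M, (Q j).mul_eq]

/-! ### Local teleportation as a family of Kraus operators. -/

section Kraus

variable {P : Type*} [Fintype P] [DecidableEq P]

/-- The teleportation unitary of one party. -/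
noncomputable def teleReg (a : Fin k → Fin 2 × Fin 2) : Matrix (Reg k) (Reg k) ℂ :=
  tensor fun i => teleU (a i)

theorem teleReg_mul_conjTranspose (a : Fin k → Fin 2 × Fin 2) :
    teleReg a * (teleReg a)ᴴ = 1 := by
  simp only [teleReg, tensor_conjTranspose, tensor_mul, teleU_mul_conjTranspose, tensor_one]

/-- Kraus operators of one party: the party measures its qubits and prepares the state `w` of a
new register instead, carries out the teleportation measurement, and corrects a copy of this
register. Only the register `∑ w, |w⟩⟨w| / √2 ^ k` is kept. -/
noncomputable def teleKraus {L : Type*} [DecidableEq L] (o : L)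
    (E : (Fin k → Fin 2 × Fin 2) → Matrix P P ℂ) (X B : Reg k → Matrix P P ℂ)
    (i : (Fin k → Fin 2 × Fin 2) × Reg k × P) : Matrix (L × Reg k) P ℂ :=
  fun x h => if x.1 = o then (1 / rt) ^ k *
    ∑ w, star (teleReg i.1 w x.2) * (E i.1 * (X w * X i.2.1 * B i.2.1)) i.2.2 h else 0

theorem inv_rt_pow_mul_self (m : ℕ) : (1 / rt) ^ m * (1 / rt) ^ m = (1 / 2) ^ m := by
  rw [← mul_pow, one_div_mul_one_div, rt_mul_self]

theorem star_inv_rt_pow (m : ℕ) : star ((1 / rt) ^ m) = (1 / rt) ^ m := by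
  rw [star_pow, star_div₀, star_one, star_rt]

/-- The unitary correction drops out in the sum over the new register, and the teleportation
measurement in the sum over its outcomes. What remains is the norm of preparation and reset. -/
theorem sum_teleKraus {L : Type*} [Fintype L] [DecidableEq L] (o : L)
    {E : (Fin k → Fin 2 × Fin 2) → Matrix P P ℂ} (hE : IsPVM E) (X B : Reg k → Matrix P P ℂ) :
    ∑ i, (teleKraus o E X B i)ᴴ * teleKraus o E X B i =
      (1 / 2 : ℂ) ^ k • ∑ u, ∑ w, (B u)ᴴ * ((X u)ᴴ * ((X w)ᴴ * (X w * (X u * B u)))) := by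
  have h1 : ∀ a u, ∑ r, (teleKraus o E X B (a, u, r))ᴴ * teleKraus o E X B (a, u, r) =
      (1 / 2 : ℂ) ^ k • ∑ w, (E a * (X w * X u * B u))ᴴ * (E a * (X w * X u * B u)) := by
    intro a u
    have h3 : ∀ r h h', ((teleKraus o E X B (a, u, r))ᴴ * teleKraus o E X B (a, u, r)) h h' =
        (1 / 2) ^ k * ∑ w, star ((E a * (X w * X u * B u)) r h) *
          (E a * (X w * X u * B u)) r h' := by
      intro r h h'
      rw [Matrix.mul_apply, Fintype.sum_prod_type, Finset.sum_eq_single o]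
      · simp only [conjTranspose_apply, teleKraus, if_true]
        rw [← sum_star_mul_of_unitary (teleReg_mul_conjTranspose a)
            (fun w => (E a * (X w * X u * B u)) r h) fun w => (E a * (X w * X u * B u)) r h',
          ← inv_rt_pow_mul_self,
          Finset.mul_sum]
        refine Finset.sum_congr rfl fun z _ => ?_
        rw [star_mul', star_inv_rt_pow]
        ring
      · intro l _ hl
        simp [conjTranspose_apply, teleKraus, hl]
      · simp
    ext h h'
    rw [Matrix.sum_apply, Matrix.smul_apply, Matrix.sum_apply, smul_eq_mul]
    simp only [h3, ← Finset.mul_sum]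
    rw [Finset.sum_comm]
    exact congrArg _ (Finset.sum_congr rfl fun w _ => rfl)
  have h2 : ∀ u w, ∑ a, (E a * (X w * X u * B u))ᴴ * (E a * (X w * X u * B u)) =
      (B u)ᴴ * ((X u)ᴴ * ((X w)ᴴ * (X w * (X u * B u)))) := by
    intro u w
    have h3 : ∀ a, (E a * (X w * X u * B u))ᴴ * (E a * (X w * X u * B u)) =
        (X w * X u * B u)ᴴ * E a * (X w * X u * B u) := by
      intro a
      rw [conjTranspose_mul, (hE.hermitian a).eq, Matrix.mul_assoc, ← Matrix.mul_assoc (E a),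
        hE.idem, ← Matrix.mul_assoc]
    simp only [h3]
    rw [← Finset.sum_mul, ← Finset.mul_sum, hE.sum_eq_one, Matrix.mul_one]
    simp only [conjTranspose_mul, Matrix.mul_assoc]
  simp only [Fintype.sum_prod_type, h1]
  rw [Finset.sum_comm]
  simp only [← Finset.smul_sum]
  congr 1
  refine Finset.sum_congr rfl fun u _ => ?_
  rw [Finset.sum_comm]
  exact Finset.sum_congr rfl fun w _ => h2 u w

end Kraus

/-- On the state the flips are isometric, so each of the `2 ^ k` labels `w` of the fresh pair
contributes equally and cancels `(1 / 2) ^ k`. -/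
theorem sum_teleKraus_mul_support (T : ∀ j, LocalMirror M H j) (Q : ∀ j, Support M j) (j : Fin N)
    {L : Type*} [Fintype L] [DecidableEq L] (o : L)
    {E : (Fin k → Fin 2 × Fin 2) → Matrix (p j) (p j) ℂ} (hE : IsPVM E) :
    (∑ i, (teleKraus o E (T j).flip (T j).basis i)ᴴ * teleKraus o E (T j).flip (T j).basis i) *
      (Q j).proj = (Q j).proj := by
  nth_rewrite 2 [← Matrix.one_mul (Q j).proj]
  refine (Q j).mul_congr ?_
  have h1 : ∀ u w, onFactor j (((T j).basis u)ᴴ * (((T j).flip u)ᴴ * (((T j).flip w)ᴴ *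
      ((T j).flip w * ((T j).flip u * (T j).basis u))))) * M =
      onFactor j ((T j).basis u)ᴴ * (onFactor j ((T j).basis u) * M) := by
    intro u w
    have h2 : ∀ (v : Reg k) (s : Matrix Y Y ℂ),
        onFactor j ((T j).flip v)ᴴ * (onFactor j ((T j).flip v) * (M * s)) = M * s := by
      intro v s
      rw [← Matrix.mul_assoc, ← Matrix.mul_assoc, Matrix.mul_assoc _ _ M,
        LocalMirror.flip_star_mul_flip]
    simp only [← onFactor_mul, Matrix.mul_assoc]
    rw [(T j).basis_mul, ← Matrix.mul_assoc (onFactor j ((T j).flip u)) M, (T j).flip_mul,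
      Matrix.mul_assoc M, h2, ← Matrix.mul_assoc M, ← (T j).flip_mul, Matrix.mul_assoc _ M, h2]
  rw [sum_teleKraus o hE, onFactor_smul, onFactor_sum, onFactor_one, Matrix.smul_mul,
    Matrix.one_mul, Matrix.sum_mul]
  simp only [onFactor_sum, Matrix.sum_mul, h1, Finset.sum_const]
  rw [← Finset.smul_sum, LocalMirror.sum_basis_star_mul_basis, ← Nat.cast_smul_eq_nsmul ℂ,
    smul_smul]
  simp

/-- All local flips and basis operators can be replaced by operators on the right of `M`; only the
teleportation projectors, which have no mirror, stay on the left. -/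
theorem tensor_teleKraus_mul_apply (T : ∀ j, LocalMirror M H j)
    {L : Fin N → Type*} [∀ j, Fintype (L j)] [∀ j, DecidableEq (L j)] (o : ∀ j, L j)
    (E : ∀ j, (Fin k → Fin 2 × Fin 2) → Matrix (p j) (p j) ℂ) (s : Matrix Y Y ℂ)
    (i : ∀ j, (Fin k → Fin 2 × Fin 2) × Reg k × p j) (x : ∀ j, L j × Reg k) (q : Y) :
    (tensor (fun j => teleKraus (o j) (E j) (T j).flip (T j).basis (i j)) * (M * s)) x q =
      if (fun j => (x j).1) = o then (1 / rt) ^ (N * k) *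
        ∑ w, star (teleAll (fun j => (i j).1) w fun j => (x j).2) *
          (tensor (fun j => E j (i j).1) * (M * ((H.flip (flat w)).1 *
            (H.flip (flat fun j => (i j).2.1)).1 * (H.basis (flat fun j => (i j).2.1)).1 * s)))
            (fun j => (i j).2.2) q else 0 := by
  have h1 : ∀ w : Fin N → Reg k, tensor (fun j => E j (i j).1) * (M * ((H.flip (flat w)).1 *
      (H.flip (flat fun j => (i j).2.1)).1 * (H.basis (flat fun j => (i j).2.1)).1 * s)) =
      tensor (fun j => E j (i j).1 * ((T j).flip (w j) * (T j).flip (i j).2.1 *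
        (T j).basis (i j).2.1)) * (M * s) := by
    intro w
    simp only [← tensor_mul, Matrix.mul_assoc]
    rw [← Matrix.mul_assoc (tensor fun j => (T j).basis _) M,
      LocalMirror.tensor_basis_mul T fun j => (i j).2.1, Matrix.mul_assoc M,
      ← Matrix.mul_assoc (tensor fun j => (T j).flip (i j).2.1) M,
      LocalMirror.tensor_flip_mul T fun j => (i j).2.1, Matrix.mul_assoc M,
      ← Matrix.mul_assoc (tensor fun j => (T j).flip (w j)) M,
      LocalMirror.tensor_flip_mul T w, Matrix.mul_assoc M]
  have h2 : ∀ h, tensor (fun j => teleKraus (o j) (E j) (T j).flip (T j).basis (i j)) x h =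
      if (fun j => (x j).1) = o then (1 / rt) ^ (N * k) *
        ∑ w, star (teleAll (fun j => (i j).1) w fun j => (x j).2) *
          tensor (fun j => E j (i j).1 * ((T j).flip (w j) * (T j).flip (i j).2.1 *
            (T j).basis (i j).2.1)) (fun j => (i j).2.2) h else 0 := by
    intro h
    simp only [tensor, teleKraus, Finset.prod_ite_zero, Finset.mem_univ, true_imp_iff]
    refine if_congr (by rw [funext_iff]) ?_ rfl
    rw [Finset.prod_mul_distrib, Finset.prod_const, Finset.card_univ, Fintype.card_fin, ← pow_mul,
      mul_comm k]
    congr 1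
    rw [Finset.prod_univ_sum, Fintype.piFinset_univ]
    refine Finset.sum_congr rfl fun w _ => ?_
    rw [Finset.prod_mul_distrib, teleAll, tensor, star_prod]
    rfl
  rw [Matrix.mul_apply]
  simp only [h1, h2]
  split_ifs
  · simp only [Finset.mul_sum, Finset.sum_mul]
    rw [Finset.sum_comm]
    refine Finset.sum_congr rfl fun w _ => ?_
    rw [Matrix.mul_apply, Finset.mul_sum, Finset.mul_sum]
    exact Finset.sum_congr rfl fun h _ => by ring
  · simp

/-- Discarding the qubits of a mirrored state and preparing a matrix unit instead. -/
theorem mul_sum_discard {β : Site N k → Fin 3 → MirrorQuot M} {c : ℂ}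
    (hH : IsPauliCalculus H.hom β c) (y : Site N k → Fin 3) (f : (Site N k → Fin 2) → ℂ)
    (w w' : Fin N → Reg k) :
    M * (∑ u, (H.flip (flat w)).1 * (H.flip (flat u)).1 * (H.basis (flat u)).1 *
      (H.pvm y).calc f * ((H.basis (flat u)).1 * (H.flip (flat u)).1 * (H.flip (flat w')).1)) =
    (∑ b, f b) • (M * ((H.flip (flat w)).1 * (H.basis 0).1 * (H.flip (flat w')).1)) := by
  have h1 : mirrorMk M (∑ u, H.flip (flat w) * H.flip (flat u) * H.basis (flat u) *
      H.lift y f * (H.basis (flat u) * H.flip (flat u) * H.flip (flat w'))) =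
      mirrorMk M ((∑ b, f b) • (H.flip (flat w) * H.basis 0 * H.flip (flat w'))) := by
    simp only [map_sum, map_mul, map_smul, H.mk_flip, H.mk_basis, H.mk_lift]
    exact (Equiv.sum_comp flat fun u => flipOp H.hom (flat w) * flipOp H.hom u *
      basisProj H.hom u * H.hom y f *
      (basisProj H.hom u * flipOp H.hom u * flipOp H.hom (flat w'))).trans
      (hH.sum_discard y _ _ _)
  have h2 := mirrorMk_eq.mp h1
  simp only [AddSubmonoidClass.coe_finsetSum, MulMemClass.coe_mul, SetLike.val_smul,
    H.lift_coe, Matrix.mul_smul] at h2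
  exact h2

/-- The overlaps of the operators that remain if a party discards its qubits and prepares new
ones. -/
theorem sum_trace_discard {β : Site N k → Fin 3 → MirrorQuot M} {c : ℂ}
    (hH : IsPauliCalculus H.hom β c) (y : Site N k → Fin 3) (f : (Site N k → Fin 2) → ℂ)
    {A : Matrix (∀ j, p j) (∀ j, p j) ℂ} (hA : Aᴴ = A) (hAA : A * A = A) (w w' : Fin N → Reg k) :
    ∑ u, ((A * (M * ((H.flip (flat w)).1 * (H.flip (flat u)).1 * (H.basis (flat u)).1 *
        (H.pvm y).calc f))) *
      (A * (M * ((H.flip (flat w')).1 * (H.flip (flat u)).1 * (H.basis (flat u)).1 *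
        (H.pvm y).calc f)))ᴴ).trace =
    (∑ b, f b * star (f b)) *
      (Mᴴ * (A * (M * ((H.flip (flat w)).1 * (H.basis 0).1 * (H.flip (flat w')).1)))).trace := by
  have h4 : ∀ u, (H.basis u).1ᴴ = (H.basis u).1 := fun u => by
    rw [H.basis_eq]; exact (H.pvm _).hermitian _
  have h5 : (H.pvm y).calc f * ((H.pvm y).calc f)ᴴ = (H.pvm y).calc (f * star f) := by
    rw [IsPVM.calc_star, map_mul]
  have h6 : ∀ g g' : Matrix Y Y ℂ, ((A * (M * g)) * (A * (M * g'))ᴴ).trace =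
      (Mᴴ * (A * (M * (g * g'ᴴ)))).trace := by
    intro g g'
    rw [conjTranspose_mul, conjTranspose_mul, hA, Matrix.trace_mul_comm,
      Matrix.mul_assoc (g'ᴴ * Mᴴ), ← Matrix.mul_assoc A, hAA, Matrix.mul_assoc g'ᴴ,
      Matrix.trace_mul_comm g'ᴴ]
    simp only [Matrix.mul_assoc]
  have h7 : ∀ u, (H.flip (flat w)).1 * (H.flip (flat u)).1 * (H.basis (flat u)).1 *
      (H.pvm y).calc f * ((H.flip (flat w')).1 * (H.flip (flat u)).1 * (H.basis (flat u)).1 *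
      (H.pvm y).calc f)ᴴ = (H.flip (flat w)).1 * (H.flip (flat u)).1 * (H.basis (flat u)).1 *
      (H.pvm y).calc (f * star f) *
        ((H.basis (flat u)).1 * (H.flip (flat u)).1 * (H.flip (flat w')).1) := by
    intro u
    rw [conjTranspose_mul, ← Matrix.mul_assoc, Matrix.mul_assoc _ (IsPVM.calc _ f), h5]
    simp only [conjTranspose_mul, h4, H.flip_conjTranspose, Matrix.mul_assoc]
  simp only [h6, h7]
  rw [← trace_sum, ← Matrix.mul_sum, ← Matrix.mul_sum, ← Matrix.mul_sum, mul_sum_discard hH,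
    Matrix.mul_smul, Matrix.mul_smul, Matrix.trace_smul]
  rfl

/-- For each outcome `a`, discarding the qubits leaves the overlaps given in `hφ`, those of the pure
state `teleAll a *ᵥ φ`; the correction turns it back into `φ`. The `4 ^ (N * k)` outcomes have equal
weight. The measurement of the auxiliary party enters only through `∑ b, f b * star (f b)`. -/
theorem exists_extraction_channels (T : ∀ j, LocalMirror M H j) (Q : ∀ j, Support M j)
    {β : Site N k → Fin 3 → MirrorQuot M} {c : ℂ} (hH : IsPauliCalculus H.hom β c)
    {E : ∀ j, (Fin k → Fin 2 × Fin 2) → Matrix (p j) (p j) ℂ} (hE : ∀ j, IsPVM (E j))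
    {m L : Fin N → Type*}
    [∀ j, Fintype (m j)] [∀ j, DecidableEq (m j)] [∀ j, Fintype (L j)] [∀ j, DecidableEq (L j)]
    {V : ∀ j, Matrix (m j) (p j) ℂ} (hV : ∀ j, (V j)ᴴ * V j = 1) (o : ∀ j, L j)
    {φ : (Fin N → Reg k) → ℂ}
    (hφ : ∀ (a : Fin N → Fin k → Fin 2 × Fin 2) (w w' : Fin N → Reg k),
      (Mᴴ * (tensor (fun j => E j (a j)) * (M * ((H.flip (flat w)).1 * (H.basis 0).1 *
        (H.flip (flat w')).1)))).trace =
      1 / 4 ^ (N * k) * ((teleAll a *ᵥ φ) w * star ((teleAll a *ᵥ φ) w'))) :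
    ∃ Φ : ∀ j, Channel (m j) (L j × Reg k), ∀ y f,
      Channel.tensorApply Φ ((tensor V * (M * (H.pvm y).calc f)) *
        (tensor V * (M * (H.pvm y).calc f))ᴴ) = fun x x' =>
          ((1 / 2) ^ (N * k) * ∑ b, f b * star (f b)) *
          (if (fun j => (x j).1) = o ∧ (fun j => (x' j).1) = o then 1 else 0) *
          proj φ (fun j => (x j).2) (fun j => (x' j).2) := by
  obtain ⟨Φ, hΦ⟩ := exists_channels_of_isometry Q hV
    (fun j => teleKraus (o j) (E j) (T j).flip (T j).basis)
    (fun j => sum_teleKraus_mul_support T Q j (o j) (hE j)) fun j => (o j, 0)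
  refine ⟨Φ, fun y f => ?_⟩
  rw [hΦ]
  set s := (H.pvm y).calc f with hs
  -- `G a u w` is the branch in which the old qubits were found in `u`, the fresh pair carries `w`,
  -- and the teleportation outcome is `a`.
  let G : (Fin N → Fin k → Fin 2 × Fin 2) → (Fin N → Reg k) → (Fin N → Reg k) →
      Matrix (∀ j, p j) Y ℂ := fun a u w => tensor (fun j => E j (a j)) *
        (M * ((H.flip (flat w)).1 * (H.flip (flat u)).1 * (H.basis (flat u)).1 * s))
  have hG : ∀ a w w', ∑ u, ∑ r, ∑ q, G a u w r q * star (G a u w' r q) =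
      (∑ b, f b * star (f b)) * (1 / 4 ^ (N * k) *
        ((teleAll a *ᵥ φ) w * star ((teleAll a *ᵥ φ) w'))) := by
    intro a w w'
    have h1 : ∀ A B : Matrix (∀ j, p j) Y ℂ,
        ∑ r, ∑ q, A r q * star (B r q) = (A * Bᴴ).trace := fun A B => rfl
    have h2 : (tensor fun j => E j (a j))ᴴ = tensor fun j => E j (a j) := by
      rw [tensor_conjTranspose]
      exact congrArg tensor (funext fun j => (hE j).hermitian _)
    have h3 : (tensor fun j => E j (a j)) * (tensor fun j => E j (a j)) =
        tensor fun j => E j (a j) := by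
      rw [tensor_mul]
      exact congrArg tensor (funext fun j => (hE j).idem _)
    simp only [h1, G]
    rw [← hφ, hs, sum_trace_discard hH y f h2 h3]
  have hsum : ∀ a (z : Fin N → Reg k), ∑ w, star (teleAll a w z) * (teleAll a *ᵥ φ) w = φ z := by
    intro a z
    have h1 : (teleAll a)ᴴ *ᵥ (teleAll a *ᵥ φ) = φ := by
      rw [mulVec_mulVec, teleAll_conjTranspose_mul, one_mulVec]
    exact congrFun h1 z
  funext x x'
  rw [Matrix.sum_apply]
  simp only [Matrix.mul_apply, conjTranspose_apply]
  simp only [← Matrix.mul_apply, tensor_teleKraus_mul_apply]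
  by_cases hx : (fun j => (x j).1) = o
  swap
  · simp [hx]
  by_cases hx' : (fun j => (x' j).1) = o
  swap
  · simp [hx']
  simp only [hx, hx', if_true, and_self, mul_one]
  let e : (∀ j, (Fin k → Fin 2 × Fin 2) × Reg k × p j) ≃
      (Fin N → Fin k → Fin 2 × Fin 2) × (Fin N → Reg k) × (∀ j, p j) :=
    { toFun := fun i => (fun j => (i j).1, fun j => (i j).2.1, fun j => (i j).2.2)
      invFun := fun i j => (i.1 j, i.2.1 j, i.2.2 j)
      left_inv := fun _ => rfl
      right_inv := fun _ => rfl }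
  let F : (Fin N → Fin k → Fin 2 × Fin 2) × (Fin N → Reg k) × (∀ j, p j) → ℂ := fun i =>
    ∑ q, ((1 / rt) ^ (N * k) * ∑ w, star (teleAll i.1 w fun j => (x j).2) *
      G i.1 i.2.1 w i.2.2 q) * star ((1 / rt) ^ (N * k) *
        ∑ w, star (teleAll i.1 w fun j => (x' j).2) * G i.1 i.2.1 w i.2.2 q)
  have h1 : ∑ i, F (e i) = ∑ a, ∑ u, ∑ r, F (a, u, r) := by
    rw [Equiv.sum_comp e F, Fintype.sum_prod_type]
    simp only [Fintype.sum_prod_type]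
  refine h1.trans ?_
  have h2 : ∀ a, ∑ u, ∑ r, F (a, u, r) = (1 / 2) ^ (N * k) * (1 / 4 ^ (N * k)) *
      (∑ b, f b * star (f b)) * proj φ (fun j => (x j).2) fun j => (x' j).2 := by
    intro a
    calc ∑ u, ∑ r, F (a, u, r)
      _ = ∑ w, ∑ w', ((1 / rt) ^ (N * k) * (1 / rt) ^ (N * k)) *
          (star (teleAll a w fun j => (x j).2) * teleAll a w' fun j => (x' j).2) *
          ∑ u, ∑ r, ∑ q, G a u w r q * star (G a u w' r q) := by
        have h3 : ∀ u r q, ((1 / rt) ^ (N * k) * ∑ w, star (teleAll a w fun j => (x j).2) *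
            G a u w r q) * star ((1 / rt) ^ (N * k) *
              ∑ w, star (teleAll a w fun j => (x' j).2) * G a u w r q) =
            ∑ w, ∑ w', ((1 / rt) ^ (N * k) * (1 / rt) ^ (N * k)) *
          (star (teleAll a w fun j => (x j).2) * teleAll a w' fun j => (x' j).2) *
              (G a u w r q * star (G a u w' r q)) := by
          intro u r q
          rw [star_mul', star_inv_rt_pow, star_sum, mul_mul_mul_comm, Finset.sum_mul_sum,
            Finset.mul_sum]
          refine Finset.sum_congr rfl fun w _ => ?_
          rw [Finset.mul_sum]
          refine Finset.sum_congr rfl fun w' _ => ?_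
          rw [star_mul', star_star]
          ring
        simp only [F, h3]
        simp only [Finset.mul_sum]
        -- The sums over the discarded indices are exchanged with those over `w`, `w'` in one step,
        -- as sums over product types.
        have h4 := Finset.sum_comm (s := (Finset.univ : Finset ((Fin N → Reg k) × (∀ j, p j) × Y)))
          (t := (Finset.univ : Finset ((Fin N → Reg k) × (Fin N → Reg k)))) (f := fun i i' =>
            ((1 / rt) ^ (N * k) * (1 / rt) ^ (N * k)) *
            (star (teleAll a i'.1 fun j => (x j).2) * teleAll a i'.2 fun j => (x' j).2) *
              (G a i.1 i'.1 i.2.1 i.2.2 * star (G a i.1 i'.2 i.2.1 i.2.2)))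
        simpa only [Fintype.sum_prod_type] using h4
      _ = _ := by
        simp only [hG, inv_rt_pow_mul_self]
        rw [proj, vecMulVec_apply, Pi.star_apply, ← hsum a, ← hsum a, star_sum,
          Finset.sum_mul_sum, Finset.mul_sum]
        refine Finset.sum_congr rfl fun w _ => ?_
        rw [Finset.mul_sum]
        refine Finset.sum_congr rfl fun w' _ => ?_
        rw [star_mul', star_star]
        ring
  simp only [h2, Finset.sum_const, Finset.card_univ, nsmul_eq_mul]
  have h3 : ((Fintype.card (Fin N → Fin k → Fin 2 × Fin 2) : ℕ) : ℂ) * (1 / 4 ^ (N * k)) = 1 := by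
    simp only [Fintype.card_fun, Fintype.card_prod, Fintype.card_fin]
    rw [← pow_mul, mul_comm k]
    push_cast
    exact mul_one_div_cancel (by positivity)
  linear_combination (1 / 2) ^ (N * k) * (∑ b, f b * star (f b)) *
    proj φ (fun j => (x j).2) (fun j => (x' j).2) * h3

end Extraction

/-! ### Preparation of a fixed product state -/

section Preparation

variable {N k : ℕ} {p : Fin N → Type*} [∀ j, Fintype (p j)] [∀ j, DecidableEq (p j)]
  {Y : Type*} [Fintype Y] [DecidableEq Y] {M : Matrix (∀ j, p j) Y ℂ}

/-- Kraus operators of one party that prepares the state `v` and discards its system. -/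
def prepareKraus {P L I : Type*} [DecidableEq P] [DecidableEq L] (o : L) (v : I → ℂ) (κ : P) :
    Matrix (L × I) P ℂ :=
  fun x h => if x.1 = o then v x.2 * (if κ = h then 1 else 0) else 0

theorem sum_prepareKraus {P L I : Type*} [Fintype P] [DecidableEq P] [Fintype L] [DecidableEq L]
    [Fintype I] (o : L) {v : I → ℂ} (hv : IsState v) :
    ∑ κ : P, (prepareKraus o v κ)ᴴ * prepareKraus o v κ = 1 := by
  ext h h'
  rw [Matrix.sum_apply]
  simp only [Matrix.mul_apply, conjTranspose_apply, Fintype.sum_prod_type, prepareKraus]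
  have h1 : ∑ z, star (v z) * v z = 1 := hv
  have h2 : ∀ κ, ∑ l : L, ∑ z : I,
      star (if l = o then v z * (if κ = h then 1 else 0) else 0) *
        (if l = o then v z * (if κ = h' then 1 else 0) else 0) =
      (if κ = h then 1 else 0) * (if κ = h' then 1 else 0) * ∑ z, star (v z) * v z := by
    intro κ
    rw [Finset.sum_eq_single o (fun l _ hl => by simp [hl]) (by simp), Finset.mul_sum]
    refine Finset.sum_congr rfl fun z _ => ?_
    rw [if_pos rfl, if_pos rfl]
    split_ifs <;> simp
  simp only [h2, h1, mul_one]
  simp [one_apply, eq_comm]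

theorem exists_preparation_channels (Q : ∀ j, Support M j) {m L : Fin N → Type*}
    [∀ j, Fintype (m j)] [∀ j, DecidableEq (m j)] [∀ j, Fintype (L j)] [∀ j, DecidableEq (L j)]
    {V : ∀ j, Matrix (m j) (p j) ℂ} (hV : ∀ j, (V j)ᴴ * V j = 1) (o : ∀ j, L j)
    {φ : Fin N → Reg k → ℂ} (hφ : ∀ j, IsState (φ j)) :
    ∃ Φ : ∀ j, Channel (m j) (L j × Reg k), ∀ s : Matrix Y Y ℂ,
      Channel.tensorApply Φ ((tensor V * (M * s)) * (tensor V * (M * s))ᴴ) = fun x x' =>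
          (Mᴴ * (M * (s * sᴴ))).trace *
          (if (fun j => (x j).1) = o ∧ (fun j => (x' j).1) = o then 1 else 0) *
          proj (fun z => ∏ j, φ j (z j)) (fun j => (x j).2) (fun j => (x' j).2) := by
  obtain ⟨Φ, hΦ⟩ := exists_channels_of_isometry Q hV (fun j => prepareKraus (o j) (φ j))
    (fun j => by rw [sum_prepareKraus (o j) (hφ j), Matrix.one_mul]) fun j => (o j, 0)
  refine ⟨Φ, fun s => ?_⟩
  rw [hΦ]
  have h1 : ∀ (κ : ∀ j, p j) (x : ∀ j, L j × Reg k) q,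
      (tensor (fun j => prepareKraus (o j) (φ j) (κ j)) * (M * s)) x q =
      if (fun j => (x j).1) = o then (∏ j, φ j (x j).2) * (M * s) κ q else 0 := by
    intro κ x q
    have h2 : ∀ h : ∀ j, p j, (∏ j, if (x j).1 = o j then φ j (x j).2 *
        (if κ j = h j then 1 else 0) else 0) = if (fun j => (x j).1) = o then
          (∏ j, φ j (x j).2) * (if κ = h then 1 else 0) else 0 := by
      intro h
      simp only [Finset.prod_ite_zero, Finset.mem_univ, true_imp_iff, Finset.prod_mul_distrib,
        Finset.prod_const_one]
      refine if_congr (by rw [funext_iff]) ?_ rfl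
      congr 1
      exact if_congr (by rw [funext_iff]) rfl rfl
    rw [Matrix.mul_apply]
    simp only [tensor, prepareKraus, h2]
    split_ifs <;> simp
  funext x x'
  rw [Matrix.sum_apply]
  have h3 : ∀ (A : Matrix (∀ j, L j × Reg k) Y ℂ), (A * Aᴴ) x x' = ∑ q, A x q * star (A x' q) :=
    fun A => rfl
  simp only [h3, h1]
  by_cases hx : (fun j => (x j).1) = o
  swap
  · simp [hx]
  by_cases hx' : (fun j => (x' j).1) = o
  swap
  · simp [hx']
  simp only [hx, hx', if_true, and_self, mul_one]
  have h4 : (Mᴴ * (M * (s * sᴴ))).trace = ∑ κ, ∑ q, (M * s) κ q * star ((M * s) κ q) := by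
    rw [← Matrix.mul_assoc M, Matrix.trace_mul_comm, Matrix.mul_assoc, ← conjTranspose_mul]
    rfl
  rw [h4, Finset.sum_mul]
  refine Finset.sum_congr rfl fun κ _ => ?_
  rw [Finset.sum_mul]
  refine Finset.sum_congr rfl fun q _ => ?_
  rw [proj, vecMulVec_apply, Pi.star_apply, star_mul']
  ring

end Preparation

theorem Channel.tensorApply_smul {J : Type*} [Fintype J] [DecidableEq J] {m n : J → Type*}
    [∀ j, Fintype (m j)] [∀ j, DecidableEq (m j)] [∀ j, Fintype (n j)]
    (Φ : ∀ j, Channel (m j) (n j)) (c : ℂ) (ρ : Matrix (∀ j, m j) (∀ j, m j) ℂ) :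
    Channel.tensorApply Φ (c • ρ) = c • Channel.tensorApply Φ ρ := by
  simp only [Channel.tensorApply, Matrix.mul_smul, Matrix.smul_mul, Finset.smul_sum]

/-! ### Self-testing -/

namespace Experiment

variable {N k : ℕ} {α τ β : Fin N → Type*}
  [∀ j, Fintype (α j)] [∀ j, DecidableEq (α j)]
  [∀ j, Fintype (τ j)] [∀ j, DecidableEq (τ j)]
  [∀ j, Fintype (β j)] [∀ j, DecidableEq (β j)]
  (R : Experiment N k α τ β) {ψ : (Fin N → Reg k) → ℂ}

theorem prob_eq_trace (y : Site N k → Fin 3) (b : Site N k → Fin 2) :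
    R.prob y b = (R.matᴴ * (R.mat * (R.aux y b)ᵀ)).trace := by
  rw [prob, expect_kronecker, Matrix.one_mul]
  rfl

/-- Summing the tomography statistics over all teleportation outcomes gives the marginal of the
auxiliary party, which is uniform by `sum_expect_tele`. -/
theorem prob_eq (hψ : IsState ψ) (hT : R.TeleportationTomography ψ) (y : Site N k → Fin 3)
    (b : Site N k → Fin 2) : R.prob y b = (1 / 2) ^ (N * k) := by
  have h1 : ∑ a : Fin N → Fin k → Fin 2 × Fin 2, tensor (fun j => R.tele j (a j)) = 1 := by
    rw [← tensor_sum fun j a => R.tele j a]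
    simp only [(R.tele_isPVM _).sum_eq_one, tensor_one]
  have h2 : ∑ a : Fin N → Fin k → Fin 2 × Fin 2,
      expect R.state (tensor (fun j => R.tele j (a j)) ⊗ₖ R.aux y b) = R.prob y b := by
    simp only [expect_kronecker, prob, ← h1]
    rw [← trace_sum, ← Matrix.mul_sum, Matrix.sum_mul, Matrix.sum_mul]
  rw [← h2]
  simp only [fun a => hT a y b]
  rw [← Finset.mul_sum, sum_expect_tele y b hψ, one_div, one_div, show (4 : ℂ) = 2 * 2 by norm_num,
    mul_pow, mul_inv, mul_assoc, inv_mul_cancel₀ (by positivity), mul_one, inv_pow]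

/-- The overlaps of the teleportation measurement with mirrored matrix units. -/
theorem trace_tele (h : R.MaximalCHSH) {c : ℂ}
    (hc : IsPauliCalculus (R.isMirrored h).hom (R.siteObs h) c)
    (hT : R.TeleportationTomography ψ) :
    ∃ φ, (φ = ψ ∨ φ = star ψ) ∧ ∀ (a : Fin N → Fin k → Fin 2 × Fin 2) (w w' : Fin N → Reg k),
      (R.matᴴ * (tensor (fun j => R.tele j (a j)) * (R.mat * (((R.isMirrored h).flip (flat w)).1 *
        ((R.isMirrored h).basis 0).1 * ((R.isMirrored h).flip (flat w')).1)))).trace =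
      1 / 4 ^ (N * k) * ((teleAll a *ᵥ φ) w * star ((teleAll a *ᵥ φ) w')) := by
  set H := R.isMirrored h with hH
  let F : (Fin N → Fin k → Fin 2 × Fin 2) → (Site N k → Fin 2) → (Site N k → Fin 2) → ℂ :=
    fun a w w' => (R.matᴴ * (tensor (fun j => R.tele j (a j)) * (R.mat *
      ((H.flip w).1 * (H.basis 0).1 * (H.flip w').1)))).trace
  -- On the state each projector of the auxiliary party is expanded in matrix units with the known
  -- Pauli coefficients. The statistics thus become linear equations for `F`, and tomography solves
  -- them.
  have h1 : ∀ y b, R.mat * (R.aux y b)ᵀ = ∑ w, ∑ w',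
      (tensor fun s => signProj (pauliC c (y s)) (b s)) w w' •
        (R.mat * ((H.flip w).1 * (H.basis 0).1 * (H.flip w').1)) := by
    intro y b
    have h2 : mirrorMk R.mat (H.lift y (Pi.single b 1)) = mirrorMk R.mat (∑ w, ∑ w',
        (tensor fun s => signProj (pauliC c (y s)) (b s)) w w' •
          (H.flip w * H.basis 0 * H.flip w')) := by
      simp only [map_sum, map_mul, map_smul, H.mk_flip, H.mk_basis, H.mk_lift]
      rw [hc.calc_eq_unitRep, IsPVM.calc_single]
      rfl
    have h3 := mirrorMk_eq.mp h2
    rw [H.lift_coe, IsPVM.calc_single] at h3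
    simp only [AddSubmonoidClass.coe_finsetSum, MulMemClass.coe_mul, SetLike.val_smul,
      Matrix.mul_sum, Matrix.mul_smul] at h3
    simpa only [Matrix.mul_assoc] using h3
  have h2 : ∀ a (y : Site N k → Fin 3) (b : Site N k → Fin 2),
      ∑ w, ∑ w', (tensor fun s => signProj (pauliC c (y s)) (b s)) w w' * F a w w' =
      ∑ w, ∑ w', (tensor fun s => pauliProj (y s) (b s)) w w' * (1 / 4 ^ (N * k) *
        (star ((teleAll a *ᵥ ψ) (flat.symm w)) * (teleAll a *ᵥ ψ) (flat.symm w'))) := by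
    intro a y b
    have h3 := hT a y b
    rw [expect_kronecker, expect_tele, Matrix.mul_assoc] at h3
    change (R.matᴴ * (tensor (fun j => R.tele j (a j)) * (R.mat * (R.aux y b)ᵀ))).trace = _ at h3
    rw [h1] at h3
    simp only [Matrix.mul_sum, trace_sum, Matrix.mul_smul, trace_smul, smul_eq_mul] at h3
    refine h3.trans ?_
    rw [← Equiv.sum_comp flat, Finset.mul_sum]
    refine Finset.sum_congr rfl fun w _ => ?_
    rw [← Equiv.sum_comp flat, Finset.mul_sum]
    refine Finset.sum_congr rfl fun w' _ => ?_
    rw [pauliAll_apply, Equiv.symm_apply_apply, Equiv.symm_apply_apply]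
    ring
  rcases hc.phase with rfl | rfl
  -- For `c = i` the operators on the right of `M` are the untransposed Pauli projectors, so
  -- comparison of coefficients produces the conjugated state.
  · refine ⟨star ψ, Or.inr rfl, fun a w w' => ?_⟩
    have h3 := eq_zero_of_pauliProj (fun w w' => F a w w' - 1 / 4 ^ (N * k) *
        (star ((teleAll a *ᵥ ψ) (flat.symm w)) * (teleAll a *ᵥ ψ) (flat.symm w')))
      (fun y b => by
        have := h2 a y b
        simp only [signProj_pauliC_I] at this
        simp only [mul_sub, Finset.sum_sub_distrib, this, sub_self]) (flat w) (flat w')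
    rw [Equiv.symm_apply_apply, Equiv.symm_apply_apply] at h3
    rw [← star_teleAll_mulVec, Pi.star_apply, Pi.star_apply, star_star]
    exact sub_eq_zero.mp h3
  · refine ⟨ψ, Or.inl rfl, fun a w w' => ?_⟩
    -- For `c = -i` the projectors are transposed; exchanging the two labels absorbs the transpose
    -- and leaves `ψ` itself.
    have h3 := eq_zero_of_pauliProj (fun w' w => F a w w' - 1 / 4 ^ (N * k) *
        (star ((teleAll a *ᵥ ψ) (flat.symm w')) * (teleAll a *ᵥ ψ) (flat.symm w)))
      (fun y b => by
        have := h2 a y b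
        simp only [signProj_pauliC_neg_I, ← tensor_transpose, transpose_apply] at this
        rw [Finset.sum_comm] at this
        simp only [mul_sub, Finset.sum_sub_distrib, this]
        exact sub_self _) (flat w') (flat w)
    rw [Equiv.symm_apply_apply, Equiv.symm_apply_apply] at h3
    rw [mul_comm ((teleAll a *ᵥ ψ) w)]
    exact sub_eq_zero.mp h3

/-- The isometries and any channels that act correctly on their output extract the state. -/
theorem extracts_of_channels (h : R.MaximalCHSH)
    (T : ∀ j, LocalMirror R.mat (R.isMirrored h) j) (Q : ∀ j, Support R.mat j)
    (hp : ∀ y b, R.prob y b = (1 / 2) ^ (N * k)) (o : ∀ j, (α j × τ j) × Reg k × Reg k)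
    {φ : (Fin N → Reg k) → ℂ}
    (hΦ : ∃ Φ : ∀ j, Channel ((α j × τ j) × Reg k × Reg k) (((α j × τ j) × Reg k × Reg k) × Reg k),
      ∀ y f, Channel.tensorApply Φ
        ((tensor (isoA T Q) * (R.mat * ((R.isMirrored h).pvm y).calc f)) *
        (tensor (isoA T Q) * (R.mat * ((R.isMirrored h).pvm y).calc f))ᴴ) = fun x x' =>
          ((1 / 2) ^ (N * k) * ∑ b, f b * star (f b)) *
          (if (fun j => (x j).1) = o ∧ (fun j => (x' j).1) = o then 1 else 0) *
          proj φ (fun j => (x j).2) (fun j => (x' j).2)) : R.Extracts φ := by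
  obtain ⟨Φ, hΦ⟩ := hΦ
  have hB := isoB_isometry (R.isMirrored h)
  have hB' : (isoB (R.isMirrored h))ᵀ * ((isoB (R.isMirrored h))ᵀ)ᴴ = 1 := by
    have := congrArg transpose hB
    rw [transpose_mul, transpose_one] at this
    exact this
  let ξ : Matrix (∀ j, (α j × τ j) × Reg k × Reg k) (∀ j, (α j × τ j) × Reg k × Reg k) ℂ :=
    proj (Pi.single o 1)
  have hξ : IsDensity ξ := by
    refine ⟨posSemidef_vecMulVec_self_star _, ?_⟩
    rw [show ξ = vecMulVec (Pi.single o 1) (star (Pi.single o 1)) from rfl, trace_vecMulVec]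
    simp
  have hξ' : ∀ x x', ξ x x' = if x = o ∧ x' = o then 1 else 0 := by
    intro x x'
    simp only [ξ, proj, vecMulVec_apply, Pi.star_apply, Pi.single_apply, apply_ite star, star_one,
      star_zero, mul_ite, mul_one, mul_zero, ite_and]
    split_ifs <;> rfl
  -- An isometry of the auxiliary party disappears under the partial trace over its systems.
  have hred : ∀ S : Matrix (∀ j, β j) (∀ j, β j) ℂ,
      tensor (isoA T Q) * (R.mat * S) * (isoB (R.isMirrored h))ᵀ *
        (tensor (isoA T Q) * (R.mat * S) * (isoB (R.isMirrored h))ᵀ)ᴴ =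
      tensor (isoA T Q) * (R.mat * S) * (tensor (isoA T Q) * (R.mat * S))ᴴ := by
    intro S
    rw [conjTranspose_mul, Matrix.mul_assoc, ← Matrix.mul_assoc (isoB _)ᵀ, hB', Matrix.one_mul]
  refine ⟨isoA T Q, isoB (R.isMirrored h), Φ, isoA_isometry T Q, hB,
    ⟨fun a => if (∀ j, (a.1 j).2 = 0) ∧ a.2.2 = 0 then rt ^ (N * k) *
      (R.mat * ((R.isMirrored h).basis 0).1) (fun j => (a.1 j).1) a.2.1 else 0, ?_⟩,
    ⟨ξ, hξ, ?_⟩, fun y b => ⟨ξ, hξ, ?_⟩⟩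
  · funext r
    have h1 : ((tensor (isoA T Q) ⊗ₖ isoB (R.isMirrored h)) *ᵥ R.state) r =
        toMat ((tensor (isoA T Q) ⊗ₖ isoB (R.isMirrored h)) *ᵥ R.state) r.1 r.2 := rfl
    rw [h1, toMat_kronecker_mulVec]
    exact iso_mul_mul_iso T Q (R.isAnticommuting h) r.1 r.2
  · have h1 := hΦ (fun _ => 0) 1
    -- The reduced state is the case `f = 1`: the `2 ^ (N * k)` bit strings cancel the prefactor.
    -- For a result `b`, the indicator of `b` is used instead, and the prefactor cancels `p(b|y)`.
    have h2 := hred 1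
    rw [Matrix.mul_one] at h2
    rw [map_one, Matrix.mul_one] at h1
    rw [traceSnd_proj, toMat_kronecker_mulVec]
    change Channel.tensorApply Φ (tensor (isoA T Q) * R.mat * (isoB (R.isMirrored h))ᵀ *
        (tensor (isoA T Q) * R.mat * (isoB (R.isMirrored h))ᵀ)ᴴ) = _
    rw [h2, h1]
    funext x x'
    rw [hξ']
    simp only [Pi.one_apply, star_one, mul_one, Finset.sum_const, Finset.card_univ,
      Fintype.card_fun, Fintype.card_prod, Fintype.card_fin, nsmul_eq_mul]
    push_cast
    rw [← mul_pow]
    norm_num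
  · have h1 := hΦ y (Pi.single b 1)
    rw [IsPVM.calc_single] at h1
    rw [Channel.tensorApply_smul, traceSnd_proj, toMat_kronecker_mulVec, postState,
      toMat_kronecker_mulVec, Matrix.one_mul]
    change _ • Channel.tensorApply Φ (tensor (isoA T Q) * (R.mat * (R.aux y b)ᵀ) *
      (isoB (R.isMirrored h))ᵀ * (tensor (isoA T Q) * (R.mat * (R.aux y b)ᵀ) *
        (isoB (R.isMirrored h))ᵀ)ᴴ) = _
    rw [hred, h1, hp]
    have h3 : ∑ b', (Pi.single b 1 : (Site N k → Fin 2) → ℂ) b' *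
        star ((Pi.single b 1 : (Site N k → Fin 2) → ℂ) b') = 1 := by
      rw [Finset.sum_eq_single b (fun b' _ hb => by simp [hb]) (by simp)]
      simp
    have h4 : ((1 / 2 : ℂ) ^ (N * k))⁻¹ * (1 / 2) ^ (N * k) = 1 :=
      inv_mul_cancel₀ (by positivity)
    funext x x'
    change ((1 / 2 : ℂ) ^ (N * k))⁻¹ * (((1 / 2) ^ (N * k) * _) * _ * _) = _
    rw [hξ', h3, mul_one, ← mul_assoc, ← mul_assoc, h4,
      one_mul]

theorem extracts_of_reproduces (hψ : IsState ψ) (hR : R.Reproduces ψ) :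
    R.Extracts ψ ∨ R.Extracts (star ψ) := by
  obtain ⟨h, hB, hT⟩ := hR
  have T : ∀ j, LocalMirror R.mat (R.isMirrored h) j := fun j =>
    ((R.isMirrored h).exists_localMirror j).some
  have Q : ∀ j, Support R.mat j := fun j => (exists_support R.mat j).some
  have ho : ∀ j, Nonempty (α j × τ j) := by
    intro j
    obtain ⟨x, -⟩ := (R.source_isState j).exists_ne_zero
    obtain ⟨u, -⟩ := R.shared_isState.exists_ne_zero
    exact ⟨x.1, u j⟩
  let o : ∀ j, (α j × τ j) × Reg k × Reg k := fun j => ((ho j).some, 0, 0)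
  have hp := R.prob_eq hψ hT
  -- A single main party has no partner with which to compare handedness. But then every `ψ` is a
  -- local state, which a channel can prepare after discarding its input.
  by_cases hN : N = 1
  · left
    subst hN
    let φ : Fin 1 → Reg k → ℂ := fun _ z => ψ fun _ => z
    have hφ : ∀ j, IsState (φ j) := by
      intro j
      rw [IsState, dotProduct, ← Equiv.sum_comp (Equiv.funUnique (Fin 1) (Reg k)).symm] at hψ
      exact hψ
    have hφ' : (fun z : Fin 1 → Reg k => ∏ j, φ j (z j)) = ψ := by
      funext z
      rw [Fin.prod_univ_one]
      exact congrArg ψ (funext fun j => congrArg z (Subsingleton.elim _ _))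
    obtain ⟨Φ, hΦ⟩ := exists_preparation_channels Q (isoA_isometry T Q) o hφ
    refine R.extracts_of_channels h T Q hp o ⟨Φ, fun y f => ?_⟩
    rw [hΦ, hφ']
    have h1 : (R.matᴴ * (R.mat * (((R.isMirrored h).pvm y).calc f *
        (((R.isMirrored h).pvm y).calc f)ᴴ))).trace =
        (1 / 2) ^ (1 * k) * ∑ b, f b * star (f b) := by
      rw [IsPVM.calc_star, ← map_mul, IsPVM.calc_apply]
      simp only [Matrix.mul_sum, trace_sum, Matrix.mul_smul, trace_smul, ← R.prob_eq_trace, hp]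
      rw [← Finset.sum_smul, smul_eq_mul, mul_comm]
      rfl
    rw [h1]
  · obtain ⟨c, hc⟩ := R.exists_phase h hB hN
    obtain ⟨φ, hφ, hL⟩ := R.trace_tele h hc hT
    have hE : R.Extracts φ := R.extracts_of_channels h T Q hp o
      (exists_extraction_channels T Q hc (fun j => R.tele_isPVM j) (isoA_isometry T Q) o hL)
    rcases hφ with rfl | rfl
    · exact Or.inl hE
    · exact Or.inr hE

end Experiment

/-! ### Operators on a part of a composite system -/

section Embed

variable {ι X Y : Type*} [Fintype ι] [DecidableEq ι] [Fintype X] [DecidableEq X] [Fintype Y]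
  [DecidableEq Y]

/-- The operator `T ⊗ 1` on a system that is identified with a composite system. -/
def embed (e : ι ≃ X × Y) (T : Matrix X X ℂ) : Matrix ι ι ℂ := (T ⊗ₖ 1).submatrix e e

theorem embed_apply (e : ι ≃ X × Y) (T : Matrix X X ℂ) (u v : ι) :
    embed e T u v = if (e u).2 = (e v).2 then T (e u).1 (e v).1 else 0 := by
  simp [embed, kroneckerMap_apply, one_apply]

theorem embed_mul (e : ι ≃ X × Y) (S T : Matrix X X ℂ) :
    embed e S * embed e T = embed e (S * T) := by
  rw [embed, embed, submatrix_mul_equiv, ← mul_kronecker_mul, Matrix.one_mul, embed]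

theorem embed_one (e : ι ≃ X × Y) : embed e (1 : Matrix X X ℂ) = 1 := by
  rw [embed, one_kronecker_one, submatrix_one_equiv]

theorem embed_smul (e : ι ≃ X × Y) (c : ℂ) (T : Matrix X X ℂ) :
    embed e (c • T) = c • embed e T := by
  rw [embed, smul_kronecker]
  rfl

theorem embed_sum {o : Type*} (s : Finset o) (e : ι ≃ X × Y) (T : o → Matrix X X ℂ) :
    embed e (∑ a ∈ s, T a) = ∑ a ∈ s, embed e (T a) := by
  ext u v
  simp only [Matrix.sum_apply, embed_apply]
  split_ifs <;> simp

theorem embed_transpose (e : ι ≃ X × Y) (T : Matrix X X ℂ) : (embed e T)ᵀ = embed e Tᵀ := by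
  ext u v
  simp only [transpose_apply, embed_apply, eq_comm]

theorem embed_conjTranspose (e : ι ≃ X × Y) (T : Matrix X X ℂ) : (embed e T)ᴴ = embed e Tᴴ := by
  ext u v
  simp only [conjTranspose_apply, embed_apply, apply_ite star, star_zero, eq_comm]

theorem trace_embed (e : ι ≃ X × Y) (T : Matrix X X ℂ) :
    (embed e T).trace = T.trace * Fintype.card Y := by
  have h : (embed e T).trace = ∑ u, (T ⊗ₖ (1 : Matrix Y Y ℂ)) (e u) (e u) := rfl
  rw [h, Equiv.sum_comp e fun u => (T ⊗ₖ (1 : Matrix Y Y ℂ)) u u]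
  refine (trace_kronecker T (1 : Matrix Y Y ℂ)).trans ?_
  rw [trace_one]

theorem IsPVM.embed {o : Type*} [Fintype o] {P : o → Matrix X X ℂ} (hP : IsPVM P) (e : ι ≃ X × Y) :
    IsPVM fun a => NetworkSelfTest.embed e (P a) where
  hermitian a := by rw [IsHermitian, embed_conjTranspose, (hP.hermitian a).eq]
  idem a := by rw [embed_mul, hP.idem]
  orthogonal a b h := by
    rw [embed_mul, hP.orthogonal a b h]
    ext
    simp [embed_apply]
  sum_eq_one := by rw [← embed_sum, hP.sum_eq_one, embed_one]

theorem IsPVM.embed_calc {o : Type*} [Fintype o] {P : o → Matrix X X ℂ} (hP : IsPVM P)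
    (e : ι ≃ X × Y) (f : o → ℂ) :
    (hP.embed e).calc f = NetworkSelfTest.embed e (hP.calc f) := by
  simp only [IsPVM.calc_apply, embed_sum, embed_smul]

theorem IsPVM.submatrix {o : Type*} [Fintype o] {P : o → Matrix X X ℂ} (hP : IsPVM P)
    (e : ι ≃ X) : IsPVM fun a => (P a).submatrix e e where
  hermitian a := (hP.hermitian a).submatrix e
  idem a := by rw [submatrix_mul_equiv, hP.idem]
  orthogonal a b h := by
    rw [submatrix_mul_equiv, hP.orthogonal a b h]
    rfl
  sum_eq_one := by
    have := congrArg (fun T => T.submatrix e e) hP.sum_eq_one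
    rw [submatrix_one_equiv] at this
    rw [← this]
    ext u v
    simp [Matrix.sum_apply]

theorem IsPVM.reindex {o o' : Type*} [Fintype o] [Fintype o'] {P : o → Matrix X X ℂ}
    (hP : IsPVM P) (e : o' ≃ o) : IsPVM fun a => P (e a) where
  hermitian a := hP.hermitian _
  idem a := hP.idem _
  orthogonal a b h := hP.orthogonal _ _ (e.injective.ne h)
  sum_eq_one := by rw [Equiv.sum_comp e P, hP.sum_eq_one]

theorem IsPVM.mul {o o' : Type*} [Fintype o] [Fintype o'] {P : o → Matrix X X ℂ}
    {Q : o' → Matrix X X ℂ} (hP : IsPVM P) (hQ : IsPVM Q) (hc : ∀ a b, P a * Q b = Q b * P a) :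
    IsPVM fun c : o × o' => P c.1 * Q c.2 where
  hermitian c := by
    rw [IsHermitian, conjTranspose_mul, (hP.hermitian _).eq, (hQ.hermitian _).eq, hc]
  idem c := by
    rw [Matrix.mul_assoc, ← Matrix.mul_assoc (Q _), ← hc, Matrix.mul_assoc (P _) (Q _), hQ.idem,
      ← Matrix.mul_assoc, hP.idem]
  orthogonal c d h := by
    rw [Matrix.mul_assoc, ← Matrix.mul_assoc (Q _), ← hc, Matrix.mul_assoc (P _) (Q _),
      ← Matrix.mul_assoc]
    by_cases h1 : c.1 = d.1
    · rw [hQ.orthogonal _ _ fun h2 => h (Prod.ext h1 h2), Matrix.mul_zero]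
    · rw [hP.orthogonal _ _ h1, Matrix.zero_mul]
  sum_eq_one := by
    simp only [Fintype.sum_prod_type, ← Finset.mul_sum, hQ.sum_eq_one, Matrix.mul_one,
      hP.sum_eq_one]

/-- The other factors contribute their dimensions to the trace; the form without division also
covers an empty factor. -/
theorem card_mul_trace_onFactor {J : Type*} [Fintype J] [DecidableEq J] {p : J → Type*}
    [∀ j, Fintype (p j)] [∀ j, DecidableEq (p j)] (j : J) (T : Matrix (p j) (p j) ℂ) :
    (Fintype.card (p j) : ℂ) * (onFactor j T).trace = (Fintype.card (∀ j, p j) : ℂ) * T.trace := by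
  have h1 : ∀ i ∈ Finset.univ.erase j, (Function.update (fun i => (1 : Matrix (p i) (p i) ℂ)) j T
      i).trace = Fintype.card (p i) := by
    intro i hi
    rw [Function.update_of_ne (Finset.ne_of_mem_erase hi), trace_one]
  rw [onFactor, trace_tensor, ← Finset.mul_prod_erase _ _ (Finset.mem_univ j),
    Finset.prod_congr rfl h1,
    Function.update_self, Fintype.card_pi, ← Finset.mul_prod_erase _ _ (Finset.mem_univ j)]
  push_cast
  ring

end Embed

/-! ### Observables of the reference experiment -/

theorem pauli_hermitian (y : Fin 3) : (pauli y).IsHermitian := by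
  ext i j
  fin_cases y <;> fin_cases i <;> fin_cases j <;> simp [pauli]

theorem pauli_mul_self (y : Fin 3) : pauli y * pauli y = 1 := by
  ext i j
  fin_cases y <;> fin_cases i <;> fin_cases j <;> simp [pauli, mul_apply, Fin.sum_univ_two]

/-- The observables of the main parties. They are the transposes of the observables
`(σ_z ± σ_x) / √2`, `(σ_z ± σ_y) / √2`, `(σ_x ± σ_y) / √2`. -/
noncomputable def inObs : Fin 6 → Matrix (Fin 2) (Fin 2) ℂ :=
  ![(1 / rt) • (pauli 0 + pauli 1), (1 / rt) • (pauli 0 + -pauli 1),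
    (1 / rt) • (pauli 0 + -pauli 2), (1 / rt) • (pauli 0 + pauli 2),
    (1 / rt) • (pauli 1 + -pauli 2), (1 / rt) • (pauli 1 + pauli 2)]

theorem inv_rt_mul_self : (1 / rt) * (1 / rt) = 1 / 2 := by
  rw [one_div_mul_one_div, rt_mul_self]

/-- All six observables are normalised sums of two anticommuting Hermitian involutions. Hermiticity
and the square follow from this alone. -/
theorem inObs_cases {P : Matrix (Fin 2) (Fin 2) ℂ → Prop}
    (h : ∀ A B : Matrix (Fin 2) (Fin 2) ℂ, A.IsHermitian → B.IsHermitian → A * A = 1 → B * B = 1 →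
      A * B + B * A = 0 → P ((1 / rt) • (A + B))) (x : Fin 6) : P (inObs x) := by
  have hh := pauli_hermitian
  have hs := pauli_mul_self
  have h01 : pauli 0 * pauli 1 + pauli 1 * pauli 0 = 0 := by
    ext i j
    fin_cases i <;> fin_cases j <;> simp [pauli]
  have h02 : pauli 0 * pauli 2 + pauli 2 * pauli 0 = 0 := by
    ext i j
    fin_cases i <;> fin_cases j <;> simp [pauli]
  have h12 : pauli 1 * pauli 2 + pauli 2 * pauli 1 = 0 := by
    ext i j
    fin_cases i <;> fin_cases j <;> simp [pauli]
  have hneg : ∀ A B : Matrix (Fin 2) (Fin 2) ℂ, A * B + B * A = 0 → A * -B + -B * A = 0 := by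
    intro A B hAB
    rw [Matrix.mul_neg, Matrix.neg_mul, ← neg_add, hAB, neg_zero]
  have hsn : ∀ B : Matrix (Fin 2) (Fin 2) ℂ, B * B = 1 → -B * -B = 1 := by
    intro B hB
    rw [Matrix.mul_neg, Matrix.neg_mul, neg_neg, hB]
  fin_cases x
  · exact h _ _ (hh 0) (hh 1) (hs 0) (hs 1) h01
  · exact h _ _ (hh 0) (hh 1).neg (hs 0) (hsn _ (hs 1)) (hneg _ _ h01)
  · exact h _ _ (hh 0) (hh 2).neg (hs 0) (hsn _ (hs 2)) (hneg _ _ h02)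
  · exact h _ _ (hh 0) (hh 2) (hs 0) (hs 2) h02
  · exact h _ _ (hh 1) (hh 2).neg (hs 1) (hsn _ (hs 2)) (hneg _ _ h12)
  · exact h _ _ (hh 1) (hh 2) (hs 1) (hs 2) h12

theorem inObs_hermitian (x : Fin 6) : (inObs x).IsHermitian := by
  refine inObs_cases (P := fun O => O.IsHermitian) (fun A B hA hB _ _ _ => ?_) x
  have : star (1 / rt) = 1 / rt := by rw [star_div₀, star_one, star_rt]
  rw [IsHermitian, conjTranspose_smul, this, conjTranspose_add, hA.eq, hB.eq]

theorem inObs_mul_self (x : Fin 6) : inObs x * inObs x = 1 := by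
  refine inObs_cases (P := fun O => O * O = 1) (fun A B _ _ hA hB hAB => ?_) x
  rw [smul_mul_smul_comm, inv_rt_mul_self, Matrix.add_mul, Matrix.mul_add, Matrix.mul_add, hA, hB,
    add_assoc, ← add_assoc (A * B), hAB, zero_add]
  module

/-- The Bell state measurement: the joint measurement of `σ_x ⊗ σ_x` and `σ_z ⊗ σ_z`. -/
noncomputable def bell (c : Fin 2 × Fin 2) : Matrix (Fin 2 × Fin 2) (Fin 2 × Fin 2) ℂ :=
  signProj (pauli 1 ⊗ₖ pauli 1) c.1 * signProj (pauli 0 ⊗ₖ pauli 0) c.2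

theorem kronecker_self_comm :
    (pauli 1 ⊗ₖ pauli 1) * (pauli 0 ⊗ₖ pauli 0) = (pauli 0 ⊗ₖ pauli 0) * (pauli 1 ⊗ₖ pauli 1) := by
  have h : pauli 1 * pauli 0 = -(pauli 0 * pauli 1) := by
    ext i j
    fin_cases i <;> fin_cases j <;> simp [pauli, mul_apply, Fin.sum_univ_two]
  rw [← mul_kronecker_mul, ← mul_kronecker_mul, h]
  ext
  simp [kroneckerMap_apply]

theorem isPVM_bell : IsPVM bell := by
  have h1 : ∀ y, (pauli y ⊗ₖ pauli y).IsHermitian := fun y => by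
    rw [IsHermitian, conjTranspose_kronecker, (pauli_hermitian y).eq]
  have h2 : ∀ y, (pauli y ⊗ₖ pauli y) * (pauli y ⊗ₖ pauli y) = 1 := fun y => by
    rw [← mul_kronecker_mul, pauli_mul_self, one_kronecker_one]
  refine IsPVM.mul (isPVM_signProj (h1 1) (h2 1)) (isPVM_signProj (h1 0) (h2 0)) fun a b => ?_
  simp only [signProj, smul_mul_smul_comm, Matrix.add_mul, Matrix.mul_add, Matrix.one_mul,
    Matrix.mul_one, Matrix.smul_mul, Matrix.mul_smul, kronecker_self_comm]
  module

theorem trace_kronecker_mul_bell (A B : Matrix (Fin 2) (Fin 2) ℂ) (c : Fin 2 × Fin 2) :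
    ((A ⊗ₖ B) * bell c).trace = 1 / 4 * (A.trace * B.trace +
      sgn c.1 * ((A * pauli 1).trace * (B * pauli 1).trace) +
      sgn c.2 * ((A * pauli 0).trace * (B * pauli 0).trace) +
      sgn c.1 * sgn c.2 * ((A * (pauli 1 * pauli 0)).trace * (B * (pauli 1 * pauli 0)).trace)) := by
  have h : bell c = (1 / 4 : ℂ) • (1 + sgn c.1 • (pauli 1 ⊗ₖ pauli 1) +
      sgn c.2 • (pauli 0 ⊗ₖ pauli 0) +
      (sgn c.1 * sgn c.2) • ((pauli 1 * pauli 0) ⊗ₖ (pauli 1 * pauli 0))) := by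
    simp only [bell, signProj, smul_mul_smul_comm, Matrix.add_mul, Matrix.mul_add, Matrix.one_mul,
      Matrix.mul_one, mul_kronecker_mul]
    module
  rw [h]
  simp only [Matrix.mul_smul, Matrix.mul_add, Matrix.mul_one, ← mul_kronecker_mul, trace_smul,
    trace_add, trace_kronecker, smul_eq_mul]

/-- The Bell state measurement is the projection onto the teleportation vectors. -/
theorem bell_swap_apply (a : Fin 2 × Fin 2) (x x' : Fin 2 × Fin 2) :
    bell a.swap x x' = 1 / 2 * (teleU a x.1 x.2 * teleU a x'.1 x'.2) := by
  -- The bit-flip label `a.1` is the eigenvalue of `σ_z ⊗ σ_z` and the phase label `a.2` that of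
  -- `σ_x ⊗ σ_x`, the opposite order to the labels of `bell`; hence the swap.
  have h : bell a.swap = (1 / 4 : ℂ) • (1 + sgn a.2 • (pauli 1 ⊗ₖ pauli 1) +
      sgn a.1 • (pauli 0 ⊗ₖ pauli 0) +
      (sgn a.2 * sgn a.1) • ((pauli 1 * pauli 0) ⊗ₖ (pauli 1 * pauli 0))) := by
    simp only [bell, signProj, smul_mul_smul_comm, Matrix.add_mul, Matrix.mul_add, Matrix.one_mul,
      Matrix.mul_one, mul_kronecker_mul, Prod.fst_swap, Prod.snd_swap]
    module
  rw [h]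
  obtain ⟨a, b⟩ := a
  obtain ⟨x, y⟩ := x
  obtain ⟨x', y'⟩ := x'
  simp only [Matrix.smul_apply, Matrix.add_apply, kroneckerMap_apply, smul_eq_mul, one_apply,
    Prod.mk.injEq]
  fin_cases a <;> fin_cases b <;> fin_cases x <;> fin_cases y <;> fin_cases x' <;> fin_cases y' <;>
    simp [sgn, pauli, teleU, mul_apply, Fin.sum_univ_two] <;> norm_num

/-! ### The reference experiment -/

section Reference

variable {N k : ℕ}

/-- The systems of the main parties as qubits at the sites and shares of the state `ψ`. -/
def splitMain : (Fin N → Reg k × Reg k) ≃ (Site N k → Fin 2) × (Fin N → Reg k) :=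
  (Equiv.arrowProdEquivProdArrow (Fin N) (fun _ => Reg k) fun _ => Reg k).trans
    (flat.prodCongr (Equiv.refl _))

/-- The qubits of pairs of sites and the remaining qubits. -/
noncomputable def splitPairs {σ : Type*} {r : ℕ} (f : Fin r → Fin 2 → σ)
    (hf : Function.Injective fun q : Fin r × Fin 2 => f q.1 q.2) :
    (σ → Fin 2) ≃ (Fin r → Fin 2 × Fin 2) × ({s : σ // ∀ m i, s ≠ f m i} → Fin 2) :=
  Equiv.ofBijective (fun u => (fun m => (u (f m 0), u (f m 1)), fun s => u s.1)) <| by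
    classical
    constructor
    · intro u v h
      obtain ⟨h1, h2⟩ := Prod.mk.inj h
      funext s
      by_cases hs : ∀ m i, s ≠ f m i
      · exact congrFun h2 ⟨s, hs⟩
      · push Not at hs
        obtain ⟨m, i, rfl⟩ := hs
        have := Prod.mk.inj (congrFun h1 m)
        fin_cases i
        · exact this.1
        · exact this.2
    · rintro ⟨g, q⟩
      -- The preimage takes its value from `g` on the sites of pairs and from `q` elsewhere.
      -- Injectivity of `f` makes the prescription from `g` consistent.
      let u : σ → Fin 2 := fun s => if hs : ∀ m i, s ≠ f m i then q ⟨s, hs⟩ else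
        if ∃ m, s = f m 0 ∧ (g m).1 = 1 ∨ s = f m 1 ∧ (g m).2 = 1 then 1 else 0
      have h01 : ∀ x : Fin 2, (if x = 1 then (1 : Fin 2) else 0) = x := by decide
      have hinj : ∀ m i m' i', f m i = f m' i' → m = m' ∧ i = i' := fun m i m' i' h =>
        Prod.mk.inj (hf (a₁ := (m, i)) (a₂ := (m', i')) h)
      refine ⟨u, Prod.ext (funext fun m => Prod.ext ?_ ?_) (funext fun s => ?_)⟩
      · have h1 : ¬∀ m' i, f m 0 ≠ f m' i := fun h => h m 0 rfl
        have h2 : (∃ m', f m 0 = f m' 0 ∧ (g m').1 = 1 ∨ f m 0 = f m' 1 ∧ (g m').2 = 1) ↔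
            (g m).1 = 1 := by
          constructor
          · rintro ⟨m', ⟨h, h'⟩ | ⟨h, -⟩⟩
            · rwa [(hinj _ _ _ _ h).1]
            · exact absurd (hinj _ _ _ _ h).2 (by decide)
          · exact fun h => ⟨m, Or.inl ⟨rfl, h⟩⟩
        simp only [u, dif_neg h1, h2, h01]
      · have h1 : ¬∀ m' i, f m 1 ≠ f m' i := fun h => h m 1 rfl
        have h2 : (∃ m', f m 1 = f m' 0 ∧ (g m').1 = 1 ∨ f m 1 = f m' 1 ∧ (g m').2 = 1) ↔
            (g m).2 = 1 := by
          constructor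
          · rintro ⟨m', ⟨h, -⟩ | ⟨h, h'⟩⟩
            · exact absurd (hinj _ _ _ _ h).2 (by decide)
            · rwa [(hinj _ _ _ _ h).1]
          · exact fun h => ⟨m, Or.inr ⟨rfl, h⟩⟩
        simp only [u, dif_neg h1, h2, h01]
      · exact dif_pos s.2

theorem splitPairs_apply {σ : Type*} {r : ℕ} (f : Fin r → Fin 2 → σ)
    (hf : Function.Injective fun q : Fin r × Fin 2 => f q.1 q.2) (u : σ → Fin 2) :
    splitPairs f hf u = (fun m => (u (f m 0), u (f m 1)), fun s => u s.1) := rfl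

theorem onFactor_mul_onFactor_eq_embed {σ : Type*} [Fintype σ] [DecidableEq σ] {r : ℕ}
    (f : Fin r → Fin 2 → σ) (hf : Function.Injective fun q : Fin r × Fin 2 => f q.1 q.2)
    (m : Fin r) (A B : Matrix (Fin 2) (Fin 2) ℂ) :
    onFactor (p := fun _ : σ => Fin 2) (f m 0) A * onFactor (f m 1) B =
      embed (splitPairs f hf) (onFactor m (A ⊗ₖ B)) := by
  have hinj : ∀ m i m' i', f m i = f m' i' → m = m' ∧ i = i' := fun m i m' i' h =>
    Prod.mk.inj (hf (a₁ := (m, i)) (a₂ := (m', i')) h)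
  have h1 : ∀ (i : Fin 2) (C : Matrix (Fin 2) (Fin 2) ℂ)
      (D : Matrix (Fin 2 × Fin 2) (Fin 2 × Fin 2) ℂ),
      (∀ x y, D x y = if ∀ i', i' ≠ i → ![x.1, x.2] i' = ![y.1, y.2] i' then
        C (![x.1, x.2] i) (![y.1, y.2] i) else 0) →
      onFactor (p := fun _ : σ => Fin 2) (f m i) C = embed (splitPairs f hf) (onFactor m D) := by
    intro i C D hD
    ext u v
    have hu : ∀ (u : σ → Fin 2) m i, ![u (f m 0), u (f m 1)] i = u (f m i) := by
      intro u m i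
      fin_cases i <;> rfl
    rw [onFactor_apply_ite, embed_apply, onFactor_apply_ite, splitPairs_apply, splitPairs_apply]
    simp only [hD, hu, ← ite_and]
    refine if_congr ?_ rfl rfl
    constructor
    · intro h
      refine ⟨funext fun s => h s.1 (s.2 m i), fun m' hm => Prod.ext (h _ ?_) (h _ ?_),
        fun i' hi => h _ ?_⟩
      · exact fun h' => hm (hinj _ _ _ _ h').1
      · exact fun h' => hm (hinj _ _ _ _ h').1
      · exact fun h' => hi (hinj _ _ _ _ h').2
    · rintro ⟨h1, h2, h3⟩ s hs
      by_cases hs' : ∀ m i, s ≠ f m i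
      · exact congrFun h1 ⟨s, hs'⟩
      · push Not at hs'
        obtain ⟨m', i', rfl⟩ := hs'
        by_cases hm : m' = m
        · subst hm
          exact h3 i' fun h => hs (by rw [h])
        · have := Prod.mk.inj (h2 m' hm)
          fin_cases i'
          · exact this.1
          · exact this.2
  rw [h1 0 A (A ⊗ₖ 1), h1 1 B (1 ⊗ₖ B), embed_mul, onFactor_mul, ← mul_kronecker_mul,
    Matrix.mul_one, Matrix.one_mul]
  · rintro ⟨x, x'⟩ ⟨y, y'⟩
    simp [kroneckerMap_apply, one_apply]
  · rintro ⟨x, x'⟩ ⟨y, y'⟩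
    simp [kroneckerMap_apply, one_apply]

/-- Bell state measurements of pairs of sites. -/
noncomputable def pairBell {σ : Type*} [Fintype σ] [DecidableEq σ] {r : ℕ} (f : Fin r → Fin 2 → σ)
    (hf : Function.Injective fun q : Fin r × Fin 2 => f q.1 q.2) (b : Fin r → Fin 2 × Fin 2) :
    Matrix (σ → Fin 2) (σ → Fin 2) ℂ :=
  embed (splitPairs f hf) (tensor fun m => bell (b m))

theorem isPVM_pairBell {σ : Type*} [Fintype σ] [DecidableEq σ] {r : ℕ} (f : Fin r → Fin 2 → σ)
    (hf : Function.Injective fun q : Fin r × Fin 2 => f q.1 q.2) : IsPVM (pairBell f hf) :=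
  (IsPVM.tensor fun _ => isPVM_bell).embed _

theorem sum_pairBell {σ : Type*} [Fintype σ] [DecidableEq σ] {r : ℕ} (f : Fin r → Fin 2 → σ)
    (hf : Function.Injective fun q : Fin r × Fin 2 => f q.1 q.2) (m : Fin r) (c : Fin 2 × Fin 2) :
    ∑ b : Fin r → Fin 2 × Fin 2 with b m = c, pairBell f hf b =
      embed (splitPairs f hf) (onFactor m (bell c)) := by
  have h1 := IsPVM.tensor_calc (fun _ : Fin r => isPVM_bell) m (Pi.single c 1)
  rw [IsPVM.calc_single, IsPVM.calc_apply] at h1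
  rw [← h1, Finset.sum_filter, embed_sum]
  refine Finset.sum_congr rfl fun b _ => ?_
  by_cases hb : b m = c
  · rw [if_pos hb, hb, Pi.single_eq_same, one_smul, pairBell]
  · rw [if_neg hb, Pi.single_eq_of_ne hb, zero_smul]
    ext
    simp [embed_apply]

/-- Qubits outside the pair contribute only their dimension, a quarter of `2 ^ Fintype.card σ`. -/
theorem trace_pairBell {σ : Type*} [Fintype σ] [DecidableEq σ] {r : ℕ} (f : Fin r → Fin 2 → σ)
    (hf : Function.Injective fun q : Fin r × Fin 2 => f q.1 q.2) (m : Fin r) (c : Fin 2 × Fin 2)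
    (A B : Matrix (Fin 2) (Fin 2) ℂ) :
    4 * ((onFactor (p := fun _ : σ => Fin 2) (f m 0) A * onFactor (f m 1) B)ᵀ *
      ∑ b ∈ Finset.univ.filter (fun b : Fin r → Fin 2 × Fin 2 => b m = c), pairBell f hf b).trace =
      2 ^ Fintype.card σ * ((Aᵀ ⊗ₖ Bᵀ) * bell c).trace := by
  rw [onFactor_mul_onFactor_eq_embed f hf, sum_pairBell, embed_transpose, onFactor_transpose,
    embed_mul, onFactor_mul, trace_embed]
  have h1 := card_mul_trace_onFactor (p := fun _ : Fin r => Fin 2 × Fin 2) m ((A ⊗ₖ B)ᵀ * bell c)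
  have h2 := Fintype.card_congr (splitPairs f hf)
  have h3 : ((Fintype.card (σ → Fin 2) : ℕ) : ℂ) = 2 ^ Fintype.card σ := by
    rw [Fintype.card_fun, Fintype.card_fin]
    push_cast
    rfl
  have h4 : ((Fintype.card (Fin 2 × Fin 2) : ℕ) : ℂ) = 4 := by
    rw [Fintype.card_prod, Fintype.card_fin]
    norm_num
  have h5 : (A ⊗ₖ B)ᵀ = Aᵀ ⊗ₖ Bᵀ := rfl
  rw [h4] at h1
  rw [← h3, h2, Fintype.card_prod, ← mul_assoc, h1, h5]
  push_cast
  ring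

end Reference

/-! ### Realisation of the reference correlations. -/

section Reference

variable {N k : ℕ}

/-- The sites of the pairs `(0, 1), (2, 3), …`. -/
def whiteSite (m : Fin (N * k / 2)) : Fin 2 → Site N k := ![(pairWhite m).1, (pairWhite m).2]

/-- The sites of the pairs `(1, 2), (3, 4), …`. -/
def blackSite (m : Fin (N * k / 2)) : Fin 2 → Site N k := ![(pairBlack m).1, (pairBlack m).2]

theorem whiteSite_injective :
    Function.Injective fun q : Fin (N * k / 2) × Fin 2 => (whiteSite q.1 q.2 : Site N k) := by
  rintro ⟨m, i⟩ ⟨m', i'⟩ h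
  have hm := m.isLt
  have hm' := m'.isLt
  have hi : ∀ i : Fin 2, i = 0 ∨ i = 1 := by decide
  have key : m.1 = m'.1 ∧ i = i' := by
    rcases hi i with rfl | rfl <;> rcases hi i' with rfl | rfl <;>
      have h' := Experiment.siteAt_injective _ _ h <;> dsimp only at h' <;>
      first | exact ⟨by omega, rfl⟩ | omega
  exact Prod.ext (Fin.ext key.1) key.2

theorem blackSite_injective :
    Function.Injective fun q : Fin (N * k / 2) × Fin 2 => (blackSite q.1 q.2 : Site N k) := by
  rintro ⟨m, i⟩ ⟨m', i'⟩ h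
  have hm := m.isLt
  have hm' := m'.isLt
  have hi : ∀ i : Fin 2, i = 0 ∨ i = 1 := by decide
  -- The reduction modulo `N * k` acts only on the last pair, and only if the number of sites is
  -- even. It yields position `0`, which no other pair occupies.
  have hmod : ∀ m : ℕ, m < N * k / 2 → (2 * m + 2) % (N * k) = 2 * m + 2 ∧ 2 * m + 2 < N * k ∨
      (2 * m + 2) % (N * k) = 0 ∧ 2 * m + 2 = N * k := by
    intro m hm
    rcases Nat.lt_or_ge (2 * m + 2) (N * k) with hlt | hge
    · exact Or.inl ⟨Nat.mod_eq_of_lt hlt, hlt⟩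
    · have : 2 * m + 2 = N * k := by omega
      exact Or.inr ⟨by rw [this, Nat.mod_self], this⟩
  have h1 := hmod m hm
  have h2 := hmod m' hm'
  have key : m.1 = m'.1 ∧ i = i' := by
    rcases hi i with rfl | rfl <;> rcases hi i' with rfl | rfl <;>
      have h' := Experiment.siteAt_injective _ _ h <;> dsimp only at h' <;>
      first | exact ⟨by omega, rfl⟩ | omega
  exact Prod.ext (Fin.ext key.1) key.2

theorem isState_maxEntangled (k : ℕ) : IsState (maxEntangled k) := by
  have h1 : ∑ a : Fin 2 × Fin 2, star (phiPlus a.1 a.2) * phiPlus a.1 a.2 = 1 := by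
    have : star (1 / rt) * (1 / rt) = 1 / 2 := by
      rw [star_div₀, star_one, star_rt, inv_rt_mul_self]
    have h2 : ∀ a b, phiPlus a b = if a = b then 1 / rt else 0 := by
      intro a b
      simp [phiPlus, rt]
    simp only [Fintype.sum_prod_type, Fin.sum_univ_two, h2]
    simp only [if_true, this]
    simp
    norm_num
  have h2 := Finset.prod_univ_sum (fun _ : Fin k => (Finset.univ : Finset (Fin 2 × Fin 2)))
    fun _ a => star (phiPlus a.1 a.2) * phiPlus a.1 a.2
  rw [Fintype.piFinset_univ] at h2
  simp only [h1, Finset.prod_const_one] at h2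
  rw [IsState, dotProduct, ← Equiv.sum_comp (Equiv.arrowProdEquivProdArrow _ _ _), h2]
  refine Finset.sum_congr rfl fun a _ => ?_
  simp only [Pi.star_apply, maxEntangled, star_prod, Equiv.arrowProdEquivProdArrow_apply,
    Finset.prod_mul_distrib]

theorem inPVM (x : Fin k → Fin 6) :
    IsPVM fun a : Fin k → Fin 2 => tensor fun i => signProj (inObs (x i)) (a i) :=
  IsPVM.tensor fun i => isPVM_signProj (inObs_hermitian (x i)) (inObs_mul_self (x i))

/-- The reference experiment. -/
noncomputable def reference {ψ : (Fin N → Reg k) → ℂ} (hψ : IsState ψ) :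
    Experiment N k (fun _ => Reg k) (fun _ => Reg k) (fun _ => Reg k) where
  source _ := maxEntangled k
  source_isState _ := isState_maxEntangled k
  shared := ψ
  shared_isState := hψ
  main _ x a := embed (Equiv.refl _) (tensor fun i => signProj (inObs (x i)) (a i))
  main_isPVM _ x := (inPVM x).embed _
  tele _ a := (tensor fun i => bell (a i).swap).submatrix
    (Equiv.arrowProdEquivProdArrow _ _ _).symm (Equiv.arrowProdEquivProdArrow _ _ _).symm
  tele_isPVM _ := (IsPVM.tensor fun _ => isPVM_bell.reindex (Equiv.prodComm _ _)).submatrix _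
  aux y b := (tensor fun s => signProj (pauliC Complex.I (y s)) (b s)).submatrix flat flat
  aux_isPVM y := (isPVM_pauliTensor (Or.inl rfl) y).submatrix flat
  white b := (pairBell whiteSite whiteSite_injective b).submatrix flat flat
  white_isPVM := (isPVM_pairBell _ _).submatrix flat
  black b := (pairBell blackSite blackSite_injective b).submatrix flat flat
  black_isPVM := (isPVM_pairBell _ _).submatrix flat

variable {ψ : (Fin N → Reg k) → ℂ} (hψ : IsState ψ)

theorem reference_state_apply (u t v : Fin N → Reg k) :
    (reference hψ).state ((fun j => (u j, t j)), v) =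
      (if u = v then (1 / rt) ^ (N * k) else 0) * ψ t := by
  rw [← prod_maxEntangled]
  rfl

/-- The maximally entangled sources identify the label of the auxiliary party with that of the main
parties in bra and ket; their two normalisations give `(1 / 2) ^ (N * k)`. -/
theorem expect_reference (T : Matrix (Fin N → Reg k × Reg k) (Fin N → Reg k × Reg k) ℂ)
    (P : Matrix (Fin N → Reg k) (Fin N → Reg k) ℂ) :
    expect (reference hψ).state (T ⊗ₖ P) = (1 / 2) ^ (N * k) * ∑ u, ∑ u', P u u' *
      ∑ t, ∑ t', star (ψ t) * (T (fun j => (u j, t j)) (fun j => (u' j, t' j)) * ψ t') := by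
  have hsum : ∀ F : (Fin N → Reg k × Reg k) × (Fin N → Reg k) → ℂ,
      ∑ x, F x = ∑ u : Fin N → Reg k, ∑ t : Fin N → Reg k, ∑ v,
        F ((fun j => (u j, t j)), v) := by
    intro F
    rw [Fintype.sum_prod_type, ← Equiv.sum_comp (Equiv.arrowProdEquivProdArrow (Fin N)
      (fun _ => Reg k) fun _ => Reg k).symm, Fintype.sum_prod_type]
    rfl
  have h1 : ∀ (u t v : Fin N → Reg k),
      ((T ⊗ₖ P) *ᵥ (reference hψ).state) ((fun j => (u j, t j)), v) =
      (1 / rt) ^ (N * k) * ∑ u', P v u' * ∑ t', T (fun j => (u j, t j)) (fun j => (u' j, t' j)) *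
        ψ t' := by
    intro u t v
    rw [mulVec, dotProduct, hsum, Finset.mul_sum]
    refine Finset.sum_congr rfl fun u' _ => ?_
    rw [Finset.mul_sum, Finset.mul_sum]
    refine Finset.sum_congr rfl fun t' _ => ?_
    simp only [reference_state_apply, kroneckerMap_apply]
    rw [Finset.sum_eq_single u' (fun v' _ hv => by rw [if_neg hv.symm]; ring) (by simp),
      if_pos rfl]
    ring
  rw [expect, dotProduct, hsum, Finset.mul_sum]
  refine Finset.sum_congr rfl fun u _ => ?_
  simp only [Pi.star_apply, h1, reference_state_apply]
  have h2 : ∀ t, ∑ v, star ((if u = v then (1 / rt) ^ (N * k) else 0) * ψ t) *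
      ((1 / rt) ^ (N * k) * ∑ u', P v u' * ∑ t', T (fun j => (u j, t j)) (fun j => (u' j, t' j)) *
        ψ t') = (1 / 2) ^ (N * k) * ∑ u', P u u' * ∑ t', star (ψ t) *
          (T (fun j => (u j, t j)) (fun j => (u' j, t' j)) * ψ t') := by
    intro t
    rw [Finset.sum_eq_single u (fun v' _ hv => by rw [if_neg hv.symm]; simp) (by simp),
      if_pos rfl, star_mul', star_inv_rt_pow, ← inv_rt_pow_mul_self]
    simp only [← Finset.mul_sum _ _ (star (ψ t)), mul_left_comm (P u _) (star (ψ t))]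
    ring
  simp only [h2]
  rw [← Finset.mul_sum, Finset.sum_comm]
  simp only [Finset.mul_sum]

/-- Operators that do not touch the shares of `ψ` see only maximally entangled states, for which
expectations are normalised traces with one side transposed. This serves all correlations except the
tomography. -/
theorem expect_reference_embed (X : Matrix (Site N k → Fin 2) (Site N k → Fin 2) ℂ)
    (P : Matrix (Site N k → Fin 2) (Site N k → Fin 2) ℂ) :
    expect (reference hψ).state (embed splitMain X ⊗ₖ P.submatrix flat flat) =
      (1 / 2) ^ (N * k) * (Xᵀ * P).trace := by
  have h1 : ∑ t, star (ψ t) * ψ t = 1 := hψ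
  have h2 : (Xᵀ * P).trace = ∑ u, ∑ u', P u u' * X u u' := by
    simp only [Matrix.trace, diag_apply, Matrix.mul_apply, transpose_apply]
    rw [Finset.sum_comm]
    exact Finset.sum_congr rfl fun _ _ => Finset.sum_congr rfl fun _ _ => mul_comm _ _
  rw [expect_reference, h2]
  congr 1
  rw [← Equiv.sum_comp flat]
  refine Finset.sum_congr rfl fun u _ => ?_
  rw [← Equiv.sum_comp flat]
  refine Finset.sum_congr rfl fun u' _ => ?_
  have h3 : ∀ t t', embed splitMain X (fun j => (u j, t j)) (fun j => (u' j, t' j)) =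
      X (flat u) (flat u') * (1 : Matrix (Fin N → Reg k) (Fin N → Reg k) ℂ) t t' := fun _ _ => rfl
  simp only [h3, submatrix_apply]
  congr 1
  refine Eq.trans ?_ (mul_one (X (flat u) (flat u')))
  rw [← h1, Finset.mul_sum]
  refine Finset.sum_congr rfl fun t _ =>
    (Finset.sum_eq_single t (fun t' _ ht => ?_) (by simp)).trans ?_
  · rw [one_apply_ne ht.symm, mul_zero, zero_mul, mul_zero]
  · rw [one_apply_eq]
    ring

theorem reference_obsA (s : Site N k) (x : Site N k → Fin 6) :
    (reference hψ).obsA s x = embed splitMain (onFactor s (inObs (x s))) := by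
  have h1 : ∑ a : Fin k → Fin 2, sgn (a s.2) •
      (reference hψ).main s.1 (fun i => x (s.1, i)) a =
      embed (Equiv.refl (Reg k × Reg k)) (onFactor s.2 (inObs (x s))) := by
    rw [← IsPVM.calc_apply ((reference hψ).main_isPVM s.1 fun i => x (s.1, i))]
    refine ((inPVM fun i => x (s.1, i)).embed_calc (Equiv.refl (Reg k × Reg k)) _).trans ?_
    congr 1
    exact (IsPVM.tensor_calc (fun i => isPVM_signProj (inObs_hermitian (x (s.1, i)))
      (inObs_mul_self (x (s.1, i)))) s.2 sgn).trans
      (congrArg _ (signProj_calc_sgn (inObs_hermitian _) (inObs_mul_self _)))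
  rw [Experiment.obsA, h1]
  ext u v
  rw [onFactor_apply_ite, embed_apply, embed_apply, onFactor_apply_ite, onFactor_apply_ite]
  have key : ((∀ j, j ≠ s.1 → u j = v j) ∧ (u s.1).2 = (v s.1).2 ∧
      ∀ i, i ≠ s.2 → (u s.1).1 i = (v s.1).1 i) ↔
      (splitMain u).2 = (splitMain v).2 ∧ ∀ i, i ≠ s → (splitMain u).1 i = (splitMain v).1 i := by
    constructor
    · rintro ⟨h2, h3, h4⟩
      refine ⟨funext fun j => ?_, fun i hi => ?_⟩
      · by_cases hj : j = s.1
        · subst hj; exact h3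
        · exact congrArg Prod.snd (h2 j hj)
      · by_cases hj : i.1 = s.1
        · have hi2 : i.2 ≠ s.2 := fun h => hi (Prod.ext hj h)
          have := h4 i.2 hi2
          rw [← hj] at this
          exact this
        · exact congrFun (congrArg Prod.fst (h2 i.1 hj)) i.2
    · rintro ⟨h2, h3⟩
      refine ⟨fun j hj => Prod.ext (funext fun i => ?_) (congrFun h2 j), congrFun h2 s.1,
        fun i hi => h3 (s.1, i) fun h => hi (congrArg Prod.snd h)⟩
      exact h3 (j, i) fun h => hj (congrArg Prod.fst h)
  have hite : ∀ {p q r p' q' : Prop} (_ : Decidable p) (_ : Decidable q) (_ : Decidable r)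
      (_ : Decidable p') (_ : Decidable q') (_ : p ∧ q ∧ r ↔ p' ∧ q') (z : ℂ),
      (if p then if q then if r then z else 0 else 0 else 0) =
        if p' then if q' then z else 0 else 0 := by
    intro p q r p' q' _ _ _ _ _ h z
    by_cases hpq : p' ∧ q'
    · obtain ⟨h1, h2, h3⟩ := h.mpr hpq
      simp [h1, h2, h3, hpq.1, hpq.2]
    · have h' := mt h.mp hpq
      simp only [← ite_and, if_neg hpq, if_neg h']
  exact hite _ _ _ _ _ key _

theorem pauliC_I (y : Fin 3) : pauliC Complex.I y = pauli y := by
  ext i j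
  fin_cases y <;> fin_cases i <;> fin_cases j <;> simp [pauliC, pauli]

theorem reference_obsB (s : Site N k) (y : Site N k → Fin 3) :
    (reference hψ).obsB s y = (onFactor s (pauli (y s))).submatrix flat flat := by
  have h1 : ∑ b : Site N k → Fin 2, sgn (b s) •
      (tensor fun s => signProj (pauliC Complex.I (y s)) (b s)) =
      onFactor s (pauli (y s)) := by
    rw [← IsPVM.calc_apply (isPVM_pauliTensor (Or.inl rfl) y)]
    refine (IsPVM.tensor_calc (fun s => isPVM_pauliC (Or.inl rfl) (y s)) s sgn).trans ?_
    refine (congrArg _ (signProj_calc_sgn (pauliC_hermitian (Or.inl rfl) _)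
      (pauliC_mul_self (Or.inl rfl) _))).trans ?_
    rw [pauliC_I]
  rw [← h1]
  ext u v
  simp [Experiment.obsB, reference, Matrix.sum_apply]

theorem reference_corr (s : Site N k) (x : Site N k → Fin 6) (y : Site N k → Fin 3) :
    (reference hψ).corr s x y = 1 / 2 * ((inObs (x s))ᵀ * pauli (y s)).trace := by
  rw [Experiment.corr, reference_obsA, reference_obsB, expect_reference_embed, onFactor_transpose,
    onFactor_mul]
  have h1 := card_mul_trace_onFactor (p := fun _ : Site N k => Fin 2) s
    ((inObs (x s))ᵀ * pauli (y s))
  have h2 : ((Fintype.card (Site N k → Fin 2) : ℕ) : ℂ) = 2 ^ (N * k) := by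
    simp only [Fintype.card_fun, Fintype.card_prod, Fintype.card_fin]
    push_cast
    rfl
  rw [h2, Fintype.card_fin] at h1
  have h3 : (1 / 2 : ℂ) ^ (N * k) * 2 ^ (N * k) = 1 := by rw [← mul_pow]; norm_num
  push_cast at h1
  linear_combination (1 / 2) ^ (N * k) * (1 / 2) * h1 +
    1 / 2 * ((inObs (x s))ᵀ * pauli (y s)).trace * h3

theorem reference_maximalCHSH : (reference hψ).MaximalCHSH := by
  intro s x y hx hy
  -- In the form `2 / √2 = √2`, so that both sides of the CHSH identity become multiples of `1 /
  -- rt`.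
  have hr : (1 / rt) * (rt * rt) = rt := by rw [← mul_assoc, one_div_mul_cancel rt_ne_zero, one_mul]
  rw [rt_mul_self] at hr
  have h6 : ((6 * Real.sqrt 2 : ℝ) : ℂ) = 6 * rt := by rw [rt]; push_cast; rfl
  simp only [Experiment.CHSH, reference_corr, hx, hy, h6]
  rw [← hr]
  simp [inObs, pauli, Matrix.trace, Fin.sum_univ_two, mul_apply]
  linear_combination (-4 * rt⁻¹) * Complex.I_mul_I

theorem sum_pairBell_submatrix {r : ℕ} (f : Fin r → Fin 2 → Site N k)
    (hf : Function.Injective fun q : Fin r × Fin 2 => f q.1 q.2) (m : Fin r) (c : Fin 2 × Fin 2) :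
    ∑ b with b m = c, (pairBell f hf b).submatrix flat flat =
      (∑ b with b m = c, pairBell f hf b).submatrix flat flat := by
  ext u v
  simp only [Matrix.sum_apply, submatrix_apply]

theorem reference_pairCorr {f : Fin (N * k / 2) → Fin 2 → Site N k}
    (hf : Function.Injective fun q : Fin (N * k / 2) × Fin 2 => f q.1 q.2) (m : Fin (N * k / 2))
    (c : Fin 2 × Fin 2) (x : Site N k → Fin 6) (p q : Fin 6) :
    (reference hψ).pairCorr (f m 0) (f m 1) x p q
      (Experiment.marginal (fun b => (pairBell f hf b).submatrix flat flat) m c) =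
      1 / 4 * (((inObs p)ᵀ ⊗ₖ (inObs q)ᵀ) * bell c).trace := by
  have hne : f m 0 ≠ f m 1 := fun h =>
    absurd (Prod.mk.inj (hf (a₁ := (m, 0)) (a₂ := (m, 1)) h)).2 (by decide)
  rw [Experiment.pairCorr, Experiment.marginal, sum_pairBell_submatrix, reference_obsA,
    reference_obsA, Function.update_of_ne hne, Function.update_self, Function.update_self,
    embed_mul, expect_reference_embed]
  have h1 := trace_pairBell f hf m c (inObs p) (inObs q)
  have h2 : Fintype.card (Site N k) = N * k := by simp
  rw [h2] at h1
  have h3 : (1 / 2 : ℂ) ^ (N * k) * 2 ^ (N * k) = 1 := by rw [← mul_pow]; norm_num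
  linear_combination (1 / 2) ^ (N * k) * (1 / 4) * h1 +
    1 / 4 * (((inObs p)ᵀ ⊗ₖ (inObs q)ᵀ) * bell c).trace * h3

theorem reference_aligned {f : Fin (N * k / 2) → Fin 2 → Site N k}
    (hf : Function.Injective fun q : Fin (N * k / 2) × Fin 2 => f q.1 q.2) (m : Fin (N * k / 2))
    (c : Fin 2 × Fin 2) :
    (reference hψ).Aligned (f m 0) (f m 1) c
      (Experiment.marginal (fun b => (pairBell f hf b).submatrix flat flat) m c) := by
  intro x
  simp only [Experiment.alignCorr, reference_pairCorr, trace_kronecker_mul_bell]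
  have hr : rt⁻¹ * rt⁻¹ = 1 / 2 := by
    have := inv_rt_mul_self
    rwa [one_div] at this
  have hI := Complex.I_mul_I
  refine ⟨?_, ?_, ?_⟩ <;>
    simp [inObs, pauli, Matrix.trace, Fin.sum_univ_two, mul_apply]
  · linear_combination sgn c.2 / 2 * hr
  · linear_combination sgn c.1 / 2 * hr
  · linear_combination sgn c.1 * sgn c.2 / 2 * Complex.I * Complex.I * hr +
      sgn c.1 * sgn c.2 / 4 * hI

/-- By `bell_swap_apply`, a Bell projector is the rank-one projector with amplitudes proportional to
those of `teleU`. Contracting it with the sources and the shares applies `teleAll a` to `ψ` on the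
side of the auxiliary party. -/
theorem reference_tomography : (reference hψ).TeleportationTomography ψ := by
  intro a y b
  have h1 : ∀ u t u' t' : Fin N → Reg k, (tensor fun j => (reference hψ).tele j (a j))
      (fun j => (u j, t j)) (fun j => (u' j, t' j)) =
      (1 / 2) ^ (N * k) * (teleAll a u t * teleAll a u' t') := by
    intro u t u' t'
    have h2 : ∀ j, (reference hψ).tele j (a j) (u j, t j) (u' j, t' j) =
        ∏ i, 1 / 2 * (teleU (a j i) (u j i) (t j i) * teleU (a j i) (u' j i) (t' j i)) := by
      intro j
      have h3 : (reference hψ).tele j (a j) (u j, t j) (u' j, t' j) =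
          ∏ i, bell (a j i).swap (u j i, t j i) (u' j i, t' j i) := rfl
      simp only [h3, bell_swap_apply]
    simp only [tensor, h2, teleAll, Finset.prod_mul_distrib, Finset.prod_const, Finset.card_univ,
      Fintype.card_fin]
    rw [← pow_mul, mul_comm k]
  have h3 : (reference hψ).aux y b = pauliAll y b := by
    ext u v
    rw [pauliAll_apply]
    simp only [← signProj_pauliC_I]
    rfl
  have h4 : (1 / 2 : ℂ) ^ (N * k) * (1 / 2) ^ (N * k) = 1 / 4 ^ (N * k) := by
    rw [← mul_pow, show (1 / 2 : ℂ) * (1 / 2) = 1 / 4 by norm_num, _root_.one_div_pow]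
  have h5 : ∀ u, star ((teleAll a *ᵥ ψ) u) = ∑ t, teleAll a u t * star (ψ t) := fun u =>
    congrFun (star_teleAll_mulVec a ψ) u
  rw [expect_tele, expect_reference, h3, ← h4, mul_assoc]
  congr 1
  rw [Finset.mul_sum]
  refine Finset.sum_congr rfl fun u _ => ?_
  rw [Finset.mul_sum]
  refine Finset.sum_congr rfl fun u' _ => ?_
  rw [mul_left_comm]
  congr 1
  rw [h5, mulVec, dotProduct, Finset.sum_mul_sum, Finset.mul_sum]
  refine Finset.sum_congr rfl fun t _ => ?_
  rw [Finset.mul_sum]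
  refine Finset.sum_congr rfl fun t' _ => ?_
  rw [h1]
  ring

theorem reference_reproduces : (reference hψ).Reproduces ψ :=
  ⟨reference_maximalCHSH hψ, fun m c => ⟨reference_aligned hψ whiteSite_injective m c,
    reference_aligned hψ blackSite_injective m c⟩, reference_tomography hψ⟩

end Reference

end NetworkSelfTest

theorem theorem2 (N k : ℕ) (ψ : (Fin N → Reg k) → ℂ) (hψ : IsState ψ) :
    (∃ R : Experiment N k (fun _ => Reg k) (fun _ => Reg k) (fun _ => Reg k),
      (∀ j, R.source j = maxEntangled k) ∧ R.shared = ψ ∧ R.Reproduces ψ) ∧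
    ∀ (α τ β : Fin N → Type*)
      [∀ j, Fintype (α j)] [∀ j, DecidableEq (α j)]
      [∀ j, Fintype (τ j)] [∀ j, DecidableEq (τ j)]
      [∀ j, Fintype (β j)] [∀ j, DecidableEq (β j)]
      (R : Experiment N k α τ β),
      R.Reproduces ψ → R.Extracts ψ ∨ R.Extracts (star ψ) := by
  refine ⟨⟨reference hψ, fun _ => rfl, rfl, reference_reproduces hψ⟩, ?_⟩
  intro α τ β _ _ _ _ _ _ R hR
  exact R.extracts_of_reproduces hψ hR
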